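/- \textbf{Setting.} Let $X$ be a complex manifold of dimension $n+1$, $\Delta\subset\mathbb C$ the unit disk, and $f:X\to\Delta$ a proper holomorphic map that is submersive away from $f^{-1}(0)$, whose central fibre $Y=f^{-1}(0)=\sum_{i\in I}e_iY_i$ is a (possibly non-reduced) simple normal crossing divisor: $I$ is finite, the $Y_i$ are connected and closed, $e_i\ge 1$, and near each point of $Y$ there are coordinates in which the $Y_i$ through that point are distinct coordinate hyperplanes $z_{\sigma(i)}=0$ and $t:=f=\prod z_{\sigma(i)}^{e_i}$ (product over the $Y_i$ through that point). Let $\mathscr T_X(-\log Y)$ be the sheaf of vector fields preserving the ideal $(t)$, $\mathscr T_{X/\Delta}(\log Y)$ the subsheaf of those that kill $t$, let $\Omega^p_X(\log Y)$, $\Omega^p_{X/\Delta}(\log Y)$ be the sheaves of $p$-forms dual to them, and let $\mathscr D_X$ be the sheaf of holomorphic differential operators with its order filtration $F_\bullet\mathscr D_X$. Let $\mathcal M$ be the right $\mathscr D_X$-module $$\mathcal M=\operatorname{coker}\bigl(\Omega^{n-1}_{X/\Delta}(\log Y)|_Y\otimes\mathscr D_X\xrightarrow{\,d\,}\Omega^{n}_{X/\Delta}(\log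 Y)|_Y\otimes\mathscr D_X\bigr),$$ where $|_Y$ is reduction modulo left multiplication by $t$; let $F_\ell\mathcal M$ be the image of $\Omega^n_{X/\Delta}(\log Y)|_Y\otimes F_{\ell+n}\mathscr D_X$; and let $R:\mathcal M\to\mathcal M$ be the $\mathscr D_X$-linear endomorphism $[\alpha]\mapsto[(\tfrac{dt}{t}\wedge)^{-1}d\alpha]$, i.e. $R[\alpha]=[\beta]$ whenever $\alpha,\beta\in\Omega^n_X(\log Y)\otimes\mathscr D_X$ satisfy $d\alpha=\tfrac{dt}{t}\wedge\beta$ (these conditions determine a unique well-defined $R$; this is part of the assertion). For $\alpha\in\mathbb R$ let $\mathcal M_{\ge\alpha}$ (resp. $\mathcal M_{>\alpha}$) be the sum of the $\ker(R-\lambda)^\infty$ over real $\lambda\ge\alpha$ (resp. $\lambda>\alpha$), put $\mathcal M_\alpha=\mathcal M_{\ge\alpha}/\mathcal M_{>\alpha}$, let $R_\alpha$ be the endomorphism of $\mathcal M_\alpha$ induced by $R-\alpha$, and let $F_\ell\mathcal M_\alpha$ be the image of $F_\ell\mathcal M\cap\mathcal M_{\ge\alpha}$ in $\mathcal M_\alpha$.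 For a nilpotent endomorphism $N$ of a filtered module $(\mathcal G,F_\bullet)$ let $$W_r\mathcal G=\sum_{j\ge0}N^j\ker N^{r+2j+1}\qquad(\ker N^m=0\text{ for }m\le0)$$ be its weight (monodromy) filtration; let $F_\ell\,\mathrm{gr}^W_r\mathcal G$ be the image of $F_\ell\mathcal G\cap W_r\mathcal G$, and for $r\ge0$ let $\mathcal P_r=\ker\bigl(N^{r+1}:\mathrm{gr}^W_r\mathcal G\to\mathrm{gr}^W_{-r-2}\mathcal G\bigr)$ and let $F_\ell\mathcal P_r$ be the image of $F_\ell\mathcal G\cap\ker N^{r+1}$. \textbf{Theorem.} For every $\alpha\in\mathbb R$ the endomorphism $N=R_\alpha$ of $(\mathcal G,F_\bullet)=(\mathcal M_\alpha,F_\bullet\mathcal M_\alpha)$ is nilpotent, $NF_b\mathcal G\subseteq F_{b+1}\mathcal G$, and the following hold. \begin{enumerate} \item Every power of $N$ is strict: $N^aF_b\mathcal G=F_{a+b}\mathcal G\cap N^a\mathcal G$ for all $a\ge0$, $b\in\mathbb Z$. \item $W_\bullet$ is increasing, with $W_r=\mathcal G$ for some $r$ and $W_r=0$ for some $r$; for every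 $r\ge0$ and $\ell\in\mathbb Z$, $N^r$ induces isomorphisms $\mathrm{gr}^W_r\mathcal G\to\mathrm{gr}^W_{-r}\mathcal G$ and $F_\ell\,\mathrm{gr}^W_r\mathcal G\to F_{\ell+r}\,\mathrm{gr}^W_{-r}\mathcal G$. \item For $r\ge 0$, $\mathcal P_r$ is the image of $\ker N^{r+1}$, so that $\mathcal P_r\cong\ker N^{r+1}/(\ker N^r+N\ker N^{r+2})$; and $F_\ell\mathcal P_r=\mathcal P_r\cap F_\ell\,\mathrm{gr}^W_r\mathcal G$ for all $\ell$. For all $r,b\in\mathbb Z$ the Lefschetz decomposition respects the filtrations: $$\mathrm{gr}^W_r\mathcal G=\bigoplus_{j\ge\max(0,-r/2)}N^j\mathcal P_{r+2j},\qquad F_b\,\mathrm{gr}^W_r\mathcal G=\bigoplus_{j\ge\max(0,-r/2)}N^jF_{b-j}\mathcal P_{r+2j}.$$ \end{enumerate} If $Y$ is reduced (all $e_i=1$), the same statements hold for $(\mathcal G,F_\bullet)=(\mathcal M,F_\bullet\mathcal M)$ and $N=R$. All equalities of subsheaves, isomorphisms and direct sums are understood at the stalk of every point $x\in X$. -/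

import Mathlib

open scoped Manifold ContDiff Topology

/-! ## Linear algebra: an endomorphism of a filtered module -/

namespace FilteredEnd

section Weight

variable {S G : Type*} [Ring S] [AddCommGroup G] [Module S G]

/-- The weight (monodromy) filtration of a nilpotent endomorphism `N`, by the usual formula
`W_r = ∑_{j ≥ 0} N^j (ker N^(r + 2j + 1))`, where `ker N^m = 0` for `m ≤ 0`. -/
def weight (N : Module.End S G) (r : ℤ) : Submodule S G :=
  ⨆ j : ℕ, (LinearMap.ker (N ^ (r + 2 * j + 1).toNat)).map (N ^ j)

theorem pow_mem_weight (N : Module.End S G) (k : ℕ) {r s : ℤ} (h : s = r - 2 * k) {x : G}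
    (hx : x ∈ weight N r) : (N ^ k) x ∈ weight N s := by
  subst h
  have key : (weight N r).map (N ^ k) ≤ weight N (r - 2 * k) := by
    rw [weight, Submodule.map_iSup]
    refine iSup_le fun j => ?_
    refine le_trans ?_ (le_iSup _ (k + j))
    rw [← Submodule.map_comp, show (N ^ k).comp (N ^ j) = N ^ (k + j) from (pow_add N k j).symm]
    have : r - 2 * (k : ℤ) + 2 * ((k + j : ℕ) : ℤ) + 1 = r + 2 * j + 1 := by push_cast; ring
    rw [this]
  exact key ⟨x, hx, rfl⟩

/-- `gr^W_r = W_r / W_{r-1}`. -/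
abbrev Gr (N : Module.End S G) (r : ℤ) : Type _ :=
  weight N r ⧸ (weight N (r - 1)).submoduleOf (weight N r)

/-- The map `gr^W_r → gr^W_{r - 2k}` induced by `N^k`. -/
def grPow (N : Module.End S G) (k : ℕ) {r s : ℤ} (h : s = r - 2 * k) : Gr N r →ₗ[S] Gr N s :=
  Submodule.mapQ _ _ ((N ^ k).restrict fun _ hx => pow_mem_weight N k h hx)
    (fun x hx => pow_mem_weight N k (r := r - 1) (s := s - 1) (by rw [h]; ring) (x := (x : G)) hx)

/-- The filtration `F_ℓ gr^W_r` induced by `F_ℓ W_r = F_ℓ ∩ W_r`. -/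
def grF (F : ℤ → AddSubgroup G) (N : Module.End S G) (ℓ r : ℤ) : AddSubgroup (Gr N r) :=
  ((F ℓ).comap (weight N r).subtype.toAddMonoidHom).map
    ((weight N (r - 1)).submoduleOf (weight N r)).mkQ.toAddMonoidHom

/-- The primitive part `ker (N^(r+1) : gr^W_r → gr^W_{-r-2})` of `gr^W_r`, used for `r ≥ 0`. -/
def prim (N : Module.End S G) (r : ℤ) : Submodule S (Gr N r) :=
  LinearMap.ker (grPow N (r.toNat + 1) (rfl : r - 2 * ((r.toNat + 1 : ℕ) : ℤ) = _))

/-- For `r ≥ 0`, the image in `gr^W_r` of `F_ℓ ∩ ker N^(r+1)` (note `ker N^(r+1) ⊆ W_r`):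
the filtration of the primitive part. -/
def primF (F : ℤ → AddSubgroup G) (N : Module.End S G) (ℓ r : ℤ) : AddSubgroup (Gr N r) :=
  ((F ℓ ⊓ (LinearMap.ker (N ^ (r.toNat + 1))).toAddSubgroup).comap
    (weight N r).subtype.toAddMonoidHom).map
    ((weight N (r - 1)).submoduleOf (weight N r)).mkQ.toAddMonoidHom

/-- All powers of the nilpotent endomorphism `N` are strict for the filtration `F`, where
`N F_b ⊆ F_{b+1}`; the powers of `N` give filtered isomorphisms between the graded quotients of
the weight filtration; and the Lefschetz decomposition respects the filtrations. -/
structure StrictLefschetz (F : ℤ → AddSubgroup G) (N : Module.End S G) : Prop where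
  nilpotent : IsNilpotent N
  map_le : ∀ b : ℤ, (F b).map N.toAddMonoidHom ≤ F (b + 1)
  /-- `N^a F_b = F_{a+b} ∩ N^a G`. -/
  strict : ∀ (a : ℕ) (b : ℤ), (F b).map (N ^ a).toAddMonoidHom =
    F (a + b) ⊓ (LinearMap.range (N ^ a)).toAddSubgroup
  /-- `W` is increasing, exhaustive, and zero in small degrees. -/
  weight_mono : Monotone (weight N)
  weight_top : ∃ r, weight N r = ⊤
  weight_bot : ∃ r, weight N r = ⊥
  /-- `N^r : gr^W_r ≅ gr^W_{-r}`. -/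
  gr_bijective : ∀ r : ℕ, Function.Bijective
    (grPow N r (show (-r : ℤ) = (r : ℤ) - 2 * (r : ℤ) by ring))
  /-- `N^r : F_ℓ gr^W_r ≅ F_{ℓ+r} gr^W_{-r}`. -/
  gr_bijOn : ∀ (r : ℕ) (ℓ : ℤ), Set.BijOn
    (grPow N r (show (-r : ℤ) = (r : ℤ) - 2 * (r : ℤ) by ring))
    (grF F N ℓ r) (grF F N (ℓ + r) (-r))
  /-- The primitive part of `gr^W_r` is the image of `ker N^(r+1)`. -/
  prim_eq : ∀ r : ℕ, ((LinearMap.ker (N ^ (r + 1))).submoduleOf (weight N r)).map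
    ((weight N ((r : ℤ) - 1)).submoduleOf (weight N r)).mkQ = prim N r
  /-- Hence it is `ker N^(r+1) / (ker N^r + N (ker N^(r+2)))`. -/
  prim_quotient : ∀ r : ℕ, LinearMap.ker (N ^ (r + 1)) ⊓ weight N ((r : ℤ) - 1) =
    LinearMap.ker (N ^ r) ⊔ (LinearMap.ker (N ^ (r + 2))).map N
  /-- The filtration `primF` of the primitive part is also the one induced from `gr^W_r`. -/
  primF_eq : ∀ (r : ℕ) (ℓ : ℤ), primF F N ℓ r = grF F N ℓ r ⊓ (prim N r).toAddSubgroup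
  /-- The Lefschetz decomposition
  `gr^W_r = ⨁_{j ≥ 0, j ≥ -r/2} N^j P_{r+2j}` for every integer `r`. -/
  lefschetz_indep : ∀ r : ℤ, iSupIndep fun j : {j : ℕ // 0 ≤ r + 2 * (j : ℤ)} =>
    (prim N (r + 2 * ((j : ℕ) : ℤ))).map
      (grPow N j (show r = r + 2 * ((j : ℕ) : ℤ) - 2 * ((j : ℕ) : ℤ) by ring))
  lefschetz_top : ∀ r : ℤ, ⨆ j : {j : ℕ // 0 ≤ r + 2 * (j : ℤ)},
    (prim N (r + 2 * ((j : ℕ) : ℤ))).map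
      (grPow N j (show r = r + 2 * ((j : ℕ) : ℤ) - 2 * ((j : ℕ) : ℤ) by ring)) = ⊤
  /-- The filtered Lefschetz decomposition
  `F_b gr^W_r = ⨁_{j ≥ 0, j ≥ -r/2} N^j F_{b-j} P_{r+2j}` for all integers `b`, `r`
  (the sum is direct by `lefschetz_indep` and `primF_eq`). -/
  lefschetz_F : ∀ b r : ℤ, grF F N b r = ⨆ j : {j : ℕ // 0 ≤ r + 2 * (j : ℤ)},
    (primF F N (b - ((j : ℕ) : ℤ)) (r + 2 * ((j : ℕ) : ℤ))).map
      (grPow N j (show r = r + 2 * ((j : ℕ) : ℤ) - 2 * ((j : ℕ) : ℤ) by ring)).toAddMonoidHom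

end Weight

section Eigen

variable {S G : Type*} [Ring S] [Algebra ℂ S] [AddCommGroup G] [Module S G] [Module ℂ G]
  [IsScalarTower ℂ S G] [SMulCommClass S ℂ G]

/-- `R - c`. -/
def shift (R : Module.End S G) (c : ℂ) : Module.End S G := R - algebraMap ℂ (Module.End S G) c

theorem shift_comm (R : Module.End S G) (c d : ℂ) : Commute (shift R c) (shift R d) := by
  unfold shift
  exact ((Commute.refl R).sub_left (Algebra.commutes c R)).sub_right
    ((Algebra.commutes d _).symm)

/-- `ker (R - c)^∞`. -/
def genEig (R : Module.End S G) (c : ℂ) : Submodule S G :=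
  ⨆ k : ℕ, LinearMap.ker (shift R c ^ k)

/-- `G_{≥ a}`: the sum of the `ker (R - b)^∞` over the real numbers `b ≥ a`. -/
def geEig (R : Module.End S G) (a : ℝ) : Submodule S G := ⨆ b : Set.Ici a, genEig R ((b : ℝ) : ℂ)

/-- `G_{> a}`: the sum of the `ker (R - b)^∞` over the real numbers `b > a`. -/
def gtEig (R : Module.End S G) (a : ℝ) : Submodule S G := ⨆ b : Set.Ioi a, genEig R ((b : ℝ) : ℂ)

theorem genEig_map (R : Module.End S G) (c d : ℂ) : (genEig R d).map (shift R c) ≤ genEig R d := by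
  rw [genEig, Submodule.map_iSup]
  refine iSup_mono fun k => ?_
  rintro _ ⟨x, hx, rfl⟩
  have h : Commute (shift R d ^ k) (shift R c) := (shift_comm R d c).pow_left k
  have h' := congrArg (fun T : Module.End S G => T x) h.eq
  simp only [Module.End.mul_apply] at h'
  rw [LinearMap.mem_ker, h', LinearMap.mem_ker.1 hx, map_zero]

theorem shift_mem_geEig (R : Module.End S G) (a : ℝ) (c : ℂ) {x : G} (hx : x ∈ geEig R a) :
    shift R c x ∈ geEig R a := by
  have key : (geEig R a).map (shift R c) ≤ geEig R a := by
    rw [geEig, Submodule.map_iSup]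
    exact iSup_mono fun b => genEig_map R c _
  exact key ⟨x, hx, rfl⟩

theorem shift_mem_gtEig (R : Module.End S G) (a : ℝ) (c : ℂ) {x : G} (hx : x ∈ gtEig R a) :
    shift R c x ∈ gtEig R a := by
  have key : (gtEig R a).map (shift R c) ≤ gtEig R a := by
    rw [gtEig, Submodule.map_iSup]
    exact iSup_mono fun b => genEig_map R c _
  exact key ⟨x, hx, rfl⟩

/-- The generalized eigenmodule `G_a = G_{≥ a} / G_{> a}`. -/
abbrev EigMod (R : Module.End S G) (a : ℝ) : Type _ :=
  geEig R a ⧸ (gtEig R a).submoduleOf (geEig R a)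

/-- The endomorphism `R_a` of `G_a` induced by `R - a`. -/
def eigEnd (R : Module.End S G) (a : ℝ) : Module.End S (EigMod R a) :=
  Submodule.mapQ _ _ ((shift R (a : ℂ)).restrict fun _ hx => shift_mem_geEig R a _ hx)
    (fun x hx => shift_mem_gtEig R a _ (x := (x : G)) hx)

/-- The filtration of `G_a` as a subquotient of `(G, F)`:
`F_ℓ G_a` is the image of `F_ℓ ∩ G_{≥ a}`. -/
def eigF (F : ℤ → AddSubgroup G) (R : Module.End S G) (a : ℝ) (ℓ : ℤ) :
    AddSubgroup (EigMod R a) :=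
  ((F ℓ).comap (geEig R a).subtype.toAddMonoidHom).map
    ((gtEig R a).submoduleOf (geEig R a)).mkQ.toAddMonoidHom

end Eigen

end FilteredEnd

/-! ## Differential operators and the relative logarithmic de Rham complex of a `ℂ`-algebra -/

namespace LogDeRham

section Ops

variable (A : Type*) [CommRing A] [Algebra ℂ A]

/-- The multiplication operators `A ⊆ End_ℂ(A)`. -/
def mulOps : Submodule ℂ (Module.End ℂ A) := LinearMap.range (LinearMap.mul ℂ A)

/-- The derivations `Der_ℂ(A) ⊆ End_ℂ(A)`. -/
def derOps : Submodule ℂ (Module.End ℂ A) :=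
  Submodule.span ℂ (Set.range fun δ : Derivation ℂ A A => (δ : A →ₗ[ℂ] A))

/-- The ring `D` of differential operators: the subalgebra of `End_ℂ(A)` generated by `A` and
`Der_ℂ(A)`. -/
def diffOps : Subalgebra ℂ (Module.End ℂ A) :=
  Algebra.adjoin ℂ ((mulOps A : Set (Module.End ℂ A)) ∪ derOps A)

/-- The operators of order at most `m`: `F_m D = A · (A + Der_ℂ(A))^m` for `m ≥ 0`, and
`F_m D = 0` for `m < 0`. -/
def orderLE (m : ℤ) : Submodule ℂ (Module.End ℂ A) :=
  if 0 ≤ m then mulOps A * (mulOps A ⊔ derOps A) ^ m.toNat else ⊥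

/-- The ring `D` of differential operators, as a type. -/
def D : Type _ := diffOps A

instance : Ring (D A) := inferInstanceAs (Ring (diffOps A))

instance : Algebra ℂ (D A) := inferInstanceAs (Algebra ℂ (diffOps A))

/-- The inclusion `D ⊆ End_ℂ(A)`. -/
def toEnd : D A →ₐ[ℂ] Module.End ℂ A := (diffOps A).val

variable {A}

theorem toEnd_injective : Function.Injective (toEnd A) := Subtype.val_injective

/-- A function as a differential operator. -/
def ofFun (a : A) : D A := ⟨LinearMap.mul ℂ A a, Algebra.subset_adjoin (Or.inl ⟨a, rfl⟩)⟩

/-- A derivation as a differential operator. -/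
def ofDer (δ : Derivation ℂ A A) : D A :=
  ⟨(δ : A →ₗ[ℂ] A), Algebra.subset_adjoin (Or.inr (Submodule.subset_span ⟨δ, rfl⟩))⟩

/-- The left `A`-module structure of `D`: `a • P` is the operator `g ↦ a * P g`. -/
instance : Module A (D A) where
  smul a P := ofFun a * P
  one_smul P := toEnd_injective (LinearMap.ext fun g => one_mul (toEnd A P g))
  mul_smul a b P := toEnd_injective (LinearMap.ext fun g => mul_assoc a b (toEnd A P g))
  smul_zero a := mul_zero (ofFun a)
  smul_add a P Q := mul_add (ofFun a) P Q
  add_smul a b P := toEnd_injective (LinearMap.ext fun g => add_mul a b (toEnd A P g))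
  zero_smul P := toEnd_injective (LinearMap.ext fun g => zero_mul (toEnd A P g))

theorem smul_def (a : A) (P : D A) : a • P = ofFun a * P := rfl

instance : SMulCommClass A (D A)ᵐᵒᵖ (D A) where
  smul_comm a Q P := (mul_assoc (ofFun a) P Q.unop).symm

instance : SMulCommClass A ℂ (D A) where
  smul_comm a c P := mul_smul_comm c (ofFun a) P

end Ops

section Complex

variable {A : Type*} [CommRing A] [Algebra ℂ A]

/-- The logarithmic vector fields `T(-log t)`: the derivations that preserve the ideal `(t)`. -/
def logT (t : A) : Submodule A (Derivation ℂ A A) where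
  carrier := {δ | t ∣ δ t}
  add_mem' := fun h h' => dvd_add h h'
  zero_mem' := dvd_zero t
  smul_mem' := fun c _ h => dvd_mul_of_dvd_right h c

/-- The relative logarithmic vector fields `T_{rel}(log t)`: the derivations that kill `t`. -/
def relT (t : A) : Submodule A (Derivation ℂ A A) where
  carrier := {δ | δ t = 0}
  add_mem' := fun {δ η} (h : δ t = 0) (h' : η t = 0) => by simp [h, h']
  zero_mem' := rfl
  smul_mem' := fun c δ (h : δ t = 0) => by simp [h]

theorem relT_le_logT (t : A) : relT t ≤ logT t := fun δ (h : δ t = 0) => by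
  change t ∣ δ t
  rw [h]; exact dvd_zero t

theorem lie_mem_logT (t : A) {δ η : Derivation ℂ A A} (h : δ ∈ logT t) (h' : η ∈ logT t) :
    ⁅δ, η⁆ ∈ logT t := by
  obtain ⟨a, ha⟩ := h
  obtain ⟨b, hb⟩ := h'
  change t ∣ ⁅δ, η⁆ t
  rw [Derivation.commutator_apply, ha, hb, Derivation.leibniz, Derivation.leibniz, ha, hb]
  simp only [smul_eq_mul]
  exact ⟨δ b - η a, by ring⟩

theorem lie_mem_relT (t : A) {δ η : Derivation ℂ A A} (h : δ ∈ relT t) (h' : η ∈ relT t) :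
    ⁅δ, η⁆ ∈ relT t := by
  change ⁅δ, η⁆ t = 0
  rw [Derivation.commutator_apply, show η t = 0 from h', show δ t = 0 from h, map_zero, map_zero,
    sub_zero]

/-- The logarithmic form `dt/t` on `T(-log t)`: `δ t = t * dlog δ`. -/
noncomputable def dlog (t : A) (δ : logT t) : A := Classical.choose δ.2

theorem dlog_spec (t : A) (δ : logT t) : (δ : Derivation ℂ A A) t = t * dlog t δ :=
  Classical.choose_spec δ.2

/-- `Ω^p ⊗ D`: the `A`-multilinear alternating `p`-forms with values in `D` on a module `L` of
vector fields. For `L = T(-log t)` these are the logarithmic forms `Ω^p(log) ⊗ D`, and for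
`L = T_{rel}(log t)` the relative logarithmic forms `Ω^p_{rel}(log) ⊗ D` (in the situation of a
normal crossing divisor, where `T(-log t)` and `T_{rel}(log t)` are free of finite rank, with
duals `Ω^1(log)` and `Ω^1_{rel}(log) = Ω^1(log) / A dt/t`). It is a right `D`-module. -/
abbrev Form (L : Submodule A (Derivation ℂ A A)) (p : ℕ) : Type _ := L [⋀^Fin p]→ₗ[A] D A

instance (L : Submodule A (Derivation ℂ A A)) (p : ℕ) :
    IsScalarTower ℂ (D A)ᵐᵒᵖ (Form L p) where
  smul_assoc c Q α := by
    ext ξ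
    exact mul_smul_comm c (α ξ) Q.unop

/-- The de Rham differential of a `D`-valued `p`-form `η`, that is
`(dη)(ξ_0, …, ξ_p) =
∑_i (-1)^i ξ_i η(…, ξ̂_i, …) + ∑_{i<j} (-1)^(i+j) η([ξ_i, ξ_j], …, ξ̂_i, …, ξ̂_j, …)`
where the vector fields act on `D` by left multiplication. In the second sum the argument
`[ξ_i, ξ_j]` is moved to the place of `ξ_j`, which gives the sign `-(-1)^i`. -/
def deRhamD (L : Submodule A (Derivation ℂ A A))
    (hL : ∀ {δ η : Derivation ℂ A A}, δ ∈ L → η ∈ L → ⁅δ, η⁆ ∈ L)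
    {p : ℕ} (η : Form L p) (ξ : Fin (p + 1) → L) : D A :=
  ∑ i : Fin (p + 1), (-1 : D A) ^ (i : ℕ) *
    (ofDer (ξ i : Derivation ℂ A A) * η (fun k => ξ (i.succAbove k)) -
      ∑ j ∈ Finset.Ioi i, η (fun k => Function.update ξ j
        ⟨⁅(ξ i : Derivation ℂ A A), (ξ j : Derivation ℂ A A)⁆, hL (ξ i).2 (ξ j).2⟩
        (i.succAbove k)))

/-- The form `dt/t ∧ β`. -/
noncomputable def dlogWedge (t : A) {p : ℕ} (β : Form (logT t) p)
    (ξ : Fin (p + 1) → logT t) : D A :=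
  ∑ i : Fin (p + 1), (-1 : D A) ^ (i : ℕ) *
    (dlog t (ξ i) • β (fun k => ξ (i.succAbove k)))

/-- The class in `Ω^p_{rel}(log) ⊗ D` of a form in `Ω^p(log) ⊗ D`. -/
def toRel (t : A) {p : ℕ} (α : Form (logT t) p) : Form (relT t) p :=
  α.compLinearMap (Submodule.inclusion (relT_le_logT t))

/-- The exact forms in `Ω^p_{rel}(log) ⊗ D`. -/
def exactForms (t : A) : (p : ℕ) → Set (Form (relT t) p)
  | 0 => ∅
  | _ + 1 => {τ | ∃ η, ∀ ξ, τ ξ = deRhamD (relT t) (lie_mem_relT t) η ξ}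

/-- The right `D`-submodule of `Ω^n_{rel}(log) ⊗ D` spanned by the exact forms and by the
left multiples of `t`. -/
def relations (t : A) (n : ℕ) : Submodule (D A)ᵐᵒᵖ (Form (relT t) n) :=
  Submodule.span _ (exactForms t n ∪ Set.range fun γ : Form (relT t) n => t • γ)

/-- The right `D`-module `M`: the cokernel of
`Ω^{n-1}_{rel}(log)|_Y ⊗ D → Ω^n_{rel}(log)|_Y ⊗ D`, where `|_Y` is reduction modulo the left
multiplication by `t`; that is the cohomology in degree `0` of the complex
`Ω^{n+•}_{rel}(log)|_Y ⊗ D` if `relT t` has rank `n`. -/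
abbrev M (t : A) (n : ℕ) : Type _ := Form (relT t) n ⧸ relations t n

/-- `F_ℓ M` is the image of `Ω^n_{rel}(log) ⊗ F_{ℓ+n} D`. -/
def filM (t : A) (n : ℕ) (ℓ : ℤ) : AddSubgroup (M t n) :=
  AddSubgroup.map (relations t n).mkQ.toAddMonoidHom
    { carrier := {α | ∀ ξ, toEnd A (α ξ) ∈ orderLE A (ℓ + n)}
      add_mem' := fun h h' ξ => add_mem (h ξ) (h' ξ)
      zero_mem' := fun _ => zero_mem _
      neg_mem' := fun h ξ => neg_mem (h ξ) }

/-- `R` is the operator `[α] ↦ (dt/t ∧)⁻¹ (dα)` on `M`: for all `α` and `β` in `Ω^n(log) ⊗ D` with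
`dα = dt/t ∧ β`, it maps the class of `α` to the class of `β`. -/
def IsResidue (t : A) (n : ℕ) (R : Module.End (D A)ᵐᵒᵖ (M t n)) : Prop :=
  ∀ α β : Form (logT t) n,
    (∀ ξ, deRhamD (logT t) (lie_mem_logT t) α ξ = dlogWedge t β ξ) →
      R ((relations t n).mkQ (toRel t α)) = (relations t n).mkQ (toRel t β)

end Complex

end LogDeRham

/-! ## Degenerations with simple normal crossing central fibre -/

namespace Degeneration

section Geometry

variable {m : ℕ} {X : Type*} [TopologicalSpace X] [ChartedSpace (Fin m → ℂ) X]

/-- The `ℂ`-algebra structure of germs of functions. -/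
instance germAlgebra {T : Type*} (l : Filter T) : Algebra ℂ (Filter.Germ l ℂ) :=
  Algebra.ofModule
    (fun r x y => Filter.Germ.inductionOn₂ x y fun f g => by
      exact congrArg _ (funext fun a => smul_mul_assoc r (f a) (g a)))
    (fun r x y => Filter.Germ.inductionOn₂ x y fun f g => by
      exact congrArg _ (funext fun a => mul_smul_comm r (f a) (g a)))

variable (m) in
/-- The stalk `O_{X,x}`: germs at `x` of functions that are holomorphic near `x`. -/
def stalk (x : X) : Subalgebra ℂ (Filter.Germ (𝓝 x) ℂ) where
  carrier := {φ | ∃ g : X → ℂ, ContMDiffAt 𝓘(ℂ, Fin m → ℂ) 𝓘(ℂ, ℂ) ω g x ∧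
    φ = (g : Filter.Germ (𝓝 x) ℂ)}
  mul_mem' := by
    rintro _ _ ⟨g, hg, rfl⟩ ⟨h, hh, rfl⟩
    exact ⟨g * h, hg.mul hh, rfl⟩
  add_mem' := by
    rintro _ _ ⟨g, hg, rfl⟩ ⟨h, hh, rfl⟩
    exact ⟨g + h, hg.add hh, rfl⟩
  algebraMap_mem' := fun c => ⟨fun _ => c, contMDiffAt_const, by
    rw [Algebra.algebraMap_eq_smul_one]
    exact congrArg _ (funext fun a => by simp)⟩

/-- The germ at `x` of a holomorphic function. -/
def germ {f : X → ℂ} (hf : ContMDiff 𝓘(ℂ, Fin m → ℂ) 𝓘(ℂ, ℂ) ω f) (x : X) : stalk m x :=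
  ⟨(f : Filter.Germ (𝓝 x) ℂ), f, hf x, rfl⟩

variable (m) in
open Classical in
/-- The divisor of `f` is the simple normal crossing divisor `∑ e_i Y_i`: the `Y_i` are
connected closed subsets with union `f⁻¹(0)`, the `e_i` are positive, and every point of `f⁻¹(0)`
lies in a holomorphic chart in which the `Y_i` through that point are distinct coordinate
hyperplanes `z_{σ i} = 0`, no other `Y_i` occurs, and `f = ∏ z_{σ i} ^ e_i`. -/
structure IsSNC (f : X → ℂ) {I : Type*} [Fintype I] (Y : I → Set X) (e : I → ℕ) : Prop where
  isClosed : ∀ i, IsClosed (Y i)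
  isConnected : ∀ i, IsConnected (Y i)
  pos : ∀ i, 0 < e i
  zeros : f ⁻¹' {0} = ⋃ i, Y i
  chart : ∀ x, f x = 0 →
    ∃ φ ∈ IsManifold.maximalAtlas 𝓘(ℂ, Fin m → ℂ) ω X, x ∈ φ.source ∧
    ∃ σ : I → Fin m, Set.InjOn σ {i | x ∈ Y i} ∧
      (∀ i, x ∈ Y i → ∀ y ∈ φ.source, y ∈ Y i ↔ φ y (σ i) = 0) ∧
      (∀ i, x ∉ Y i → Disjoint (Y i) φ.source) ∧
      ∀ y ∈ φ.source, f y = ∏ i with x ∈ Y i, φ y (σ i) ^ e i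

end Geometry

end Degeneration

/-!
The endomorphism `R` is triangular in an explicit basis of the stalk of `M`, compatibly with the
order filtration, and everything else is formal.

At a point outside the central fibre `t` is a unit and `M = 0`. At a point of the central fibre the
stalk `A` of the structure sheaf carries Taylor coordinates in which `t = z^E` with `E_0 ≠ 0`
(`Degeneration.exists_taylorCoords`). The only analytic input about `A` is division with remainder
by a coordinate (`AnalyticAt.exists_eq_add_mul`) and the fact that a germ is determined by its
Taylor coefficients; the structure `LogDeRham.TaylorCoords` records what is used.

*The local structure of `M`.* The logarithmic fields are free on the commuting fields
`λ_i = z_i ∂_i / E_i` (`∂_i` if `E_i = 0`), and the relative ones on the `ξ_k = λ_k - λ_0` (`∂_k` if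
`E_k = 0`). Evaluation of top forms on this frame identifies `M` with the quotient of `D` by the
right ideal `tD + ∑ ξ_k D` (`map_relations`), and `R` with the left multiplication by `θ = λ_0`
(`isResidue_residue`, `eq_residue`).

*A basis.* Let `κ` be an integer vector with `κ ≤ E`, and `κ_i = 0` where `E_i = 0`, and let the
function `a` not depend on the `z_i` with `κ_i < E_i`. In `M` all `z_i ∂_i / E_i` act as `θ`, and
hence `E_i θ - κ_i⁺` maps `z^{κ⁺} a ∂^{κ⁻}` to the same expression with an additional `z_i` and an
additional `∂_i`, if `κ_i < E_i`. After enough such steps the factor `z^E = t` appears, so that the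
class is annihilated by the polynomial in `θ` with the roots `m / E_i`, `κ_i⁺ ≤ m < E_i`
(`rootPoly_theta_mul_mem`). Order these roots increasingly and apply `∏_{k < q} (θ - r_k)`, for `q`
smaller than the number of roots. The resulting classes, with `a` in a basis of the space of
admissible functions, form a `ℂ`-basis of `M`:

* They span, and those with `|κ⁻| + q ≤ m` span the image of the operators of order at most `m`.
  This is an induction on the order that uses the division by coordinates
  (`mem_genSpan_of_mem_ordLE`).
* They are independent, because of the functionals
  `a ∂^β ↦ [a]_{w + β} ∏_i (E_i s - w_i) ⋯ (E_i s - w_i - β_i + 1)` from `D` to `ℂ[s]`, with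
  `E_i s` replaced by `-1` where `E_i = 0`. These turn `θ` into the multiplication by `s`, kill the
  `ξ_k D`, and map `tD` to multiples of the annihilating polynomial (`rootPoly_dvd_functional`); on
  the generators they detect the Taylor coefficients of `a` (`functional_genSum`,
  `eq_zero_of_genSum_mem`).

In this basis `R - r_q` maps a vector to the next vector of its chain, which lies one step higher in
the filtration and has an eigenvalue at least `r_q`, or to zero at the end of the chain
(`eigenBasis`). If all `e_i = 1` then all roots are zero.

*Strictness.* For such a basis the submodules `M_{≥α}` and `M_{>α}` are spanned by basis vectors,
and on the quotient `R - α` is nilpotent and homogeneous of degree one for the splitting of the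
filtration by the basis. So all its powers are strict (`FilteredEnd.EigenBasis.exists_strict`).
Finally, the assertions on the weight filtration and on the Lefschetz decomposition hold for every
nilpotent endomorphism whose powers are strict (`FilteredEnd.StrictLefschetz.of_strict`).
-/

/-! ### The weight filtration of a nilpotent endomorphism with strict powers -/

namespace FilteredEnd

section WeightFiltration

variable {S G : Type*} [Ring S] [AddCommGroup G] [Module S G] (N : Module.End S G)

theorem pow_add_apply (a b : ℕ) (x : G) : (N ^ (a + b)) x = (N ^ a) ((N ^ b) x) := by
  rw [pow_add, Module.End.mul_apply]

theorem ker_pow_mono {a b : ℕ} (h : a ≤ b) : LinearMap.ker (N ^ a) ≤ LinearMap.ker (N ^ b) := by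
  intro x hx
  obtain ⟨c, rfl⟩ := Nat.exists_eq_add_of_le' h
  rw [LinearMap.mem_ker, pow_add_apply, LinearMap.mem_ker.1 hx, map_zero]

theorem map_ker_le_weight (r : ℤ) (j : ℕ) :
    (LinearMap.ker (N ^ (r + 2 * j + 1).toNat)).map (N ^ j) ≤ weight N r :=
  le_iSup (fun j : ℕ => (LinearMap.ker (N ^ (r + 2 * j + 1).toNat)).map (N ^ j)) j

theorem ker_le_weight {r : ℤ} {a : ℕ} (h : (a : ℤ) ≤ r + 1) :
    LinearMap.ker (N ^ a) ≤ weight N r := by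
  intro x hx
  refine map_ker_le_weight N r 0 ⟨x, ker_pow_mono N (by simp; omega) hx, by simp⟩

theorem weight_monotone : Monotone (weight N) := by
  intro r s h
  refine iSup_mono fun j => Submodule.map_mono (ker_pow_mono N ?_)
  exact Int.toNat_le_toNat (by lia)

/-- `N^k W_s = W_(s - 2k)` for `s ≤ k`: the summands of `W_(s - 2k)` that are not visibly in the
image of `N^k` vanish. -/
theorem weight_le_map_pow {k : ℕ} {s r : ℤ} (hr : r = s - 2 * k) (h : s ≤ k) :
    weight N r ≤ (weight N s).map (N ^ k) := by
  subst hr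
  refine iSup_le fun j => ?_
  rintro _ ⟨x, hx, rfl⟩
  rcases le_or_gt k j with hj | hj
  · obtain ⟨c, rfl⟩ := Nat.exists_eq_add_of_le hj
    refine ⟨(N ^ c) x, map_ker_le_weight N s c ⟨x, ?_, rfl⟩, (pow_add_apply N k c x).symm⟩
    have : s - 2 * (k : ℤ) + 2 * ((k + c : ℕ) : ℤ) + 1 = s + 2 * c + 1 := by push_cast; ring
    rwa [this] at hx
  · have : x ∈ LinearMap.ker (N ^ j) := ker_pow_mono N (by lia) hx
    rw [LinearMap.mem_ker.1 this]
    exact zero_mem _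

/-- `W_r ⊆ ker N^(r+1) + N W_(r+2)`: the summand for `j = 0`, and the other ones. -/
theorem weight_le_ker_sup (r : ℤ) :
    weight N r ≤ LinearMap.ker (N ^ (r + 1).toNat) ⊔ (weight N (r + 2)).map N := by
  refine iSup_le fun j => ?_
  rintro _ ⟨x, hx, rfl⟩
  rcases j with _ | j
  · refine Submodule.mem_sup_left ?_
    simpa using hx
  · refine Submodule.mem_sup_right ⟨(N ^ j) x, map_ker_le_weight N (r + 2) j ⟨x, ?_, rfl⟩, ?_⟩
    · have : r + 2 * ((j + 1 : ℕ) : ℤ) + 1 = r + 2 + 2 * j + 1 := by push_cast; ring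
      rwa [this] at hx
    · rw [add_comm, pow_add_apply, pow_one]

/-- The induced map `N^r : gr^W_r → gr^W_(-r)` is injective. -/
theorem mem_weight_pred_of_pow_mem (r : ℕ) {x : G} (hx : (N ^ r) x ∈ weight N (-r - 1)) :
    x ∈ weight N (r - 1) := by
  obtain ⟨y, hy, e⟩ := weight_le_map_pow N (k := r + 1) (s := (r : ℤ) + 1)
    (by push_cast; ring) (by push_cast; rfl) hx
  have h1 : x - N y ∈ LinearMap.ker (N ^ r) := by
    rw [LinearMap.mem_ker, map_sub, ← e, pow_add_apply, pow_one, sub_self]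
  have h2 : N y ∈ weight N (r - 1) := by
    simpa using pow_mem_weight N 1 (s := (r : ℤ) - 1) (by push_cast; ring) hy
  simpa using add_mem (ker_le_weight N (by omega) h1) h2

theorem weight_eq_top {m : ℕ} (hm : N ^ m = 0) {r : ℤ} (hr : (m : ℤ) ≤ r + 1) :
    weight N r = ⊤ := by
  refine top_le_iff.1 fun x _ => ker_le_weight N hr ?_
  rw [LinearMap.mem_ker, hm, LinearMap.zero_apply]

theorem weight_eq_bot {m : ℕ} (hm : N ^ m = 0) : weight N (-(2 * m)) = ⊥ := by
  refine eq_bot_iff.2 (iSup_le fun j => ?_)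
  rintro _ ⟨x, hx, rfl⟩
  rcases le_or_gt (2 * m) j with hj | hj
  · obtain ⟨c, rfl⟩ := Nat.exists_eq_add_of_le' hj
    rw [two_mul, ← add_assoc, pow_add, hm, mul_zero]; rfl
  · have : x ∈ LinearMap.ker (N ^ j) := ker_pow_mono N (by lia) hx
    rw [LinearMap.mem_ker.1 this]
    exact zero_mem _

/-- The class in `gr^W_r` of an element of `W_r`. -/
def grMk {r : ℤ} {x : G} (hx : x ∈ weight N r) : Gr N r := Submodule.Quotient.mk ⟨x, hx⟩

variable {N}

theorem grMk_eq_iff {r : ℤ} {x y : G} (hx : x ∈ weight N r) (hy : y ∈ weight N r) :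
    grMk N hx = grMk N hy ↔ x - y ∈ weight N (r - 1) := by
  rw [grMk, grMk, Submodule.Quotient.eq]
  rfl

theorem grMk_eq_zero_iff {r : ℤ} {x : G} (hx : x ∈ weight N r) :
    grMk N hx = 0 ↔ x ∈ weight N (r - 1) := by
  rw [grMk, Submodule.Quotient.mk_eq_zero]
  rfl

theorem exists_grMk {r : ℤ} (z : Gr N r) : ∃ x, ∃ hx : x ∈ weight N r, grMk N hx = z := by
  induction z using Submodule.Quotient.induction_on with
  | H x => exact ⟨x.1, x.2, rfl⟩

theorem grPow_grMk (k : ℕ) {r s : ℤ} (h : s = r - 2 * k) {x : G} (hx : x ∈ weight N r) :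
    grPow N k h (grMk N hx) = grMk N (pow_mem_weight N k h hx) := rfl

theorem grPow_grMk_eq_zero_iff (k : ℕ) {r s : ℤ} (h : s = r - 2 * k) {x : G}
    (hx : x ∈ weight N r) : grPow N k h (grMk N hx) = 0 ↔ (N ^ k) x ∈ weight N (s - 1) := by
  rw [grPow_grMk, grMk_eq_zero_iff]

theorem mem_grF_iff {F : ℤ → AddSubgroup G} {ℓ r : ℤ} {z : Gr N r} :
    z ∈ grF F N ℓ r ↔ ∃ x, ∃ hx : x ∈ weight N r, x ∈ F ℓ ∧ grMk N hx = z := by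
  constructor
  · rintro ⟨x, hx, rfl⟩
    exact ⟨x.1, x.2, hx, rfl⟩
  · rintro ⟨x, hx, hF, rfl⟩
    exact ⟨⟨x, hx⟩, hF, rfl⟩

theorem mem_primF_iff {F : ℤ → AddSubgroup G} {ℓ r : ℤ} {z : Gr N r} :
    z ∈ primF F N ℓ r ↔ ∃ x, ∃ hx : x ∈ weight N r, x ∈ F ℓ ∧
      (N ^ (r.toNat + 1)) x = 0 ∧ grMk N hx = z := by
  constructor
  · rintro ⟨x, ⟨hx, hx'⟩, rfl⟩
    exact ⟨x.1, x.2, hx, hx', rfl⟩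
  · rintro ⟨x, hx, hF, h0, rfl⟩
    exact ⟨⟨x, hx⟩, ⟨hF, h0⟩, rfl⟩

theorem grMk_mem_prim {r : ℤ} {x : G} (hx : x ∈ weight N r) (h0 : (N ^ (r.toNat + 1)) x = 0) :
    grMk N hx ∈ prim N r := by
  rw [prim, LinearMap.mem_ker, grPow_grMk_eq_zero_iff, h0]
  exact zero_mem _

/-- Every primitive class lifts to `ker N^(r+1)`. -/
theorem exists_lift_of_mem_prim {r : ℤ} (hr : 0 ≤ r) {z : Gr N r} (hz : z ∈ prim N r) :
    ∃ x, ∃ hx : x ∈ weight N r, (N ^ (r.toNat + 1)) x = 0 ∧ grMk N hx = z := by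
  obtain ⟨x, hx, rfl⟩ := exists_grMk z
  rw [prim, LinearMap.mem_ker, grPow_grMk_eq_zero_iff] at hz
  obtain ⟨y, hy, e⟩ := weight_le_map_pow N (k := r.toNat + 1) (s := r - 1)
    (by push_cast; ring) (by push_cast; omega) hz
  have hxy : x - y ∈ weight N r := sub_mem hx (weight_monotone N (by omega) hy)
  refine ⟨x - y, hxy, by rw [map_sub, e, sub_self], ?_⟩
  rw [grMk_eq_iff]
  simpa using hy

/-- The Lefschetz decomposition of `gr^W_r` is direct. The summands are separated from the top:
for the power `a = r + j₀` the operator `N^a` kills `N^j p_j` for `j < j₀`, and is injective on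
the class of `N^(j₀) p_(j₀)`. -/
theorem lefschetz_iSupIndep (r : ℤ) : iSupIndep fun j : {j : ℕ // 0 ≤ r + 2 * (j : ℤ)} =>
    (prim N (r + 2 * ((j : ℕ) : ℤ))).map
      (grPow N j (show r = r + 2 * ((j : ℕ) : ℤ) - 2 * ((j : ℕ) : ℤ) by ring)) := by
  rw [iSupIndep_iff_finsetSum_eq_zero_imp_eq_zero]
  intro s v hv hsum
  have hlift : ∀ i : {j : ℕ // 0 ≤ r + 2 * (j : ℤ)}, ∃ p : G, ∃ hp : (N ^ (i : ℕ)) p ∈ weight N r,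
      (N ^ ((r + 2 * ((i : ℕ) : ℤ)).toNat + 1)) p = 0 ∧ (i ∈ s → v i = grMk N hp) := by
    intro i
    by_cases hi : i ∈ s
    · obtain ⟨z, hz, e⟩ := hv i hi
      obtain ⟨p, hp, h0, rfl⟩ := exists_lift_of_mem_prim i.2 hz
      exact ⟨p, pow_mem_weight N i (by ring) hp, h0, fun _ => e.symm⟩
    · exact ⟨0, by simp, by simp, fun h => absurd h hi⟩
  choose p hp h0 hpv using hlift
  have hmem : ∑ i ∈ s, (N ^ (i : ℕ)) (p i) ∈ weight N (r - 1) := by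
    have hw : ∑ i ∈ s, (N ^ (i : ℕ)) (p i) ∈ weight N r := sum_mem fun i _ => hp i
    rw [← grMk_eq_zero_iff hw, ← hsum]
    have : grMk N hw = ((weight N (r - 1)).submoduleOf (weight N r)).mkQ
        (∑ i ∈ s, ⟨(N ^ (i : ℕ)) (p i), hp i⟩) :=
      congrArg _ (Subtype.ext (by simp))
    rw [this, map_sum]
    exact Finset.sum_congr rfl fun i hi => (hpv i hi).symm
  -- strong induction downwards on the exponent
  have main : ∀ (c : ℕ) (i : {j : ℕ // 0 ≤ r + 2 * (j : ℤ)}),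
      i ∈ s → s.sup (fun i => (i : ℕ)) ≤ i + c →
      (N ^ (i : ℕ)) (p i) ∈ weight N (r - 1) := by
    intro c
    induction c using Nat.strong_induction_on with
    | _ c ih =>
    intro i hi hc
    have hlarge : ∀ k ∈ s, (i : ℕ) < k → (N ^ (k : ℕ)) (p k) ∈ weight N (r - 1) := by
      intro k hk hik
      have := Finset.le_sup (f := fun i : {j : ℕ // 0 ≤ r + 2 * (j : ℤ)} => (i : ℕ)) hk
      exact ih (c - (k - i)) (by omega) k hk (by omega)
    have hi2 := i.2
    rcases lt_or_ge (r + (i : ℕ)) 0 with hneg | hpos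
    · have : p i ∈ LinearMap.ker (N ^ (i : ℕ)) := ker_pow_mono N (by omega) (h0 i)
      rw [LinearMap.mem_ker.1 this]
      exact zero_mem _
    · obtain ⟨a, ha⟩ := Int.eq_ofNat_of_zero_le hpos
      obtain ⟨b, hb⟩ := Int.eq_ofNat_of_zero_le hi2
      have hab : b = a + i := by omega
      -- Apply `N^a` to the sum: the smaller exponents vanish, and the larger ones are in `W_(r-1)`
      -- already.
      have e1 : (N ^ b) (p i) ∈ weight N (-b - 1) := by
        have h1 := pow_mem_weight N a (s := -b - 1) (by rw [← hb]; omega) hmem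
        rw [map_sum, ← Finset.add_sum_erase _ _ hi, ← pow_add_apply, ← hab] at h1
        refine (add_mem_cancel_right (sum_mem fun k hk => ?_)).1 h1
        rw [Finset.mem_erase] at hk
        rcases lt_or_gt_of_ne (fun h => hk.1 (Subtype.ext h) : (k : ℕ) ≠ i) with hki | hki
        · rw [← pow_add_apply]
          have : p k ∈ LinearMap.ker (N ^ (a + (k : ℕ))) :=
            ker_pow_mono N (by have := k.2; omega) (h0 k)
          rw [LinearMap.mem_ker.1 this]
          exact zero_mem _
        · exact pow_mem_weight N a (by rw [← hb]; omega) (hlarge k hk.2 hki)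
      exact pow_mem_weight N i (by rw [← hb]; ring) (mem_weight_pred_of_pow_mem N b e1)
  intro i hi
  rw [hpv i hi, grMk_eq_zero_iff]
  exact main _ i hi le_add_self

/-- The Lefschetz decomposition spans `gr^W_r`: the summands of the formula that defines `W_r` map
to the summands of the decomposition. -/
theorem lefschetz_iSup_eq_top (r : ℤ) : ⨆ j : {j : ℕ // 0 ≤ r + 2 * (j : ℤ)},
    (prim N (r + 2 * ((j : ℕ) : ℤ))).map
      (grPow N j (show r = r + 2 * ((j : ℕ) : ℤ) - 2 * ((j : ℕ) : ℤ) by ring)) = ⊤ := by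
  set T := ⨆ j : {j : ℕ // 0 ≤ r + 2 * (j : ℤ)},
    (prim N (r + 2 * ((j : ℕ) : ℤ))).map
      (grPow N j (show r = r + 2 * ((j : ℕ) : ℤ) - 2 * ((j : ℕ) : ℤ) by ring)) with hT
  have key : weight N r ≤
      (T.comap ((weight N (r - 1)).submoduleOf (weight N r)).mkQ).map (weight N r).subtype := by
    refine iSup_le fun j => ?_
    rintro _ ⟨p, hp, rfl⟩
    have hw : (N ^ j) p ∈ weight N r := map_ker_le_weight N r j ⟨p, hp, rfl⟩
    refine ⟨⟨_, hw⟩, ?_, rfl⟩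
    rcases le_or_gt 0 (r + 2 * (j : ℤ)) with h | h
    · have hp' : (N ^ ((r + 2 * (j : ℤ)).toNat + 1)) p = 0 := by
        rwa [show (r + 2 * (j : ℤ) + 1).toNat = (r + 2 * (j : ℤ)).toNat + 1 by omega] at hp
      have hpw : p ∈ weight N (r + 2 * (j : ℤ)) := ker_le_weight N (by omega) hp'
      exact (le_iSup (fun j : {j : ℕ // 0 ≤ r + 2 * (j : ℤ)} =>
        (prim N (r + 2 * ((j : ℕ) : ℤ))).map
          (grPow N j (show r = r + 2 * ((j : ℕ) : ℤ) - 2 * ((j : ℕ) : ℤ) by ring))) ⟨j, h⟩)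
        ⟨grMk N hpw, grMk_mem_prim hpw hp', rfl⟩
    · have : p = 0 := by
        rw [show (r + 2 * (j : ℤ) + 1).toNat = 0 by omega] at hp
        simpa using hp
      subst this
      have : (⟨(N ^ j) 0, hw⟩ : weight N r) = 0 := Subtype.ext (map_zero _)
      rw [this]
      exact zero_mem _
  refine top_le_iff.1 fun z _ => ?_
  obtain ⟨x, hx, rfl⟩ := exists_grMk z
  obtain ⟨⟨y, hy⟩, h, rfl⟩ := key hx
  exact h

/-- The sum of the `N^j (F_(b-j) ∩ ker N^(r+2j+1))` over `j ≥ 0` with `r + 2j ≥ 0`. -/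
def primSum (F : ℤ → AddSubgroup G) (N : Module.End S G) (b r : ℤ) : AddSubgroup G :=
  ⨆ j : {j : ℕ // 0 ≤ r + 2 * (j : ℤ)}, (F (b - (j : ℕ)) ⊓
    (LinearMap.ker (N ^ ((r + 2 * (j : ℕ) : ℤ).toNat + 1))).toAddSubgroup).map
      (N ^ (j : ℕ)).toAddMonoidHom

theorem pow_apply_mem_primSum {F : ℤ → AddSubgroup G} {b r : ℤ} (j : ℕ)
    (hj : 0 ≤ r + 2 * (j : ℤ)) {p : G} (hF : p ∈ F (b - j))
    (hp : (N ^ ((r + 2 * (j : ℤ)).toNat + 1)) p = 0) : (N ^ j) p ∈ primSum F N b r :=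
  (le_iSup (fun j : {j : ℕ // 0 ≤ r + 2 * (j : ℤ)} => (F (b - (j : ℕ)) ⊓
    (LinearMap.ker (N ^ ((r + 2 * (j : ℕ) : ℤ).toNat + 1))).toAddSubgroup).map
      (N ^ (j : ℕ)).toAddMonoidHom) ⟨j, hj⟩) ⟨p, ⟨hF, hp⟩, rfl⟩

theorem pow_mem_primSum {F : ℤ → AddSubgroup G} {b r : ℤ} (k : ℕ) {s c : ℤ} (hs : s = r + 2 * k)
    (hc : c = b - k) {y : G} (hy : y ∈ primSum F N c s) : (N ^ k) y ∈ primSum F N b r := by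
  subst hs hc
  have : (primSum F N (b - k) (r + 2 * k)).map (N ^ k).toAddMonoidHom ≤ primSum F N b r := by
    rw [primSum, AddSubgroup.map_iSup]
    refine iSup_le fun j => ?_
    rintro _ ⟨_, ⟨p, ⟨hpF, hp0⟩, rfl⟩, rfl⟩
    have hj : r + 2 * (k : ℤ) + 2 * ((j : ℕ) : ℤ) = r + 2 * ((k + j : ℕ) : ℤ) := by
      push_cast; ring
    have hb : b - (k : ℤ) - ((j : ℕ) : ℤ) = b - ((k + j : ℕ) : ℤ) := by push_cast; ring
    have hj2 := j.2
    rw [hj] at hp0 hj2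
    rw [hb] at hpF
    have := pow_apply_mem_primSum (k + j) hj2 hpF hp0
    rwa [pow_add_apply] at this
  exact this ⟨y, hy, rfl⟩

/-- By strictness an element whose image under `N^a` lies in `F_(a+b)` can be replaced by one of
`F_b` with the same image. -/
theorem exists_mem_of_pow_mem {F : ℤ → AddSubgroup G}
    (hstrict : ∀ (a : ℕ) (b : ℤ), (F b).map (N ^ a).toAddMonoidHom =
      F (a + b) ⊓ (LinearMap.range (N ^ a)).toAddSubgroup) (a : ℕ) (b : ℤ) {y : G}
    (hy : (N ^ a) y ∈ F (a + b)) : ∃ y' ∈ F b, (N ^ a) y' = (N ^ a) y := by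
  have : (N ^ a) y ∈ (F b).map (N ^ a).toAddMonoidHom := by
    rw [hstrict]; exact ⟨hy, y, rfl⟩
  exact this

theorem pow_mem_of_mem {F : ℤ → AddSubgroup G}
    (hstrict : ∀ (a : ℕ) (b : ℤ), (F b).map (N ^ a).toAddMonoidHom =
      F (a + b) ⊓ (LinearMap.range (N ^ a)).toAddSubgroup) (a : ℕ) {b c : ℤ} (hc : c = a + b)
    {y : G} (hy : y ∈ F b) : (N ^ a) y ∈ F c := by
  have : (N ^ a) y ∈ (F b).map (N ^ a).toAddMonoidHom := ⟨y, hy, rfl⟩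
  rw [hstrict, ← hc] at this
  exact this.1

/-- The inclusion `F_b ∩ W_r ⊆ ∑ N^j (F_(b-j) ∩ ker N^(r+2j+1))` for `r ≥ 0`, by downward induction
on `r`. Write `x = p + N y` with `N^(r+1) p = 0` and `y ∈ W_(r+2)`. Then `N^(r+2) y = N^(r+1) x`
lies in `F_(b+r+1)`, so that by strictness `y` can be chosen in `F_(b-1)`. -/
theorem mem_primSum_of_nonneg {F : ℤ → AddSubgroup G} {m : ℕ} (hm : N ^ m = 0)
    (hstrict : ∀ (a : ℕ) (b : ℤ), (F b).map (N ^ a).toAddMonoidHom =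
      F (a + b) ⊓ (LinearMap.range (N ^ a)).toAddSubgroup) (b r : ℤ) (hr : 0 ≤ r) {x : G}
    (hxF : x ∈ F b) (hxW : x ∈ weight N r) : x ∈ primSum F N b r := by
  induction hc : (m - r).toNat using Nat.strong_induction_on generalizing b r x with
  | _ c ih =>
  rcases le_or_gt (m : ℤ) r with hmr | hmr
  · have : x ∈ LinearMap.ker (N ^ m) := by rw [hm]; simp
    exact pow_apply_mem_primSum 0 (by simpa using hr) (by simpa using hxF)
      (ker_pow_mono N (by simp; omega) this)
  obtain ⟨p, hp, z, ⟨y, hy, rfl⟩, rfl⟩ := Submodule.mem_sup.1 (weight_le_ker_sup N r hxW)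
  have hp : (N ^ (r.toNat + 1)) p = 0 := by
    rwa [show (r + 1).toNat = r.toNat + 1 by omega] at hp
  have hxF' : (N ^ (r.toNat + 2)) y ∈ F ((r.toNat + 2 : ℕ) + (b - 1)) := by
    have := pow_mem_of_mem hstrict (r.toNat + 1) (c := (r.toNat + 2 : ℕ) + (b - 1))
      (by push_cast; ring) hxF
    rwa [map_add, hp, zero_add, ← pow_one N, ← pow_mul, ← pow_add_apply, one_mul] at this
  obtain ⟨y', hy'F, hy'⟩ := exists_mem_of_pow_mem hstrict _ _ hxF'
  have hdiff : (N ^ (r.toNat + 2)) (y - y') = 0 := by rw [map_sub, hy', sub_self]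
  have hy'W : y' ∈ weight N (r + 2) := by
    have := sub_mem hy (ker_le_weight N (r := r + 2) (by push_cast; omega) hdiff)
    simpa using this
  have hNy' : N y' ∈ F b := by
    simpa using pow_mem_of_mem hstrict 1 (c := b) (by simp) hy'F
  -- The difference `N (y - y')` is moved to the first summand, where `N^(r+1)` still kills it.
  have e : p + N y = (p + N (y - y')) + N y' := by rw [map_sub]; abel
  rw [e]
  refine add_mem ?_ ?_
  · refine pow_apply_mem_primSum 0 (by simpa using hr) (p := p + N (y - y')) ?_ ?_
    · have := sub_mem hxF hNy'
      rw [e, add_sub_cancel_right] at this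
      simpa using this
    · rw [show (r + 2 * ((0 : ℕ) : ℤ)).toNat = r.toNat by simp, map_add, hp, zero_add]
      rwa [show r.toNat + 2 = r.toNat + 1 + 1 from rfl, pow_succ, Module.End.mul_apply] at hdiff
  · have h4 := ih (m - (r + 2)).toNat (by omega) (b - 1) (r + 2) (by omega) hy'F hy'W rfl
    simpa using pow_mem_primSum 1 (by simp) (by simp) h4

/-- Strictness of the powers of `N` refines the formula that defines `W_r` to the filtration:
`F_b ∩ W_r` is the sum of the `N^j (F_(b-j) ∩ ker N^(r+2j+1))`. -/
theorem mem_primSum {F : ℤ → AddSubgroup G} {m : ℕ} (hm : N ^ m = 0)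
    (hstrict : ∀ (a : ℕ) (b : ℤ), (F b).map (N ^ a).toAddMonoidHom =
      F (a + b) ⊓ (LinearMap.range (N ^ a)).toAddSubgroup) (b r : ℤ) {x : G}
    (hxF : x ∈ F b) (hxW : x ∈ weight N r) : x ∈ primSum F N b r := by
  rcases le_or_gt 0 r with hr | hr
  · exact mem_primSum_of_nonneg hm hstrict b r hr hxF hxW
  obtain ⟨k, hk⟩ := Int.eq_ofNat_of_zero_le (show 0 ≤ -r by omega)
  obtain ⟨y, hy, rfl⟩ := weight_le_map_pow N (k := k) (s := k) (by omega) le_rfl hxW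
  obtain ⟨y', hy'F, hy'⟩ := exists_mem_of_pow_mem hstrict k (b - k)
    (by simpa using hxF)
  have hdiff : (N ^ k) (y - y') = 0 := by rw [map_sub, hy', sub_self]
  have hy'W : y' ∈ weight N k := by
    have := sub_mem hy (ker_le_weight N (by omega) hdiff)
    simpa using this
  rw [← hy']
  exact pow_mem_primSum k (by omega) rfl
    (mem_primSum_of_nonneg hm hstrict (b - k) k (by omega) hy'F hy'W)

/-- The formal properties of the weight filtration follow from the strictness of the powers of
`N`. -/
theorem StrictLefschetz.of_strict {F : ℤ → AddSubgroup G} (hnil : IsNilpotent N)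
    (hstrict : ∀ (a : ℕ) (b : ℤ), (F b).map (N ^ a).toAddMonoidHom =
      F (a + b) ⊓ (LinearMap.range (N ^ a)).toAddSubgroup) : StrictLefschetz F N := by
  obtain ⟨m, hm⟩ := id hnil
  refine
    { nilpotent := hnil
      map_le := ?_
      strict := hstrict
      weight_mono := weight_monotone N
      weight_top := ⟨m, weight_eq_top N hm (by omega)⟩
      weight_bot := ⟨_, weight_eq_bot N hm⟩
      gr_bijective := ?_
      gr_bijOn := ?_
      prim_eq := ?_
      prim_quotient := ?_
      primF_eq := ?_
      lefschetz_indep := lefschetz_iSupIndep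
      lefschetz_top := lefschetz_iSup_eq_top
      lefschetz_F := ?_ }
  · rintro b _ ⟨x, hx, rfl⟩
    simpa using! pow_mem_of_mem hstrict 1 (c := b + 1) (by push_cast; ring) hx
  · intro r
    constructor
    · rw [injective_iff_map_eq_zero]
      intro z hz
      obtain ⟨x, hx, rfl⟩ := exists_grMk z
      rw [grPow_grMk_eq_zero_iff] at hz
      exact (grMk_eq_zero_iff hx).2 (mem_weight_pred_of_pow_mem N r hz)
    · intro z
      obtain ⟨x, hx, rfl⟩ := exists_grMk z
      obtain ⟨y, hy, rfl⟩ := weight_le_map_pow N (k := r) (s := r) (by ring) le_rfl hx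
      exact ⟨grMk N hy, rfl⟩
  · intro r ℓ
    refine ⟨?_, ?_, ?_⟩
    · intro z hz
      obtain ⟨x, hx, hF, rfl⟩ := mem_grF_iff.1 hz
      exact mem_grF_iff.2 ⟨_, pow_mem_weight N r (by ring) hx,
        pow_mem_of_mem hstrict r (by ring) hF, rfl⟩
    · refine Set.injOn_of_injective ?_
      rw [injective_iff_map_eq_zero]
      intro z hz
      obtain ⟨x, hx, rfl⟩ := exists_grMk z
      rw [grPow_grMk_eq_zero_iff] at hz
      exact (grMk_eq_zero_iff hx).2 (mem_weight_pred_of_pow_mem N r hz)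
    · intro z hz
      obtain ⟨x, hx, hF, rfl⟩ := mem_grF_iff.1 hz
      obtain ⟨y, hy, rfl⟩ := weight_le_map_pow N (k := r) (s := r) (by ring) le_rfl hx
      obtain ⟨y', hy'F, hy'⟩ := exists_mem_of_pow_mem hstrict r ℓ (by rwa [add_comm])
      have hdiff : (N ^ r) (y - y') = 0 := by rw [map_sub, hy', sub_self]
      have hy'W : y' ∈ weight N r := by
        have := sub_mem hy (ker_le_weight N (by omega) hdiff)
        simpa using this
      refine ⟨grMk N hy'W, mem_grF_iff.2 ⟨y', hy'W, hy'F, rfl⟩, ?_⟩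
      rw [grPow_grMk, grMk_eq_iff, hy', sub_self]
      exact zero_mem _
  · intro r
    refine le_antisymm ?_ ?_
    · rintro _ ⟨x, hx, rfl⟩
      exact grMk_mem_prim x.2 (by simpa using! hx)
    · intro z hz
      obtain ⟨x, hx, h0, rfl⟩ := exists_lift_of_mem_prim (Int.natCast_nonneg r) hz
      exact ⟨⟨x, hx⟩, by simpa using! h0, rfl⟩
  · intro r
    refine le_antisymm ?_ (sup_le ?_ ?_)
    · rintro x ⟨hx, hxW⟩
      obtain ⟨p, hp, z, ⟨y, hy, rfl⟩, rfl⟩ :=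
        Submodule.mem_sup.1 (weight_le_ker_sup N _ hxW)
      have hp : p ∈ LinearMap.ker (N ^ r) := by simpa using hp
      refine Submodule.add_mem_sup hp ⟨y, ?_, rfl⟩
      have h1 := ker_pow_mono N (Nat.le_succ r) hp
      have h2 : N y ∈ LinearMap.ker (N ^ (r + 1)) := by
        simpa using sub_mem hx h1
      change (N ^ (r + 2)) y = 0
      rw [show r + 2 = (r + 1) + 1 from rfl, pow_add_apply, pow_one]
      exact h2
    · exact le_inf (ker_pow_mono N (Nat.le_succ r)) (ker_le_weight N (by omega))
    · rintro _ ⟨x, hx, rfl⟩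
      refine ⟨?_, ?_⟩
      · change (N ^ (r + 1)) (N x) = 0
        rw [← pow_one N, ← pow_mul, ← pow_add_apply, one_mul]
        exact hx
      · simpa using pow_mem_weight N 1 (s := (r : ℤ) - 1) (r := r + 1) (by push_cast; ring)
          (ker_le_weight N (by push_cast; omega) hx)
  · intro r ℓ
    ext z
    rw [mem_primF_iff]
    constructor
    · rintro ⟨x, hx, hF, h0, rfl⟩
      exact ⟨mem_grF_iff.2 ⟨x, hx, hF, rfl⟩, grMk_mem_prim hx h0⟩
    · rintro ⟨hz, hp⟩
      obtain ⟨x, hx, hF, rfl⟩ := mem_grF_iff.1 hz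
      have hp : grMk N hx ∈ prim N r := hp
      rw [prim, LinearMap.mem_ker, grPow_grMk_eq_zero_iff] at hp
      -- `N^(r+1) x = N^(r+3) y`, and strictness makes `y` an element of `F_(ℓ-2)`
      obtain ⟨y, hy, e⟩ := weight_le_map_pow N (k := r + 3) (s := r + 3)
        (by push_cast; simp; ring) (by push_cast; rfl) hp
      obtain ⟨y', hy'F, hy'⟩ := exists_mem_of_pow_mem hstrict (r + 3) (ℓ - 2) (y := y) (by
        rw [e]
        exact pow_mem_of_mem hstrict _ (by push_cast; simp; ring) hF)
      have hdiff : (N ^ (r + 3)) (y - y') = 0 := by rw [map_sub, hy', sub_self]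
      have hy'W : y' ∈ weight N (r + 3) := by
        have := sub_mem hy (ker_le_weight N (by push_cast; omega) hdiff)
        simpa using this
      have hW : (N ^ 2) y' ∈ weight N (r - 1) := pow_mem_weight N 2 (by push_cast; ring) hy'W
      have hFy : (N ^ 2) y' ∈ F ℓ := pow_mem_of_mem hstrict 2 (by push_cast; ring) hy'F
      have hxW : x - (N ^ 2) y' ∈ weight N r := sub_mem hx (weight_monotone N (by omega) hW)
      refine ⟨x - (N ^ 2) y', hxW, sub_mem hF hFy, ?_, ?_⟩
      · rw [map_sub, ← e, ← hy', ← pow_add_apply, sub_eq_zero]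
        rfl
      · rw [grMk_eq_iff]
        simpa using hW
  · intro b r
    refine le_antisymm ?_ (iSup_le fun j => ?_)
    · set T := ⨆ j : {j : ℕ // 0 ≤ r + 2 * (j : ℤ)},
        (primF F N (b - ((j : ℕ) : ℤ)) (r + 2 * ((j : ℕ) : ℤ))).map
          (grPow N j (show r = r + 2 * ((j : ℕ) : ℤ) - 2 * ((j : ℕ) : ℤ) by ring)).toAddMonoidHom
        with hT
      have key : primSum F N b r ≤
          (T.comap ((weight N (r - 1)).submoduleOf (weight N r)).mkQ.toAddMonoidHom).map
            (weight N r).subtype.toAddMonoidHom := by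
        refine iSup_le fun j => ?_
        rintro _ ⟨p, ⟨hpF, hp0⟩, rfl⟩
        have hj := j.2
        have hpw : p ∈ weight N (r + 2 * ((j : ℕ) : ℤ)) :=
          ker_le_weight N (by push_cast; omega) hp0
        refine ⟨⟨(N ^ (j : ℕ)) p, pow_mem_weight N j (by ring) hpw⟩, ?_, rfl⟩
        exact (le_iSup (fun j : {j : ℕ // 0 ≤ r + 2 * (j : ℤ)} =>
          (primF F N (b - ((j : ℕ) : ℤ)) (r + 2 * ((j : ℕ) : ℤ))).map (grPow N j
            (show r = r + 2 * ((j : ℕ) : ℤ) - 2 * ((j : ℕ) : ℤ) by ring)).toAddMonoidHom) j)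
          ⟨grMk N hpw, mem_primF_iff.2 ⟨p, hpw, hpF, hp0, rfl⟩, rfl⟩
      intro z hz
      obtain ⟨x, hx, hF, rfl⟩ := mem_grF_iff.1 hz
      obtain ⟨⟨y, hy⟩, h, rfl⟩ := key (mem_primSum hm hstrict b r hF hx)
      exact h
    · rintro _ ⟨z, hz, rfl⟩
      obtain ⟨x, hx, hF, h0, rfl⟩ := mem_primF_iff.1 hz
      exact mem_grF_iff.2 ⟨_, pow_mem_weight N j (by ring) hx,
        pow_mem_of_mem hstrict j (by ring) hF, rfl⟩

end WeightFiltration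

end FilteredEnd

/-! ### Endomorphisms that are triangular in a basis adapted to the filtration -/

namespace FilteredEnd

section EigenBasis

variable {S G : Type*} [Ring S] [Algebra ℂ S] [AddCommGroup G] [Module S G] [Module ℂ G]
  [IsScalarTower ℂ S G] [SMulCommClass S ℂ G]

theorem shift_apply (R : Module.End S G) (c : ℂ) (x : G) : shift R c x = R x - c • x := by
  rw [shift, LinearMap.sub_apply, Module.algebraMap_end_apply]

theorem shift_apply_eq (R : Module.End S G) (c d : ℂ) (x : G) :
    shift R c x = shift R d x + (d - c) • x := by
  rw [shift_apply, shift_apply, sub_smul]; abel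

theorem genEig_le_geEig (R : Module.End S G) {a b : ℝ} (h : a ≤ b) :
    genEig R (b : ℂ) ≤ geEig R a :=
  le_iSup (fun b : Set.Ici a => genEig R ((b : ℝ) : ℂ)) ⟨b, h⟩

theorem genEig_le_gtEig (R : Module.End S G) {a b : ℝ} (h : a < b) :
    genEig R (b : ℂ) ≤ gtEig R a :=
  le_iSup (fun b : Set.Ioi a => genEig R ((b : ℝ) : ℂ)) ⟨b, h⟩

theorem geEig_le_gtEig (R : Module.End S G) {a b : ℝ} (h : a < b) :
    geEig R b ≤ gtEig R a :=
  iSup_le fun c => genEig_le_gtEig R (lt_of_lt_of_le h c.2)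

/-- Generalized eigenmodules are saturated: an element belongs to `ker (R - c)^∞` if its image under
a power of `R - c` does. -/
theorem mem_genEig_of_shift_pow {R : Module.End S G} {c : ℂ} (k : ℕ) {x : G}
    (h : (shift R c ^ k) x ∈ genEig R c) : x ∈ genEig R c := by
  have hdir : Directed (· ≤ ·) fun k : ℕ => LinearMap.ker (shift R c ^ k) :=
    (show Monotone fun k : ℕ => LinearMap.ker (shift R c ^ k) from
      fun a b hab => ker_pow_mono _ hab).directed_le
  rw [genEig, Submodule.mem_iSup_of_directed _ hdir] at h ⊢
  obtain ⟨l, hl⟩ := h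
  refine ⟨l + k, ?_⟩
  rw [LinearMap.mem_ker, pow_add_apply]
  exact hl

theorem exists_pow_of_mem_genEig {R : Module.End S G} {c : ℂ} {x : G} (h : x ∈ genEig R c) :
    ∃ k : ℕ, (shift R c ^ k) x = 0 := by
  have hdir : Directed (· ≤ ·) fun k : ℕ => LinearMap.ker (shift R c ^ k) :=
    (show Monotone fun k : ℕ => LinearMap.ker (shift R c ^ k) from
      fun a b hab => ker_pow_mono _ hab).directed_le
  rw [genEig, Submodule.mem_iSup_of_directed _ hdir] at h
  exact h

/-- `R - c` is surjective on the generalized eigenmodule of an eigenvalue different from `c`. -/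
theorem genEig_le_map_shift (R : Module.End S G) {c d : ℂ} (h : c ≠ d) :
    genEig R d ≤ (genEig R d).map (shift R c) := by
  intro x hx
  obtain ⟨k, hk⟩ := exists_pow_of_mem_genEig hx
  clear hx
  induction k generalizing x with
  | zero => rw [show x = 0 by simpa using hk]; exact zero_mem _
  | succ k ih =>
    rw [pow_succ, Module.End.mul_apply] at hk
    obtain ⟨y, hy, e⟩ := ih hk
    have hx : x ∈ genEig R d := by
      refine mem_genEig_of_shift_pow (k + 1) ?_
      rw [pow_succ, Module.End.mul_apply, hk]; exact zero_mem _
    -- `x = (d - c)⁻¹ ((R - c) x - (R - d) x)`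
    refine ⟨(d - c)⁻¹ • (x - y), ?_, ?_⟩
    · exact Submodule.smul_of_tower_mem _ _ (sub_mem hx hy)
    · rw [LinearMap.map_smul_of_tower, map_sub, e, shift_apply_eq R c d x, add_sub_cancel_left,
        smul_smul, inv_mul_cancel₀ (sub_ne_zero.2 h.symm), one_smul]

/-- `G_{≥a}` is saturated for `R - b`, `b ≥ a`, because `R - b` is surjective on the eigenmodules of
the other eigenvalues. -/
theorem mem_geEig_of_shift (R : Module.End S G) {a b : ℝ} (h : a ≤ b) {x : G}
    (hx : shift R (b : ℂ) x ∈ geEig R a) : x ∈ geEig R a := by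
  have key : geEig R a ≤ (geEig R a).map (shift R (b : ℂ)) ⊔ genEig R (b : ℂ) := by
    refine iSup_le fun d => ?_
    by_cases hd : (d : ℝ) = b
    · rw [hd]; exact le_sup_right
    · refine le_trans (genEig_le_map_shift R (c := b) ?_) (le_trans (Submodule.map_mono
        (genEig_le_geEig R d.2)) le_sup_left)
      exact fun h => hd (Complex.ofReal_injective h.symm)
  obtain ⟨_, ⟨y, hy, rfl⟩, z, hz, e⟩ := Submodule.mem_sup.1 (key hx)
  have : x - y ∈ genEig R (b : ℂ) := by
    refine mem_genEig_of_shift_pow 1 ?_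
    rw [pow_one, map_sub, ← e, add_sub_cancel_left]
    exact hz
  simpa using add_mem (genEig_le_geEig R h this) hy

/-- A `ℂ`-basis of `G` in which `R` is triangular with real eigenvalues, compatibly with a
filtration: `R - r_j` maps the basis vector `b_j` into the span of basis vectors of degree exactly
one more, of eigenvalue at least `r_j` and of smaller height, and `F_c` is spanned by the basis
vectors of degree at most `c`. -/
structure EigenBasis (F : ℤ → AddSubgroup G) (R : Module.End S G) (J : Type*) where
  /-- The basis. -/
  b : Module.Basis J ℂ G
  /-- The eigenvalues. -/
  r : J → ℝ
  /-- The degrees, which define the filtration. -/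
  deg : J → ℤ
  /-- The heights, which bound the length of the chains. -/
  ht : J → ℕ
  /-- A bound for the heights. -/
  m : ℕ
  ht_lt : ∀ j, ht j < m
  step : ∀ j, shift R (r j : ℂ) (b j) ∈
    Submodule.span ℂ (b '' {k | r j ≤ r k ∧ deg k = deg j + 1 ∧ ht k < ht j})
  fil : ∀ c, F c = (Submodule.span ℂ (b '' {k | deg k ≤ c})).toAddSubgroup

namespace EigenBasis

variable {F : ℤ → AddSubgroup G} {R : Module.End S G} {J : Type*}

/-- The span of a set of basis vectors. -/
def U (B : EigenBasis F R J) (s : Set J) : Submodule ℂ G := Submodule.span ℂ (B.b '' s)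

theorem U_mono (B : EigenBasis F R J) {s t : Set J} (h : s ⊆ t) : B.U s ≤ B.U t :=
  Submodule.span_mono (Set.image_mono h)

theorem mem_U (B : EigenBasis F R J) {s : Set J} {x : G} :
    x ∈ B.U s ↔ ∀ j, B.b.repr x j ≠ 0 → j ∈ s := by
  rw [U, B.b.mem_span_image]
  exact ⟨fun h j hj => h (Finsupp.mem_support_iff.2 hj),
    fun h j hj => h j (Finsupp.mem_support_iff.1 hj)⟩

theorem U_inf (B : EigenBasis F R J) {s t : Set J} {x : G} (hs : x ∈ B.U s)
    (ht : x ∈ B.U t) : x ∈ B.U (s ∩ t) :=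
  B.mem_U.2 fun j hj => ⟨B.mem_U.1 hs j hj, B.mem_U.1 ht j hj⟩

theorem U_univ (B : EigenBasis F R J) : B.U Set.univ = ⊤ := by
  rw [U, Set.image_univ, B.b.span_eq]

theorem b_mem_U (B : EigenBasis F R J) {s : Set J} {j : J} (h : j ∈ s) : B.b j ∈ B.U s :=
  Submodule.subset_span ⟨j, h, rfl⟩

/-- The part of `x` in the basis vectors of `t`, and the part in the other ones. -/
theorem exists_add_of_mem_U (B : EigenBasis F R J) (t : Set J) {s : Set J} {x : G} (h : x ∈ B.U s) :
    ∃ y ∈ B.U (s ∩ t), ∃ z ∈ B.U (s \ t), x = y + z := by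
  have : s = (s ∩ t) ∪ (s \ t) := (Set.inter_union_sdiff s t).symm
  rw [this, U, Set.image_union, Submodule.span_union] at h
  obtain ⟨y, hy, z, hz, e⟩ := Submodule.mem_sup.1 h
  exact ⟨y, hy, z, hz, e.symm⟩

theorem mem_F (B : EigenBasis F R J) {c : ℤ} {x : G} : x ∈ F c ↔ x ∈ B.U {k | B.deg k ≤ c} := by
  rw [B.fil]; rfl

theorem shift_mem_U (B : EigenBasis F R J) {s t : Set J} (c : ℂ)
    (h : ∀ j ∈ s, shift R c (B.b j) ∈ B.U t) {x : G}
    (hx : x ∈ B.U s) : shift R c x ∈ B.U t := by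
  have : B.U s ≤ (B.U t).comap ((shift R c).restrictScalars ℂ) := by
    rw [U, Submodule.span_le]
    rintro _ ⟨j, hj, rfl⟩
    exact h j hj
  exact this hx

/-- Iteration of `shift_mem_U` along a sequence of sets of indices. -/
theorem shift_pow_mem_U (B : EigenBasis F R J) {s : ℕ → Set J} (c : ℂ)
    (h : ∀ n, ∀ j ∈ s n, shift R c (B.b j) ∈ B.U (s (n + 1))) (a n : ℕ) {x : G}
    (hx : x ∈ B.U (s n)) : (shift R c ^ a) x ∈ B.U (s (a + n)) := by
  induction a with
  | zero => simpa using hx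
  | succ a ih =>
    rw [pow_succ', Module.End.mul_apply, show a + 1 + n = (a + n) + 1 by ring]
    exact B.shift_mem_U c (h _) ih

/-- The set of indices with eigenvalue at least `α`. -/
def ge (B : EigenBasis F R J) (α : ℝ) : Set J := {j | α ≤ B.r j}

/-- The set of indices with eigenvalue greater than `α`. -/
def gt (B : EigenBasis F R J) (α : ℝ) : Set J := {j | α < B.r j}

/-- `R - c` maps `b_j` into the span of `t` if `t` contains all indices that can occur in
`(R - r_j) b_j`, and also `j` itself unless `c = r_j`. -/
theorem shift_b_mem (B : EigenBasis F R J) {t : Set J} {j : J} (c : ℝ)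
    (h : ∀ k, B.r j ≤ B.r k → B.deg k = B.deg j + 1 → B.ht k < B.ht j → k ∈ t)
    (hj : B.r j = c ∨ j ∈ t) : shift R (c : ℂ) (B.b j) ∈ B.U t := by
  rw [shift_apply_eq R c (B.r j)]
  refine add_mem (B.U_mono (fun k hk => h k hk.1 hk.2.1 hk.2.2) (B.step j)) ?_
  rcases hj with rfl | hj
  · rw [sub_self, zero_smul]; exact zero_mem _
  · exact Submodule.smul_mem _ _ (B.b_mem_U hj)

/-- Induction on the height: `R - r_j` maps `b_j` to basis vectors of smaller height. -/
theorem b_mem_geEig (B : EigenBasis F R J) (α : ℝ) (j : J) (hj : α ≤ B.r j) :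
    B.b j ∈ geEig R α := by
  induction h : B.ht j using Nat.strong_induction_on generalizing j with
  | _ n ih =>
  refine mem_geEig_of_shift R hj ?_
  have : Submodule.span ℂ (B.b '' {k | B.r j ≤ B.r k ∧ B.deg k = B.deg j + 1 ∧ B.ht k < B.ht j})
      ≤ (geEig R α).restrictScalars ℂ := by
    rw [Submodule.span_le]
    rintro _ ⟨k, hk, rfl⟩
    exact ih _ (h ▸ hk.2.2) k (hj.trans hk.1) rfl
  exact this (B.step j)

/-- If `c ≥ α` then `R - c` is injective modulo the span of the basis vectors of eigenvalue at
least `α`, being triangular with nonzero diagonal entries. -/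
theorem mem_U_ge_of_shift (B : EigenBasis F R J) {α c : ℝ} (hc : α ≤ c) {x : G}
    (hx : shift R (c : ℂ) x ∈ B.U (B.ge α)) :
    x ∈ B.U (B.ge α) := by
  -- Coefficients at the indices of eigenvalue less than `α` vanish, by descent on the height.
  have main : ∀ h : ℕ, x ∈ B.U (B.ge α ∪ {k | B.ht k < h}) → x ∈ B.U (B.ge α) := by
    intro h
    induction h with
    | zero => intro hx; simpa using hx
    | succ h ih =>
      intro hxh
      refine ih (B.mem_U.2 fun j hj => ?_)
      rcases le_or_gt α (B.r j) with h1 | h1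
      · exact Or.inl h1
      rcases B.mem_U.1 hxh j hj with h2 | h2
      · exact Or.inl h2
      refine Or.inr (lt_of_le_of_ne (Nat.lt_succ_iff.1 h2) fun h3 => ?_)
      -- At the largest height that occurs, `R - c` acts on the coefficients by its diagonal
      -- entries.
      have key : ∀ y ∈ B.U (B.ge α ∪ {k | B.ht k < h + 1}),
          B.b.repr (shift R (c : ℂ) y) j = ((B.r j : ℂ) - c) * B.b.repr y j := by
        intro y hy
        induction hy using Submodule.span_induction with
        | mem y hy =>
          obtain ⟨k, hk, rfl⟩ := hy
          rw [shift_apply_eq R c (B.r k), map_add, Finsupp.add_apply, map_smul,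
            Finsupp.smul_apply, smul_eq_mul]
          have h0 : B.b.repr (shift R (B.r k : ℂ) (B.b k)) j = 0 := by
            by_contra hne
            obtain ⟨q1, -, q3⟩ := B.mem_U.1 (B.step k) j hne
            rcases hk with hk | hk
            · exact absurd (hk.trans q1) (not_le.2 h1)
            · have : B.ht k < h + 1 := hk
              omega
          rw [h0, zero_add]
          by_cases hkj : k = j
          · rw [hkj]
          · simp [hkj]
        | zero => simp
        | add y z _ _ hy hz => simp only [map_add, Finsupp.add_apply, hy, hz]; ring
        | smul a y _ hy =>
          rw [LinearMap.map_smul_of_tower, map_smul, map_smul, Finsupp.smul_apply,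
            Finsupp.smul_apply, hy, smul_eq_mul, smul_eq_mul]
          ring
      have hne : B.b.repr (shift R (c : ℂ) x) j ≠ 0 := by
        rw [key x hxh]
        refine mul_ne_zero (sub_ne_zero.2 fun h => ?_) hj
        have := Complex.ofReal_injective h
        linarith
      exact absurd (B.mem_U.1 hx j hne) (not_le.2 h1)
  refine main B.m (B.mem_U.2 fun j _ => Or.inr (B.ht_lt j))

/-- `G_{≥α}` is spanned by the basis vectors of eigenvalue at least `α`. -/
theorem mem_geEig (B : EigenBasis F R J) {α : ℝ} {x : G} : x ∈ geEig R α ↔ x ∈ B.U (B.ge α) := by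
  constructor
  · intro hx
    have hst : ∀ (b : ℝ) (s : ℝ), ∀ x ∈ B.U (B.ge b), shift R (s : ℂ) x ∈ B.U (B.ge b) :=
      fun b s x hx => B.shift_mem_U _ (fun j hj => B.shift_b_mem s
        (fun k hk _ _ => le_trans hj hk) (Or.inr hj)) hx
    rw [geEig] at hx
    induction hx using Submodule.iSup_induction' with
    | mem c x hx =>
      obtain ⟨k, hk⟩ := exists_pow_of_mem_genEig hx
      clear hx
      induction k generalizing x with
      | zero => rw [show x = 0 by simpa using hk]; exact zero_mem _
      | succ k ih =>
        rw [pow_succ, Module.End.mul_apply] at hk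
        exact B.mem_U_ge_of_shift c.2 (ih _ hk)
    | zero => exact zero_mem _
    | add x y _ _ hx hy => exact add_mem hx hy
  · intro hx
    have : B.U (B.ge α) ≤ (geEig R α).restrictScalars ℂ := by
      rw [U, Submodule.span_le]
      rintro _ ⟨k, hk, rfl⟩
      exact B.b_mem_geEig α k hk
    exact this hx

/-- `G_{>α}` is spanned by the basis vectors of eigenvalue greater than `α`. -/
theorem mem_gtEig (B : EigenBasis F R J) {α : ℝ} {x : G} : x ∈ gtEig R α ↔ x ∈ B.U (B.gt α) := by
  constructor
  · intro hx
    rw [gtEig] at hx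
    induction hx using Submodule.iSup_induction' with
    | mem c x hx =>
      have h1 : x ∈ geEig R (c : ℝ) := genEig_le_geEig R le_rfl hx
      have h2 : B.ge (c : ℝ) ⊆ B.gt α := fun j (hj : (c : ℝ) ≤ B.r j) =>
        show α < B.r j from lt_of_lt_of_le (Set.mem_Ioi.1 c.2) hj
      exact B.U_mono h2 (B.mem_geEig.1 h1)
    | zero => exact zero_mem _
    | add x y _ _ hx hy => exact add_mem hx hy
  · intro hx
    have : B.U (B.gt α) ≤ (gtEig R α).restrictScalars ℂ := by
      rw [U, Submodule.span_le]
      rintro _ ⟨k, hk, rfl⟩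
      exact geEig_le_gtEig R hk (B.b_mem_geEig _ k le_rfl)
    exact this hx

theorem shift_mem_F (B : EigenBasis F R J) (α : ℝ) {c : ℤ} {x : G} (hx : x ∈ F c) :
    shift R (α : ℂ) x ∈ F (c + 1) := by
  rw [B.mem_F] at hx ⊢
  refine B.shift_mem_U _ (fun j hj => B.shift_b_mem α (fun k _ hk _ => ?_) (Or.inr ?_)) hx
  · change B.deg k ≤ c + 1
    rw [hk]; exact add_le_add_left hj 1
  · exact le_trans (show B.deg j ≤ c from hj) (by omega)

theorem shift_pow_mem_F (B : EigenBasis F R J) (α : ℝ) {c : ℤ} (a : ℕ) {x : G} (hx : x ∈ F c) :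
    (shift R (α : ℂ) ^ a) x ∈ F (a + c) := by
  induction a with
  | zero => simpa using hx
  | succ a ih =>
    rw [pow_succ', Module.End.mul_apply]
    rw [show ((a + 1 : ℕ) : ℤ) + c = a + c + 1 by push_cast; ring]
    exact B.shift_mem_F α ih

/-- `R - α` is nilpotent on `G_{≥α} / G_{>α}`, since it lowers the height of the basis vectors of
eigenvalue `α`. -/
theorem shift_pow_mem_gt (B : EigenBasis F R J) (α : ℝ) {x : G} (hx : x ∈ B.U (B.ge α)) :
    (shift R (α : ℂ) ^ B.m) x ∈ B.U (B.gt α) := by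
  have := B.shift_pow_mem_U (s := fun n => B.ge α ∩ {k | B.ht k < B.m - n} ∪ B.gt α) α
    (fun n j hj => B.shift_b_mem α (fun k h1 _ h3 => ?_) ?_) B.m 0 (x := x) (B.U_mono ?_ hx)
  · simpa using this
  · rcases hj with hj | hj
    · refine Or.inl ⟨le_trans hj.1 h1, ?_⟩
      have := hj.2
      change B.ht k < B.m - (n + 1)
      change B.ht j < B.m - n at this
      omega
    · exact Or.inr (lt_of_lt_of_le hj h1)
  · have hj' : α ≤ B.r j := by
      rcases hj with hj | hj
      · exact hj.1
      · exact le_of_lt hj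
    rcases hj'.eq_or_lt with h | h
    · exact Or.inl h.symm
    · exact Or.inr (Or.inr h)
  · exact fun j hj => Or.inl ⟨hj, by simpa using B.ht_lt j⟩

/-- Strictness of `(R - α)^a`. The basis splits `F`, and `R - α` is homogeneous of degree one
modulo the span of the basis vectors of eigenvalue greater than `α`; hence the part of `y` in
degrees greater than `b` contributes to `(R - α)^a y` only in degrees greater than `a + b`. -/
theorem exists_strict (B : EigenBasis F R J) (α : ℝ) (a : ℕ) (b : ℤ) {x y : G} (hx : x ∈ F (a + b))
    (hy : y ∈ B.U (B.ge α)) (h : (shift R (α : ℂ) ^ a) y - x ∈ B.U (B.gt α)) :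
    ∃ y' ∈ B.U (B.ge α), y' ∈ F b ∧ (shift R (α : ℂ) ^ a) y' - x ∈ B.U (B.gt α) := by
  obtain ⟨y', hy', z, hz, rfl⟩ := B.exists_add_of_mem_U {k | B.deg k ≤ b} hy
  have hF : y' ∈ F b := B.mem_F.2 (B.U_mono Set.inter_subset_right hy')
  refine ⟨y', B.U_mono Set.inter_subset_left hy', hF, ?_⟩
  have hz' := B.shift_pow_mem_U (s := fun n => B.ge α ∩ {k | n + b < B.deg k} ∪ B.gt α) α
    (fun n j hj => B.shift_b_mem α (fun k h1 h2 _ => ?_) ?_) a 0 (x := z) (B.U_mono ?_ hz)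
  · have h1 : (shift R (α : ℂ) ^ a) y' - x ∈
        B.U (B.ge α ∩ {k | a + b < B.deg k} ∪ B.gt α) := by
      have := sub_mem (B.U_mono Set.subset_union_right h) hz'
      rw [map_add] at this
      simpa [add_sub_right_comm] using this
    have h2 : (shift R (α : ℂ) ^ a) y' - x ∈ B.U {k | B.deg k ≤ a + b} :=
      B.mem_F.1 (sub_mem (B.shift_pow_mem_F α a hF) hx)
    refine B.U_mono ?_ (B.U_inf h1 h2)
    rintro j ⟨hj | hj, hj'⟩
    · exact absurd (show (a : ℤ) + b < B.deg j from hj.2) (not_lt.2 hj')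
    · exact hj
  · rcases hj with hj | hj
    · refine Or.inl ⟨le_trans hj.1 h1, ?_⟩
      have := hj.2
      change (n : ℤ) + b < B.deg j at this
      change ((n + 1 : ℕ) : ℤ) + b < B.deg k
      push_cast; omega
    · exact Or.inr (lt_of_lt_of_le hj h1)
  · have hj' : α ≤ B.r j := by
      rcases hj with hj | hj
      · exact hj.1
      · exact le_of_lt hj
    rcases hj'.eq_or_lt with h | h
    · exact Or.inl h.symm
    · exact Or.inr (Or.inr h)
  · exact fun j hj => Or.inl ⟨hj.1, by simpa using hj.2⟩

/-- If all eigenvalues are zero then `G = G_{≥0}` and `G_{>0} = 0`, so that `G` itself has the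
properties of `G_{≥0} / G_{>0}`. -/
theorem strictLefschetz_of_eigenvalues_eq_zero (B : EigenBasis F R J) (h0 : ∀ j, B.r j = 0) :
    StrictLefschetz F R := by
  have hgt : B.U (B.gt 0) = ⊥ := by
    have : B.gt 0 = ∅ := Set.eq_empty_of_forall_notMem fun j hj => (lt_irrefl (0 : ℝ)) (by
      have : 0 < B.r j := hj
      rwa [h0] at this)
    rw [this, U, Set.image_empty, Submodule.span_empty]
  have hge : B.U (B.ge 0) = ⊤ := by
    have : B.ge 0 = Set.univ := Set.eq_univ_of_forall fun j => (h0 j).ge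
    rw [this, B.U_univ]
  have hR : shift R ((0 : ℝ) : ℂ) = R := by rw [shift]; simp
  refine StrictLefschetz.of_strict ⟨B.m, ?_⟩ fun a b => le_antisymm ?_ ?_
  · ext x
    have := B.shift_pow_mem_gt 0 (x := x) (by rw [hge]; trivial)
    rwa [hgt, hR] at this
  · rintro _ ⟨x, hx, rfl⟩
    refine ⟨?_, x, rfl⟩
    have := B.shift_pow_mem_F 0 a hx
    rwa [hR] at this
  · rintro _ ⟨hx, y, rfl⟩
    obtain ⟨y', -, hF, h⟩ := B.exists_strict 0 a b hx (y := y) (by rw [hge]; trivial)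
      (by rw [hR, sub_self]; exact zero_mem _)
    rw [hgt, hR, Submodule.mem_bot, sub_eq_zero] at h
    exact ⟨y', hF, h⟩

/-- The subquotients `G_{≥α} / G_{>α}` satisfy the strictness and Lefschetz properties, with respect
to the endomorphism induced by `R - α`. -/
theorem strictLefschetz_eigEnd (B : EigenBasis F R J) (α : ℝ) :
    StrictLefschetz (eigF F R α) (eigEnd R α) := by
  have hmk : ∀ (a : ℕ) (x : geEig R α), ∃ h : (shift R (α : ℂ) ^ a) x ∈ geEig R α,
      (eigEnd R α ^ a) (Submodule.Quotient.mk x) = Submodule.Quotient.mk ⟨_, h⟩ := by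
    intro a x
    induction a with
    | zero => exact ⟨x.2, rfl⟩
    | succ a ih =>
      obtain ⟨h, e⟩ := ih
      rw [pow_succ', pow_succ', Module.End.mul_apply, Module.End.mul_apply, e]
      exact ⟨shift_mem_geEig R α _ h, rfl⟩
  have hmkF : ∀ (ℓ : ℤ) (z : EigMod R α), z ∈ eigF F R α ℓ ↔
      ∃ x : geEig R α, (x : G) ∈ F ℓ ∧ Submodule.Quotient.mk x = z := fun ℓ z => Iff.rfl
  have hq : ∀ x y : geEig R α, (Submodule.Quotient.mk x : EigMod R α) =
      Submodule.Quotient.mk y ↔ (x : G) - y ∈ B.U (B.gt α) := by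
    intro x y
    rw [Submodule.Quotient.eq, ← B.mem_gtEig]
    rfl
  refine StrictLefschetz.of_strict ⟨B.m, ?_⟩ fun a b => le_antisymm ?_ ?_
  · refine LinearMap.ext fun z => ?_
    induction z using Submodule.Quotient.induction_on with
    | H x =>
      obtain ⟨h, e⟩ := hmk B.m x
      rw [e, LinearMap.zero_apply, ← Submodule.Quotient.mk_zero, hq]
      simpa using B.shift_pow_mem_gt α (B.mem_geEig.1 x.2)
  · rintro _ ⟨z, hz, rfl⟩
    obtain ⟨x, hx, rfl⟩ := (hmkF _ _).1 hz
    refine ⟨?_, _, rfl⟩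
    obtain ⟨h, e⟩ := hmk a x
    exact (hmkF _ _).2 ⟨⟨_, h⟩, B.shift_pow_mem_F α a hx, e.symm⟩
  · rintro _ ⟨hx, z, rfl⟩
    obtain ⟨x, hxF, hx⟩ := (hmkF _ _).1 hx
    induction z using Submodule.Quotient.induction_on with
    | H y =>
      obtain ⟨h, e⟩ := hmk a y
      rw [e, eq_comm, hq] at hx
      obtain ⟨y', hy', hF, h'⟩ := B.exists_strict α a b hxF (B.mem_geEig.1 y.2) hx
      refine ⟨Submodule.Quotient.mk ⟨y', B.mem_geEig.2 hy'⟩,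
        (hmkF _ _).2 ⟨_, hF, rfl⟩, ?_⟩
      obtain ⟨h2, e2⟩ := hmk a ⟨y', B.mem_geEig.2 hy'⟩
      change (eigEnd R α ^ a) _ = _
      rw [e2, e, hq]
      have := sub_mem h' hx
      simpa using this

end EigenBasis

end EigenBasis

end FilteredEnd

/-! ### The de Rham differential of a logarithmic form -/

namespace LogDeRham

section Tensoriality

variable {A : Type*} [CommRing A] [Algebra ℂ A]

theorem ofDer_mul_smul (δ : Derivation ℂ A A) (a : A) (P : D A) :
    ofDer δ * (a • P) = a • (ofDer δ * P) + δ a • P := by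
  refine toEnd_injective (LinearMap.ext fun g => ?_)
  change δ (a * toEnd A P g) = a * δ (toEnd A P g) + δ a * toEnd A P g
  rw [Derivation.leibniz, smul_eq_mul, smul_eq_mul, mul_comm (toEnd A P g)]

theorem ofDer_add (δ ε : Derivation ℂ A A) : ofDer (δ + ε) = ofDer δ + ofDer ε := rfl

theorem ofDer_smul (a : A) (δ : Derivation ℂ A A) : ofDer (a • δ) = a • ofDer δ := rfl

theorem smul_mul (a : A) (P Q : D A) : (a • P) * Q = a • (P * Q) := mul_assoc _ _ _

theorem neg_one_pow_mul (k : ℕ) (P : D A) : (-1 : D A) ^ k * P = (-1 : A) ^ k • P := by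
  induction k with
  | zero => simp
  | succ k ih => rw [pow_succ', pow_succ', mul_smul, mul_assoc, ih, neg_one_mul, neg_one_smul]

variable {L : Submodule A (Derivation ℂ A A)}

/-- The bracket of vector fields on a submodule closed under it. -/
def bracket (hL : ∀ {δ η : Derivation ℂ A A}, δ ∈ L → η ∈ L → ⁅δ, η⁆ ∈ L) (x y : L) : L :=
  ⟨⁅(x : Derivation ℂ A A), (y : Derivation ℂ A A)⁆, hL x.2 y.2⟩

variable (hL : ∀ {δ η : Derivation ℂ A A}, δ ∈ L → η ∈ L → ⁅δ, η⁆ ∈ L)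

theorem bracket_self (x : L) : bracket hL x x = 0 := Subtype.ext (lie_self _)

theorem bracket_skew (x y : L) : bracket hL x y = -bracket hL y x :=
  Subtype.ext (lie_skew _ _).symm

theorem bracket_add_right (x y z : L) :
    bracket hL x (y + z) = bracket hL x y + bracket hL x z := Subtype.ext (lie_add _ _ _)

theorem bracket_smul_right (x : L) (a : A) (y : L) :
    bracket hL x (a • y) = a • bracket hL x y + (x : Derivation ℂ A A) a • y := by
  refine Subtype.ext (Derivation.ext fun g => ?_)
  simp only [bracket, Derivation.commutator_apply, Submodule.coe_add, Submodule.coe_smul,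
    Derivation.add_apply, Derivation.smul_apply, smul_eq_mul, Derivation.leibniz]
  ring

theorem bracket_add_left (x y z : L) :
    bracket hL (x + y) z = bracket hL x z + bracket hL y z := Subtype.ext (add_lie _ _ _)

theorem bracket_smul_left (x : L) (a : A) (y : L) :
    bracket hL (a • x) y = a • bracket hL x y - (y : Derivation ℂ A A) a • x := by
  rw [bracket_skew, bracket_smul_right, bracket_skew hL x y, smul_neg, neg_add, sub_eq_add_neg]

/-- The de Rham differential with the bracket placed in the slot `j` of the pair `i < j`. -/
theorem deRhamD_eq {p : ℕ} (η : Form L p) (ξ : Fin (p + 1) → L) :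
    deRhamD L hL η ξ = ∑ i : Fin (p + 1), (-1 : A) ^ (i : ℕ) •
      (ofDer (ξ i : Derivation ℂ A A) * η (i.removeNth ξ) - ∑ j ∈ Finset.Ioi i,
        η (i.removeNth (Function.update ξ j (bracket hL (ξ i) (ξ j))))) := by
  rw [deRhamD]
  exact Finset.sum_congr rfl fun i _ => neg_one_pow_mul _ _

section Slots

variable {p : ℕ} (η : Form L p) (ξ : Fin (p + 1) → L)

/-- Omitting the slot `i` after an update of another slot `k` is an update of the remaining
tuple. -/
theorem removeNth_update_of_ne {i k : Fin (p + 1)} (h : i ≠ k) :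
    ∃ k' : Fin p, i.succAbove k' = k ∧ ∀ (ζ : Fin (p + 1) → L) (x : L),
      i.removeNth (Function.update ζ k x) = Function.update (i.removeNth ζ) k' x := by
  obtain ⟨k', rfl⟩ := Fin.exists_succAbove_eq h.symm
  refine ⟨k', rfl, fun ζ x => ?_⟩
  ext l : 1
  by_cases hl : l = k'
  · subst hl; simp [Fin.removeNth]
  · simp [Fin.removeNth, hl, Fin.succAbove_right_injective.ne hl]

theorem map_removeNth_update_add {i k : Fin (p + 1)} (h : i ≠ k) (x y : L) :
    η (i.removeNth (Function.update ξ k (x + y))) =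
      η (i.removeNth (Function.update ξ k x)) + η (i.removeNth (Function.update ξ k y)) := by
  obtain ⟨k', -, hk⟩ := removeNth_update_of_ne (L := L) h
  simp only [hk, AlternatingMap.map_update_add]

theorem map_removeNth_update_smul {i k : Fin (p + 1)} (h : i ≠ k) (a : A) (x : L) :
    η (i.removeNth (Function.update ξ k (a • x))) =
      a • η (i.removeNth (Function.update ξ k x)) := by
  obtain ⟨k', -, hk⟩ := removeNth_update_of_ne (L := L) h
  simp only [hk, AlternatingMap.map_update_smul]

theorem map_removeNth_update_neg {i k : Fin (p + 1)} (h : i ≠ k) (x : L) :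
    η (i.removeNth (Function.update ξ k (-x))) = -η (i.removeNth (Function.update ξ k x)) := by
  rw [← neg_one_smul A x, map_removeNth_update_smul η ξ h, neg_one_smul]

theorem removeNth_update_self (i : Fin (p + 1)) (ζ : Fin (p + 1) → L) (x : L) :
    i.removeNth (Function.update ζ i x) = i.removeNth ζ := by
  ext l : 1
  simp [Fin.removeNth, Fin.succAbove_ne]

theorem map_removeNth_eq_zero {i a b : Fin (p + 1)} (ha : i ≠ a) (hb : i ≠ b) (hab : a ≠ b)
    (ζ : Fin (p + 1) → L) (h : ζ a = ζ b) : η (i.removeNth ζ) = 0 := by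
  obtain ⟨a', rfl⟩ := Fin.exists_succAbove_eq ha.symm
  obtain ⟨b', rfl⟩ := Fin.exists_succAbove_eq hb.symm
  exact η.map_eq_zero_of_eq _ h (fun h => hab (by rw [h]))

/-- Placing the same vector `x` in the slots `k` and `j` and omitting either of them. -/
theorem smul_map_removeNth_update_add {j k : Fin (p + 1)} (h : k ≠ j) (x : L) :
    (-1 : A) ^ (k : ℕ) • η (k.removeNth (Function.update ξ j x)) +
      (-1 : A) ^ (j : ℕ) • η (j.removeNth (Function.update ξ k x)) = 0 := by
  have := η.neg_one_pow_smul_map_removeNth_add_eq_zero_of_eq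
    (v := Function.update (Function.update ξ k x) j x) (i := k) (j := j) (by simp [h]) h
  rw [removeNth_update_self, Function.update_comm h, removeNth_update_self] at this
  simpa [neg_one_pow_mul] using! this

/-- The contribution of the bracket of the vectors in the slots `i` and `j`, with its sign. -/
def bracketTerm (i j : Fin (p + 1)) : D A :=
  (-1 : A) ^ (i : ℕ) • η (i.removeNth (Function.update ξ j (bracket hL (ξ i) (ξ j))))

theorem bracketTerm_symm {i j : Fin (p + 1)} (h : i ≠ j) :
    bracketTerm hL η ξ i j = bracketTerm hL η ξ j i := by
  rw [bracketTerm, bracketTerm, bracket_skew hL (ξ j), map_removeNth_update_neg η ξ h.symm,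
    smul_neg, ← add_eq_zero_iff_eq_neg]
  exact smul_map_removeNth_update_add η ξ h _

theorem bracketTerm_eq_zero {i j a b : Fin (p + 1)} (hab : a ≠ b) (h : ξ a = ξ b)
    (hia : i ≠ a) (hib : i ≠ b) (hja : j ≠ a) (hjb : j ≠ b) : bracketTerm hL η ξ i j = 0 := by
  rw [bracketTerm, map_removeNth_eq_zero η hia hib hab, smul_zero]
  rw [Function.update_of_ne hja.symm, Function.update_of_ne hjb.symm, h]

theorem bracketTerm_add {i a b : Fin (p + 1)} (hab : a ≠ b) (h : ξ a = ξ b)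
    (hia : i ≠ a) (hib : i ≠ b) : bracketTerm hL η ξ i a + bracketTerm hL η ξ i b = 0 := by
  obtain ⟨a', rfl⟩ := Fin.exists_succAbove_eq hia.symm
  obtain ⟨b', rfl⟩ := Fin.exists_succAbove_eq hib.symm
  have hab' : a' ≠ b' := fun h => hab (by rw [h])
  set x := bracket hL (ξ i) (ξ (i.succAbove a')) with hx
  have e : i.removeNth (Function.update ξ (i.succAbove b') x) =
      i.removeNth (Function.update ξ (i.succAbove a') x) ∘ Equiv.swap a' b' := by
    ext l : 1
    simp only [Fin.removeNth, Function.comp_apply]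
    by_cases h1 : l = a'
    · subst h1
      rw [Equiv.swap_apply_left, Function.update_of_ne hab, Function.update_of_ne hab.symm, h]
    · by_cases h2 : l = b'
      · subst h2
        rw [Equiv.swap_apply_right, Function.update_self, Function.update_self]
      · rw [Equiv.swap_apply_of_ne_of_ne h1 h2,
          Function.update_of_ne (Fin.succAbove_right_injective.ne h2),
          Function.update_of_ne (Fin.succAbove_right_injective.ne h1)]
  rw [bracketTerm, bracketTerm, ← h, ← hx, e, AlternatingMap.map_swap _ _ hab', smul_neg,
    add_neg_cancel]

theorem bracketTerm_of_eq {a b : Fin (p + 1)} (hab : a ≠ b) (h : ξ a = ξ b) :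
    bracketTerm hL η ξ a b = 0 := by
  rw [bracketTerm, h, bracket_self]
  obtain ⟨k', -, hk⟩ := removeNth_update_of_ne (L := L) hab
  rw [hk, η.map_update_zero, smul_zero]

/-- The bracket terms of `dη` cancel if two of the vectors are equal. The sum over `i < j` is half
of the symmetric sum over `i ≠ j`, whose terms cancel in pairs. -/
theorem sum_bracketTerm_eq_zero {a b : Fin (p + 1)} (hab : a ≠ b) (h : ξ a = ξ b) :
    ∑ i, ∑ j ∈ Finset.Ioi i, bracketTerm hL η ξ i j = 0 := by
  set Q := bracketTerm hL η ξ with hQ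
  have hrow : ∀ i, (∑ j, if i ≠ j then Q i j else 0) =
      (∑ j, if i < j then Q i j else 0) + ∑ j, if j < i then Q i j else 0 := by
    intro i
    rw [← Finset.sum_add_distrib]
    refine Finset.sum_congr rfl fun j _ => ?_
    rcases lt_trichotomy i j with h | h | h
    · simp [h, h.ne, h.not_gt]
    · simp [h]
    · simp [h, h.ne', h.not_gt]
  have hdouble : ∑ i, ∑ j, (if i ≠ j then Q i j else 0) =
      (2 : ℂ) • ∑ i, ∑ j ∈ Finset.Ioi i, Q i j := by
    rw [Finset.sum_congr rfl fun i _ => hrow i, Finset.sum_add_distrib, two_smul]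
    have e : ∀ i, ∑ j ∈ Finset.Ioi i, Q i j = ∑ j, if i < j then Q i j else 0 := by
      intro i
      rw [← Finset.sum_filter]
      exact Finset.sum_congr (by ext; simp) fun _ _ => rfl
    simp only [e]
    congr 1
    rw [Finset.sum_comm]
    refine Finset.sum_congr rfl fun i _ => Finset.sum_congr rfl fun j _ => ?_
    split_ifs with hij
    · exact bracketTerm_symm hL η ξ hij.ne'
    · rfl
  have hzero : ∑ i, ∑ j, (if i ≠ j then Q i j else 0) = 0 := by
    rw [Fintype.sum_eq_add a b hab, ← Finset.sum_add_distrib]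
    · refine Finset.sum_eq_zero fun j _ => ?_
      by_cases hja : j = a
      · subst hja
        simp [hab.symm, hQ, bracketTerm_of_eq hL η ξ hab.symm h.symm]
      by_cases hjb : j = b
      · subst hjb
        simp [hab, hQ, bracketTerm_of_eq hL η ξ hab h]
      rw [if_pos (Ne.symm hja), if_pos (Ne.symm hjb), hQ, bracketTerm_symm hL η ξ (Ne.symm hja),
        bracketTerm_symm hL η ξ (Ne.symm hjb), bracketTerm_add hL η ξ hab h hja hjb]
    · rintro i ⟨hia, hib⟩
      rw [Fintype.sum_eq_add a b hab, if_pos hia, if_pos hib,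
        hQ, bracketTerm_add hL η ξ hab h hia hib]
      rintro j ⟨hja, hjb⟩
      split_ifs
      · exact bracketTerm_eq_zero hL η ξ hab h hia hib hja hjb
      · rfl
  rw [hdouble] at hzero
  exact (smul_eq_zero.1 hzero).resolve_left two_ne_zero

/-- The terms of `dη` with a derivative cancel if two of the vectors are equal. -/
theorem sum_derivTerm_eq_zero {a b : Fin (p + 1)} (hab : a ≠ b) (h : ξ a = ξ b) :
    ∑ i : Fin (p + 1), (-1 : A) ^ (i : ℕ) •
      (ofDer (ξ i : Derivation ℂ A A) * η (i.removeNth ξ)) = 0 := by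
  rw [Fintype.sum_eq_add a b hab]
  · have := smul_map_removeNth_update_add η ξ hab (ξ a)
    rw [h, Function.update_eq_self, ← h, Function.update_eq_self] at this
    have e : ∀ (k : ℕ) (d P : D A), (-1 : A) ^ k • (d * P) = d * ((-1 : A) ^ k • P) := by
      intro k d P
      rw [← neg_one_pow_mul, ← neg_one_pow_mul]
      exact ((Commute.neg_one_left d).pow_left k).left_comm P
    rw [h, e, e, ← mul_add, this, mul_zero]
  · rintro i ⟨hia, hib⟩
    rw [map_removeNth_eq_zero η hia hib hab ξ h, mul_zero, smul_zero]

/-- The de Rham differential of a form is a form. The terms that involve derivatives of a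
coefficient `a` cancel in pairs, by `smul_map_removeNth_update_add`. -/
def deRham : Form L (p + 1) :=
  { MultilinearMap.mk' (deRhamD L hL η)
      (fun ξ k x y => by
        simp only [deRhamD_eq]
        rw [← Finset.sum_add_distrib]
        refine Finset.sum_congr rfl fun i _ => ?_
        rw [← smul_add]
        congr 1
        by_cases hik : i = k
        · subst hik
          simp only [Function.update_self, removeNth_update_self, Submodule.coe_add, ofDer_add,
            add_mul]
          rw [sub_add_sub_comm, ← Finset.sum_add_distrib]
          congr 1
          refine Finset.sum_congr rfl fun j hj => ?_
          have hij : i ≠ j := (Finset.mem_Ioi.1 hj).ne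
          simp only [Function.update_of_ne hij.symm, Function.update_comm hij,
            removeNth_update_self, bracket_add_left, map_removeNth_update_add η ξ hij]
        · simp only [Function.update_of_ne hik, map_removeNth_update_add η ξ hik, mul_add]
          rw [sub_add_sub_comm, ← Finset.sum_add_distrib]
          congr 1
          refine Finset.sum_congr rfl fun j hj => ?_
          by_cases hjk : j = k
          · subst hjk
            simp only [Function.update_self, Function.update_idem, bracket_add_right,
              map_removeNth_update_add η ξ hik]
          · simp only [Function.update_of_ne hjk, Function.update_comm (Ne.symm hjk),
              map_removeNth_update_add η _ hik])
      (fun ξ k a x => by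
        simp only [deRhamD_eq]
        rw [Finset.smul_sum, ← sub_eq_zero, ← Finset.sum_sub_distrib]
        -- The defect of `A`-linearity in the slot `k`: for `i = k` it comes from the brackets, for
        -- `i > k` from the derivatives of `a` and for `i < k` these two contributions cancel.
        have key : ∀ i : Fin (p + 1),
            (-1 : A) ^ (i : ℕ) • (ofDer (Function.update ξ k (a • x) i : Derivation ℂ A A) *
                η (i.removeNth (Function.update ξ k (a • x))) - ∑ j ∈ Finset.Ioi i,
              η (i.removeNth (Function.update (Function.update ξ k (a • x)) j
                (bracket hL (Function.update ξ k (a • x) i) (Function.update ξ k (a • x) j))))) -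
            a • (-1 : A) ^ (i : ℕ) • (ofDer (Function.update ξ k x i : Derivation ℂ A A) *
                η (i.removeNth (Function.update ξ k x)) - ∑ j ∈ Finset.Ioi i,
              η (i.removeNth (Function.update (Function.update ξ k x) j
                (bracket hL (Function.update ξ k x i) (Function.update ξ k x j))))) =
            if i = k then ∑ j ∈ Finset.Ioi k, (ξ j : Derivation ℂ A A) a •
              (-1 : A) ^ (k : ℕ) • η (k.removeNth (Function.update ξ j x))
            else if k < i then (ξ i : Derivation ℂ A A) a •
              (-1 : A) ^ (i : ℕ) • η (i.removeNth (Function.update ξ k x)) else 0 := by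
          intro i
          rw [smul_comm a, ← smul_sub, smul_sub a, sub_sub_sub_comm, Finset.smul_sum,
            ← Finset.sum_sub_distrib]
          by_cases hik : i = k
          · subst hik
            simp only [Function.update_self, removeNth_update_self, Submodule.coe_smul,
              ofDer_smul, smul_mul, sub_self, zero_sub, if_true]
            rw [smul_neg, ← smul_neg, ← Finset.sum_neg_distrib, Finset.smul_sum]
            refine Finset.sum_congr rfl fun j hj => ?_
            have hij : i ≠ j := (Finset.mem_Ioi.1 hj).ne
            simp only [Function.update_of_ne hij.symm, Function.update_comm hij,
              removeNth_update_self, bracket_smul_left, sub_eq_add_neg,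
              map_removeNth_update_add η ξ hij, map_removeNth_update_neg η ξ hij,
              map_removeNth_update_smul η ξ hij]
            rw [smul_comm ((ξ j : Derivation ℂ A A) a)]
            congr 1
            abel
          · simp only [Function.update_of_ne hik, map_removeNth_update_smul η ξ hik,
              ofDer_mul_smul, if_neg hik, add_sub_cancel_left]
            have hterm : ∀ j ∈ Finset.Ioi i,
                η (i.removeNth (Function.update (Function.update ξ k (a • x)) j
                  (bracket hL (ξ i) (Function.update ξ k (a • x) j)))) -
                a • η (i.removeNth (Function.update (Function.update ξ k x) j
                  (bracket hL (ξ i) (Function.update ξ k x j)))) =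
                if j = k then (ξ i : Derivation ℂ A A) a •
                  η (i.removeNth (Function.update ξ k x)) else 0 := by
              intro j hj
              by_cases hjk : j = k
              · subst hjk
                simp only [Function.update_self, Function.update_idem, bracket_smul_right,
                  map_removeNth_update_add η ξ hik, map_removeNth_update_smul η ξ hik,
                  add_sub_cancel_left, if_true]
              · simp only [Function.update_of_ne hjk, Function.update_comm (Ne.symm hjk),
                  map_removeNth_update_smul η _ hik, sub_self, if_neg hjk]
            rw [Finset.sum_congr rfl hterm, Finset.sum_ite_eq']
            rcases lt_or_gt_of_ne hik with h | h
            · rw [if_pos (Finset.mem_Ioi.2 h), sub_self, smul_zero, if_neg h.not_gt]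
            · rw [if_neg (by simpa using h.le), sub_zero, if_pos h, smul_comm]
        rw [Finset.sum_congr rfl fun i _ => key i,
          ← Finset.add_sum_erase _ _ (Finset.mem_univ k), if_pos rfl]
        have h2 : ∑ i ∈ Finset.univ.erase k, (if i = k then ∑ j ∈ Finset.Ioi k,
              (ξ j : Derivation ℂ A A) a •
                (-1 : A) ^ (k : ℕ) • η (k.removeNth (Function.update ξ j x))
            else if k < i then (ξ i : Derivation ℂ A A) a •
              (-1 : A) ^ (i : ℕ) • η (i.removeNth (Function.update ξ k x)) else 0) =
            ∑ i ∈ Finset.Ioi k, (ξ i : Derivation ℂ A A) a •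
              (-1 : A) ^ (i : ℕ) • η (i.removeNth (Function.update ξ k x)) := by
          rw [← Finset.sum_subset (s₁ := Finset.Ioi k)]
          · refine Finset.sum_congr rfl fun i hi => ?_
            have := Finset.mem_Ioi.1 hi
            rw [if_neg this.ne', if_pos this]
          · intro i hi
            simpa using (Finset.mem_Ioi.1 hi).ne'
          · intro i hi hi'
            rw [if_neg (Finset.ne_of_mem_erase hi), if_neg (by simpa using hi')]
        rw [h2, ← Finset.sum_add_distrib]
        refine Finset.sum_eq_zero fun j hj => ?_
        rw [← smul_add, smul_map_removeNth_update_add η ξ (Finset.mem_Ioi.1 hj).ne, smul_zero]) with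
    map_eq_zero_of_eq' := fun ξ a b h hab => by
      change deRhamD L hL η ξ = 0
      rw [deRhamD_eq]
      simp only [smul_sub, Finset.sum_sub_distrib, Finset.smul_sum]
      rw [sum_derivTerm_eq_zero η ξ hab h, zero_sub, neg_eq_zero]
      exact sum_bracketTerm_eq_zero hL η ξ hab h }

theorem deRham_apply : deRham hL η ξ = deRhamD L hL η ξ := rfl

end Slots

end Tensoriality

end LogDeRham

/-! ### Taylor coordinates -/

namespace LogDeRham

/-- Coordinates on a `ℂ`-algebra `A` of power series type: functions `z_i` and derivations `d_i`
together with Taylor coefficients. The coefficients are indexed by all integer vectors, and vanish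
if an index is negative; with this convention the formulas for the coefficients of `d_i a` and
`z_i a` hold without case distinctions. -/
structure TaylorCoords (A : Type*) [CommRing A] [Algebra ℂ A] (N : ℕ) where
  /-- The coordinate functions. -/
  z : Fin N → A
  /-- The partial derivatives. -/
  d : Fin N → Derivation ℂ A A
  /-- The Taylor coefficients. -/
  coeff : (Fin N → ℤ) → A →ₗ[ℂ] ℂ
  coeff_of_neg : ∀ (v : Fin N → ℤ) (i : Fin N) (a : A), v i < 0 → coeff v a = 0
  coeff_zero_one : coeff 0 1 = 1
  coeff_d : ∀ v i a, coeff v (d i a) = (v i + 1) * coeff (v + Pi.single i 1) a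
  coeff_z : ∀ v i a, coeff v (z i * a) = coeff (v - Pi.single i 1) a
  coeff_inj : ∀ a, (∀ v, coeff v a = 0) → a = 0
  /-- Division by a coordinate, with a remainder independent of that coordinate. -/
  div : ∀ (i : Fin N) (a : A), ∃ r b, a = r + z i * b ∧ d i r = 0

/-- Induction on multi-indices, one unit in one direction at a time. -/
theorem multiindex_induction {N : ℕ} {p : (Fin N → ℕ) → Prop} (h0 : p 0)
    (h1 : ∀ β i, p β → p (β + Pi.single i 1)) (β : Fin N → ℕ) : p β := by
  induction h : ∑ i, β i generalizing β with
  | zero =>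
    have : β = 0 := funext fun i => by
      simpa using (Finset.sum_eq_zero_iff.1 h) i (Finset.mem_univ i)
    rwa [this]
  | succ n ih =>
    obtain ⟨i, hi⟩ : ∃ i, β i ≠ 0 := by
      by_contra! hall
      simp [hall] at h
    have e : β = (β - Pi.single i 1) + Pi.single i 1 := by
      ext j
      by_cases hj : j = i
      · subst hj; simp; omega
      · simp [hj]
    rw [e]
    refine h1 _ _ (ih _ ?_)
    have := congrArg (fun f => ∑ j, f j) e
    simp only [Pi.add_apply, Finset.sum_add_distrib, Finset.sum_pi_single', Finset.mem_univ,
      if_true] at this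
    omega

section MultiPow

variable {R : Type*} [Monoid R] {N : ℕ} (x : Fin N → R) (h : ∀ i j, Commute (x i) (x j))

theorem powersHom_commute (h : ∀ i j, Commute (x i) (x j)) : Pairwise fun i j =>
    ∀ a b : Multiplicative ℕ, Commute (powersHom R (x i) a) (powersHom R (x j) b) :=
  fun i j _ _ _ => ((h i j).pow_left _).pow_right _

/-- The product of the `β_i`-th powers of commuting elements `x_i`. -/
def multiPow (β : Fin N → ℕ) : R :=
  MonoidHom.noncommPiCoprod (fun i => powersHom R (x i)) (powersHom_commute x h)
    fun i => Multiplicative.ofAdd (β i)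

theorem multiPow_zero : multiPow x h 0 = 1 := map_one (MonoidHom.noncommPiCoprod _ _)

theorem multiPow_add (β γ : Fin N → ℕ) :
    multiPow x h (β + γ) = multiPow x h β * multiPow x h γ :=
  map_mul (MonoidHom.noncommPiCoprod _ _) _ _

theorem multiPow_single (i : Fin N) : multiPow x h (Pi.single i 1) = x i := by
  have : (fun j => Multiplicative.ofAdd ((Pi.single i 1 : Fin N → ℕ) j)) =
      Pi.mulSingle i (Multiplicative.ofAdd 1) := by
    ext j
    by_cases hj : j = i
    · subst hj; simp
    · simp [hj]
  rw [multiPow, this, MonoidHom.noncommPiCoprod_mulSingle]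
  simp

end MultiPow

namespace TaylorCoords

variable {A : Type*} [CommRing A] [Algebra ℂ A] {N : ℕ} (c : TaylorCoords A N)

theorem ext_coeff {a b : A} (h : ∀ v, c.coeff v a = c.coeff v b) : a = b :=
  sub_eq_zero.1 (c.coeff_inj _ fun v => by rw [map_sub, h, sub_self])

theorem coeff_eq_zero_of_d {i : Fin N} {a : A} (h : c.d i a = 0) {v : Fin N → ℤ}
    (hv : v i ≠ 0) : c.coeff v a = 0 := by
  have := c.coeff_d (v - Pi.single i 1) i a
  rw [h, map_zero, sub_add_cancel] at this
  simpa [hv] using this.symm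

theorem d_comm (i j : Fin N) (a : A) : c.d i (c.d j a) = c.d j (c.d i a) := by
  by_cases hij : i = j
  · rw [hij]
  refine c.ext_coeff fun v => ?_
  simp only [c.coeff_d, Pi.add_apply, Pi.single_eq_of_ne hij, Pi.single_eq_of_ne (Ne.symm hij),
    add_right_comm v (Pi.single i 1), add_zero]
  ring

theorem coeff_one_of_ne {v : Fin N → ℤ} (hv : v ≠ 0) : c.coeff v 1 = 0 := by
  obtain ⟨i, hi⟩ := Function.ne_iff.1 hv
  exact c.coeff_eq_zero_of_d (Derivation.map_one_eq_zero _) hi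

theorem d_z (i j : Fin N) : c.d i (c.z j) = if i = j then 1 else 0 := by
  refine c.ext_coeff fun v => ?_
  rw [c.coeff_d, ← mul_one (c.z j), c.coeff_z]
  split_ifs with h
  · subst h
    rw [add_sub_cancel_right]
    by_cases hv : v = 0
    · subst hv; simp
    · rw [c.coeff_one_of_ne hv, mul_zero]
  · rw [map_zero]
    by_cases hv : v i = -1
    · simp [hv]
    · rw [c.coeff_one_of_ne, mul_zero]
      intro h0
      have := congrFun h0 i
      simp [h] at this
      omega

theorem d_z_self (i : Fin N) : c.d i (c.z i) = 1 := by rw [d_z, if_pos rfl]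

theorem d_z_of_ne {i j : Fin N} (h : i ≠ j) : c.d i (c.z j) = 0 := by rw [d_z, if_neg h]

theorem z_mul_eq_zero {i : Fin N} {a : A} (h : c.z i * a = 0) : a = 0 :=
  c.coeff_inj _ fun v => by
    rw [← add_sub_cancel_right v (Pi.single i 1), ← c.coeff_z, h, map_zero]

/-- Division by `z_i` preserves independence of another coordinate. -/
theorem d_eq_zero_of_div {i j : Fin N} (hij : i ≠ j) {r b : A} (hr : c.d i r = 0)
    (h : c.d j (r + c.z i * b) = 0) : c.d j r = 0 ∧ c.d j b = 0 := by
  have hr' : c.d j r = 0 := by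
    refine c.coeff_inj _ fun v => ?_
    by_cases hv : v i = 0
    · have h1 := congrArg (c.coeff v) h
      rw [map_zero, c.coeff_d, map_add, c.coeff_z,
        c.coeff_of_neg (v + Pi.single j 1 - Pi.single i 1) i _ (by simp [hij, hv]), add_zero] at h1
      rw [c.coeff_d, h1]
    · rw [c.coeff_d, c.coeff_eq_zero_of_d hr (by simpa [hij] using hv), mul_zero]
  refine ⟨hr', ?_⟩
  rw [map_add, hr', zero_add, Derivation.leibniz, c.d_z_of_ne hij.symm, smul_zero, add_zero] at h
  exact c.z_mul_eq_zero h

/-- Successive division by the `z_i` with `i ∈ T`. -/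
theorem exists_eq_add_sum (a : A) (T : Finset (Fin N)) :
    ∃ r, ∃ b : Fin N → A, a = r + ∑ i ∈ T, c.z i * b i ∧ ∀ i ∈ T, c.d i r = 0 := by
  classical
  induction T using Finset.induction_on with
  | empty => exact ⟨a, 0, by simp, by simp⟩
  | insert j T hj ih =>
    obtain ⟨r, b, e, hr⟩ := ih
    obtain ⟨r', b', e', hr'⟩ := c.div j r
    refine ⟨r', Function.update b j b', ?_, ?_⟩
    · rw [Finset.sum_insert hj, Function.update_self, e, e', add_assoc]
      congr 2
      exact Finset.sum_congr rfl fun i hi => by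
        rw [Function.update_of_ne (ne_of_mem_of_not_mem hi hj)]
    · intro i hi
      rcases Finset.mem_insert.1 hi with rfl | hi
      · exact hr'
      · exact (c.d_eq_zero_of_div (ne_of_mem_of_not_mem hi hj).symm hr'
        (by rw [← e']; exact hr i hi)).1

/-- The maximal ideal is generated by the coordinates, and the residue field is `ℂ`. -/
theorem exists_eq_const_add_sum (a : A) :
    ∃ r : ℂ, ∃ b : Fin N → A, a = algebraMap ℂ A r + ∑ i, c.z i * b i := by
  obtain ⟨r, b, e, hr⟩ := c.exists_eq_add_sum a Finset.univ
  refine ⟨c.coeff 0 r, b, ?_⟩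
  rw [e]
  congr 1
  refine c.ext_coeff fun v => ?_
  rw [Algebra.algebraMap_eq_smul_one, map_smul, smul_eq_mul]
  by_cases hv : v = 0
  · rw [hv, c.coeff_zero_one, mul_one]
  · rw [c.coeff_one_of_ne hv, mul_zero]
    obtain ⟨i, hi⟩ := Function.ne_iff.1 hv
    exact c.coeff_eq_zero_of_d (hr i (Finset.mem_univ i)) hi

/-- A derivation is determined by its values on the coordinates: if these vanish then it maps `A`
into all powers of the maximal ideal. -/
theorem derivation_eq_zero {δ : Derivation ℂ A A} (h : ∀ i, δ (c.z i) = 0) : δ = 0 := by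
  -- The coefficients of `δ a` vanish up to any total degree.
  have key : ∀ n : ℕ, ∀ v : Fin N → ℤ, ∑ i, v i < n → ∀ a, c.coeff v (δ a) = 0 := by
    intro n
    induction n with
    | zero =>
      intro v hv a
      obtain ⟨i, hi⟩ : ∃ i, v i < 0 := by
        by_contra! hall
        exact absurd (Finset.sum_nonneg fun i _ => hall i) (by simpa using hv)
      exact c.coeff_of_neg v i _ hi
    | succ n ih =>
      intro v hv a
      obtain ⟨r, b, e⟩ := c.exists_eq_const_add_sum a
      rw [e, map_add, Derivation.map_algebraMap, zero_add, map_sum, map_sum]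
      refine Finset.sum_eq_zero fun i _ => ?_
      rw [Derivation.leibniz, h, smul_zero, add_zero, smul_eq_mul, c.coeff_z]
      refine ih _ ?_ _
      simp only [Pi.sub_apply, Finset.sum_sub_distrib, Finset.sum_pi_single', Finset.mem_univ,
        if_true]
      push_cast at hv
      omega
  ext a
  exact c.coeff_inj _ fun v => key (∑ i, v i).toNat.succ v (by push_cast; omega) a

theorem derivation_eq_sum (δ : Derivation ℂ A A) : δ = ∑ i, δ (c.z i) • c.d i := by
  rw [← sub_eq_zero]
  refine c.derivation_eq_zero fun j => ?_
  have : (∑ i, δ (c.z i) • c.d i : Derivation ℂ A A) (c.z j) = δ (c.z j) := by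
    rw [← Derivation.coeFnAddMonoidHom_apply, map_sum, Finset.sum_apply]
    simp [c.d_z]
  rw [Derivation.sub_apply, this, sub_self]

/-- The monomial `z^u`. -/
def zpow (u : Fin N → ℕ) : A := ∏ i, c.z i ^ u i

theorem zpow_zero : c.zpow 0 = 1 := by simp [zpow]

theorem zpow_add (u v : Fin N → ℕ) : c.zpow (u + v) = c.zpow u * c.zpow v := by
  simp [zpow, pow_add, Finset.prod_mul_distrib]

theorem zpow_single (i : Fin N) : c.zpow (Pi.single i 1) = c.z i := by
  rw [zpow, Finset.prod_eq_single i]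
  · simp
  · intro j _ hj; simp [hj]
  · simp

theorem coeff_zpow_mul (u : Fin N → ℕ) (v : Fin N → ℤ) (a : A) :
    c.coeff v (c.zpow u * a) = c.coeff (v - fun i => (u i : ℤ)) a := by
  induction u using multiindex_induction generalizing v with
  | h0 => rw [zpow_zero, one_mul]; congr 2; ext i; simp
  | h1 u i ih =>
    rw [zpow_add, zpow_single, mul_comm (c.zpow u), mul_assoc, c.coeff_z, ih]
    congr 2
    ext j
    by_cases hj : j = i
    · subst hj; simp; ring
    · simp [hj]

theorem zpow_mul_eq_zero {u : Fin N → ℕ} {a : A} (h : c.zpow u * a = 0) : a = 0 :=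
  c.coeff_inj _ fun v => by
    rw [← add_sub_cancel_right v (fun i => (u i : ℤ)), ← c.coeff_zpow_mul, h, map_zero]

theorem coeff_zpow (u : Fin N → ℕ) (v : Fin N → ℤ) :
    c.coeff v (c.zpow u) = if v = (fun i => (u i : ℤ)) then 1 else 0 := by
  rw [← mul_one (c.zpow u), coeff_zpow_mul]
  split_ifs with h
  · rw [h, sub_self, c.coeff_zero_one]
  · exact c.coeff_one_of_ne (sub_ne_zero.2 h)

theorem d_zpow (i : Fin N) (u : Fin N → ℕ) :
    c.d i (c.zpow u) = (u i : ℂ) • c.zpow (u - Pi.single i 1) := by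
  refine c.ext_coeff fun v => ?_
  rw [c.coeff_d, coeff_zpow, map_smul, coeff_zpow, smul_eq_mul]
  by_cases hu : u i = 0
  · rw [hu, Nat.cast_zero, zero_mul]
    split_ifs with h
    · have := congrFun h i
      simp [hu] at this
      rw [mul_one]; exact_mod_cast this
    · rw [mul_zero]
  · have : v + Pi.single i 1 = (fun j => (u j : ℤ)) ↔
        v = fun j => ((u - Pi.single i 1 : Fin N → ℕ) j : ℤ) := by
      rw [← eq_sub_iff_add_eq]
      have : (fun j => (u j : ℤ)) - Pi.single i 1 =
          fun j => ((u - Pi.single i 1 : Fin N → ℕ) j : ℤ) := by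
        ext j
        by_cases hj : j = i
        · subst hj; simp; omega
        · simp [hj]
      rw [this]
    simp only [this]
    split_ifs with h
    · rw [h]
      simp only [Pi.sub_apply, Pi.single_eq_same, mul_one]
      have : 1 ≤ u i := by omega
      push_cast [this]; ring
    · simp

end TaylorCoords

end LogDeRham

/-! ### Differential operators in coordinates -/

namespace LogDeRham

section OpLemmas

variable {A : Type*} [CommRing A] [Algebra ℂ A]

instance : IsScalarTower ℂ A (D A) where
  smul_assoc r a P := toEnd_injective (LinearMap.ext fun g => smul_mul_assoc r a (toEnd A P g))

theorem toEnd_smul_apply (a : A) (P : D A) (g : A) : toEnd A (a • P) g = a * toEnd A P g := rfl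

theorem toEnd_ofDer_apply (δ : Derivation ℂ A A) (g : A) : toEnd A (ofDer δ) g = δ g := rfl

theorem toEnd_mul_apply (P Q : D A) (g : A) : toEnd A (P * Q) g = toEnd A P (toEnd A Q g) := by
  rw [map_mul]; rfl

/-- The span of the derivations in the endomorphisms consists of derivations. -/
theorem derOps_eq (T : Module.End ℂ A) (hT : T ∈ derOps A) :
    ∃ δ : Derivation ℂ A A, (δ : A →ₗ[ℂ] A) = T := by
  induction hT using Submodule.span_induction with
  | mem T hT => exact hT
  | zero => exact ⟨0, rfl⟩
  | add S T _ _ hS hT =>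
    obtain ⟨δ, rfl⟩ := hS
    obtain ⟨ε, rfl⟩ := hT
    exact ⟨δ + ε, rfl⟩
  | smul r T _ hT =>
    obtain ⟨δ, rfl⟩ := hT
    exact ⟨r • δ, rfl⟩

theorem mulOps_sup_pow_succ (m : ℕ) : (mulOps A ⊔ derOps A) ^ (m + 1) =
    (mulOps A ⊔ derOps A) * (mulOps A ⊔ derOps A) ^ m := by
  rcases Nat.eq_zero_or_pos m with rfl | h
  · rw [zero_add, Submodule.pow_one, Submodule.pow_zero, Submodule.mul_one]
  · exact Submodule.pow_succ' _ h.ne'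

/-- `D` is the smallest left submodule that contains `1` and is stable under left multiplication
by functions and derivations. -/
theorem D_induction (W : Submodule A (D A)) (h1 : (1 : D A) ∈ W)
    (hd : ∀ (δ : Derivation ℂ A A), ∀ P ∈ W, ofDer δ * P ∈ W) (P : D A) : P ∈ W := by
  have key : ∀ T ∈ diffOps A, ∀ Q ∈ W, ∃ Q' ∈ W, toEnd A Q' = T * toEnd A Q := by
    intro T hT
    induction hT using Algebra.adjoin_induction with
    | mem T hT =>
      intro Q hQ
      rcases hT with ⟨a, rfl⟩ | hT
      · exact ⟨a • Q, W.smul_mem a hQ, rfl⟩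
      · obtain ⟨δ, rfl⟩ := derOps_eq T hT
        exact ⟨_, hd δ Q hQ, rfl⟩
    | algebraMap r =>
      intro Q hQ
      refine ⟨algebraMap ℂ A r • Q, W.smul_mem _ hQ, ?_⟩
      rw [algebraMap_smul, map_smul, Algebra.smul_def]
    | add S T hS hT ihS ihT =>
      intro Q hQ
      obtain ⟨P, hP, e⟩ := ihS Q hQ
      obtain ⟨P', hP', e'⟩ := ihT Q hQ
      exact ⟨P + P', add_mem hP hP', by rw [map_add, e, e', add_mul]⟩
    | mul S T hS hT ihS ihT =>
      intro Q hQ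
      obtain ⟨P, hP, e⟩ := ihT Q hQ
      obtain ⟨P', hP', e'⟩ := ihS P hP
      exact ⟨P', hP', by rw [e', e, mul_assoc]⟩
  obtain ⟨Q, hQ, e⟩ := key (toEnd A P) P.2 1 h1
  rw [map_one, mul_one] at e
  rwa [← toEnd_injective e]

end OpLemmas

namespace TaylorCoords

variable {A : Type*} [CommRing A] [Algebra ℂ A] {N : ℕ} (c : TaylorCoords A N)

/-- The partial derivative `d_i` as a differential operator. -/
def del (i : Fin N) : D A := ofDer (c.d i)

theorem del_comm (i j : Fin N) : Commute (c.del i) (c.del j) :=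
  toEnd_injective (LinearMap.ext fun g => by
    rw [toEnd_mul_apply, toEnd_mul_apply]; exact c.d_comm i j g)

theorem del_mul_smul (i : Fin N) (a : A) (P : D A) :
    c.del i * (a • P) = a • (c.del i * P) + c.d i a • P := ofDer_mul_smul _ _ _

/-- The operator `d^β`. -/
def pd (β : Fin N → ℕ) : D A := multiPow c.del c.del_comm β

theorem pd_zero : c.pd 0 = 1 := multiPow_zero _ _

theorem pd_add (β γ : Fin N → ℕ) : c.pd (β + γ) = c.pd β * c.pd γ := multiPow_add _ _ _ _

theorem pd_single (i : Fin N) : c.pd (Pi.single i 1) = c.del i := multiPow_single _ _ _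

theorem pd_add_single (β : Fin N → ℕ) (i : Fin N) :
    c.pd (β + Pi.single i 1) = c.del i * c.pd β := by
  rw [add_comm, pd_add, pd_single]

theorem toEnd_pd_zpow (γ β : Fin N → ℕ) : toEnd A (c.pd γ) (c.zpow β) =
    (∏ i, ((β i).descFactorial (γ i) : ℂ)) • c.zpow (β - γ) := by
  induction γ using multiindex_induction with
  | h0 => rw [pd_zero, map_one]; simp
  | h1 γ j ih =>
    rw [pd_add_single, toEnd_mul_apply, ih, map_smul, del, toEnd_ofDer_apply, d_zpow, smul_smul]
    have e1 : β - γ - Pi.single j 1 = β - (γ + Pi.single j 1) := by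
      rw [tsub_tsub]
    rw [e1, ← Finset.mul_prod_erase _ _ (Finset.mem_univ j),
      ← Finset.mul_prod_erase _ _ (Finset.mem_univ j)]
    congr 1
    have e2 : ∏ i ∈ Finset.univ.erase j,
        ((β i).descFactorial ((γ + Pi.single j 1 : Fin N → ℕ) i) : ℂ) =
        ∏ i ∈ Finset.univ.erase j, ((β i).descFactorial (γ i) : ℂ) :=
      Finset.prod_congr rfl fun i hi => by simp [Finset.ne_of_mem_erase hi]
    rw [e2]
    simp only [Pi.add_apply, Pi.single_eq_same, Nat.descFactorial_succ, Pi.sub_apply]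
    push_cast; ring

/-- Evaluate a relation at the monomial `z^β` with `β` minimal among the indices that occur. -/
theorem linearIndependent_pd : LinearIndependent A c.pd := by
  rw [linearIndependent_iff]
  intro f hf
  by_contra hne
  obtain ⟨β, hβ, hmin⟩ := Finset.exists_min_image f.support (fun β => ∑ i, β i)
    (Finsupp.support_nonempty_iff.2 hne)
  have h1 := congrArg (fun P => toEnd A P (c.zpow β)) hf
  simp only [Finsupp.linearCombination_apply, Finsupp.sum, map_sum, LinearMap.sum_apply, map_zero,
    LinearMap.zero_apply, toEnd_smul_apply, toEnd_pd_zpow] at h1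
  rw [Finset.sum_eq_single β] at h1
  · rw [tsub_self, zpow_zero, mul_smul_comm, mul_one] at h1
    rcases smul_eq_zero.1 h1 with h | h
    · simp [Finset.prod_eq_zero_iff, Nat.descFactorial_eq_zero_iff_lt] at h
    · exact (Finsupp.mem_support_iff.1 hβ) h
  · intro γ hγ hγβ
    obtain ⟨i, hi⟩ : ∃ i, β i < γ i := by
      by_contra! hall
      refine hγβ (funext fun i => ?_)
      have := hmin γ hγ
      exact (Finset.sum_eq_sum_iff_of_le (fun i _ => hall i)).1
        (le_antisymm (Finset.sum_le_sum fun i _ => hall i) this) i (Finset.mem_univ i)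
    rw [Finset.prod_eq_zero (Finset.mem_univ i), zero_smul, mul_zero]
    exact_mod_cast Nat.descFactorial_eq_zero_iff_lt.2 hi
  · exact fun h => absurd hβ h

/-- The left submodule of the operators of order at most `m`, in terms of coordinates. -/
def ordLE (m : ℕ) : Submodule A (D A) := Submodule.span A (c.pd '' {β | ∑ i, β i ≤ m})

theorem pd_mem_ordLE {m : ℕ} {β : Fin N → ℕ} (h : ∑ i, β i ≤ m) : c.pd β ∈ c.ordLE m :=
  Submodule.subset_span ⟨β, h, rfl⟩

theorem ordLE_mono {m k : ℕ} (h : m ≤ k) : c.ordLE m ≤ c.ordLE k :=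
  Submodule.span_mono (Set.image_mono fun _ hβ => le_trans hβ h)

theorem sum_add_single (β : Fin N → ℕ) (i : Fin N) :
    ∑ j, (β + Pi.single i 1 : Fin N → ℕ) j = ∑ j, β j + 1 := by
  simp [Finset.sum_add_distrib]

theorem del_mul_mem_ordLE {m : ℕ} (i : Fin N) {P : D A} (hP : P ∈ c.ordLE m) :
    c.del i * P ∈ c.ordLE (m + 1) := by
  induction hP using Submodule.span_induction with
  | mem P hP =>
    obtain ⟨β, hβ, rfl⟩ := hP
    rw [← pd_add_single]
    refine c.pd_mem_ordLE ?_
    rw [sum_add_single]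
    exact Nat.add_le_add_right hβ 1
  | zero => rw [mul_zero]; exact zero_mem _
  | add P Q _ _ hP hQ => rw [mul_add]; exact add_mem hP hQ
  | smul a P hP' hP =>
    rw [del_mul_smul]
    exact add_mem (Submodule.smul_mem _ _ hP)
      (Submodule.smul_mem _ _ (c.ordLE_mono (Nat.le_succ m) hP'))

theorem ofDer_eq_sum (δ : Derivation ℂ A A) : ofDer δ = ∑ i, δ (c.z i) • c.del i := by
  refine toEnd_injective (LinearMap.ext fun g => ?_)
  rw [toEnd_ofDer_apply, map_sum, LinearMap.sum_apply]
  conv_lhs => rw [c.derivation_eq_sum δ]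
  rw [← Derivation.coeFnAddMonoidHom_apply, map_sum, Finset.sum_apply]
  rfl

theorem ofDer_mul_mem_ordLE {m : ℕ} (δ : Derivation ℂ A A) {P : D A} (hP : P ∈ c.ordLE m) :
    ofDer δ * P ∈ c.ordLE (m + 1) := by
  rw [c.ofDer_eq_sum, Finset.sum_mul]
  refine sum_mem fun i _ => ?_
  rw [smul_mul]
  exact Submodule.smul_mem _ _ (c.del_mul_mem_ordLE i hP)

theorem exists_mem_ordLE (P : D A) : ∃ m, P ∈ c.ordLE m := by
  have hdir : Directed (· ≤ ·) c.ordLE := (show Monotone c.ordLE from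
    fun _ _ h => c.ordLE_mono h).directed_le
  have := D_induction (⨆ m, c.ordLE m)
    ((Submodule.mem_iSup_of_directed _ hdir).2 ⟨0, by
      rw [← c.pd_zero]; exact c.pd_mem_ordLE (by simp)⟩)
    (fun δ P hP => by
      obtain ⟨m, hm⟩ := (Submodule.mem_iSup_of_directed _ hdir).1 hP
      exact (Submodule.mem_iSup_of_directed _ hdir).2 ⟨m + 1, c.ofDer_mul_mem_ordLE δ hm⟩) P
  exact (Submodule.mem_iSup_of_directed _ hdir).1 this

/-- `D` is a free left `A`-module on the `d^β`. -/
noncomputable def pdBasis : Module.Basis (Fin N → ℕ) A (D A) :=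
  Module.Basis.mk c.linearIndependent_pd fun P _ => by
    obtain ⟨m, hm⟩ := c.exists_mem_ordLE P
    exact Submodule.span_mono (Set.image_subset_range _ _) hm

theorem pdBasis_apply (β : Fin N → ℕ) : c.pdBasis β = c.pd β := Module.Basis.mk_apply _ _ _

theorem ordLE_le_orderLE (m : ℕ) {P : D A} (hP : P ∈ c.ordLE m) : toEnd A P ∈ orderLE A m := by
  have hone : (1 : Submodule ℂ (Module.End ℂ A)) ≤ mulOps A ⊔ derOps A := by
    refine le_trans ?_ le_sup_left
    rw [Submodule.one_le]
    exact ⟨1, LinearMap.ext fun g => one_mul g⟩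
  have hmono : ∀ m k, (mulOps A ⊔ derOps A) ^ m ≤ (mulOps A ⊔ derOps A) ^ (k + m) := by
    intro m k
    induction k with
    | zero => rw [zero_add]
    | succ k ih =>
      refine ih.trans ?_
      rw [show k + 1 + m = k + m + 1 by ring, mulOps_sup_pow_succ]
      intro T hT
      simpa using Submodule.mul_mem_mul (Submodule.one_le.1 hone) hT
  have hpow : ∀ β : Fin N → ℕ, toEnd A (c.pd β) ∈ (mulOps A ⊔ derOps A) ^ (∑ i, β i) := by
    intro β
    induction β using multiindex_induction with
    | h0 =>
      have h1 : (1 : Module.End ℂ A) ∈ (mulOps A ⊔ derOps A) ^ 0 := Submodule.one_le.1 le_rfl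
      simpa [pd_zero] using h1
    | h1 β i ih =>
      rw [sum_add_single, pd_add_single, mulOps_sup_pow_succ, map_mul]
      exact Submodule.mul_mem_mul (Submodule.mem_sup_right (Submodule.subset_span ⟨c.d i, rfl⟩)) ih
  rw [orderLE, if_pos (Int.natCast_nonneg m), Int.toNat_natCast]
  induction hP using Submodule.span_induction with
  | mem P hP =>
    obtain ⟨β, hβ, rfl⟩ := hP
    have h1 : toEnd A (c.pd β) ∈ (mulOps A ⊔ derOps A) ^ m := by
      obtain ⟨k, hk⟩ := Nat.exists_eq_add_of_le' (show ∑ i, β i ≤ m from hβ)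
      rw [hk]
      exact hmono _ _ (hpow β)
    have h3 : (1 : Module.End ℂ A) ∈ mulOps A := ⟨1, LinearMap.ext fun g => one_mul g⟩
    simpa using Submodule.mul_mem_mul h3 h1
  | zero => rw [map_zero]; exact zero_mem _
  | add P Q _ _ hP hQ => rw [map_add]; exact add_mem hP hQ
  | smul a P _ hP =>
    have h4 : toEnd A (a • P) = LinearMap.mul ℂ A a * toEnd A P := rfl
    rw [h4]
    have h5 : mulOps A * (mulOps A * (mulOps A ⊔ derOps A) ^ m) ≤
        mulOps A * (mulOps A ⊔ derOps A) ^ m := by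
      rw [← mul_assoc]
      refine Submodule.mul_le.2 fun S hS T hT => Submodule.mul_mem_mul ?_ hT
      revert S
      change mulOps A * mulOps A ≤ mulOps A
      rw [Submodule.mul_le]
      rintro _ ⟨a, rfl⟩ _ ⟨b, rfl⟩
      exact ⟨a * b, LinearMap.ext fun g => mul_assoc a b g⟩
    exact h5 (Submodule.mul_mem_mul ⟨a, rfl⟩ hP)

/-- The order filtration, defined by products of functions and derivations, is given by the order in
the coordinates. -/
theorem mem_orderLE (m : ℕ) (P : D A) : toEnd A P ∈ orderLE A m ↔ P ∈ c.ordLE m := by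
  refine ⟨fun h => ?_, c.ordLE_le_orderLE m⟩
  set W : ℕ → Submodule ℂ (Module.End ℂ A) := fun m =>
    ((c.ordLE m).restrictScalars ℂ).map (toEnd A).toLinearMap with hW
  have hpow : ∀ m, (mulOps A ⊔ derOps A) ^ m ≤ W m := by
    intro m
    induction m with
    | zero =>
      refine Submodule.one_le.2 ?_
      refine ⟨1, ?_, map_one (toEnd A)⟩
      rw [← c.pd_zero]; exact c.pd_mem_ordLE (by simp)
    | succ m ih =>
      rw [mulOps_sup_pow_succ]
      refine le_trans (Submodule.mul_le.2 fun S hS T hT =>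
        Submodule.mul_mem_mul hS (ih hT)) ?_
      rw [Submodule.sup_mul, sup_le_iff, Submodule.mul_le, Submodule.mul_le]
      constructor
      · rintro _ ⟨a, rfl⟩ _ ⟨P, hP, rfl⟩
        exact ⟨a • P, Submodule.smul_mem _ a (c.ordLE_mono (Nat.le_succ m) hP), rfl⟩
      · rintro T hT _ ⟨P, hP, rfl⟩
        obtain ⟨δ, rfl⟩ := derOps_eq T hT
        exact ⟨ofDer δ * P, c.ofDer_mul_mem_ordLE δ hP, rfl⟩
  have : orderLE A m ≤ W m := by
    rw [orderLE, if_pos (Int.natCast_nonneg m), Int.toNat_natCast]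
    refine le_trans (Submodule.mul_le.2 fun S hS T hT =>
      Submodule.mul_mem_mul hS (hpow m hT)) ?_
    rw [Submodule.mul_le]
    rintro _ ⟨a, rfl⟩ _ ⟨P, hP, rfl⟩
    exact ⟨a • P, Submodule.smul_mem _ a hP, rfl⟩
  obtain ⟨Q, hQ, e⟩ := this h
  rwa [toEnd_injective e] at hQ

theorem orderLE_of_neg {m : ℤ} (hm : m < 0) (P : D A) : toEnd A P ∈ orderLE A m ↔ P = 0 := by
  rw [orderLE, if_neg (not_le.2 hm), Submodule.mem_bot]
  exact map_eq_zero_iff _ toEnd_injective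

end TaylorCoords

end LogDeRham

/-! ### Frames of logarithmic fields -/

namespace LogDeRham

/-- An alternating map of top degree is determined by its value on a basis. -/
theorem alternating_ext_basis {A L V : Type*} [CommRing A] [AddCommGroup L] [Module A L]
    [AddCommGroup V]
    [Module A V] {p : ℕ} (b : Module.Basis (Fin p) A L) {f g : L [⋀^Fin p]→ₗ[A] V}
    (h : f b = g b) : f = g := by
  refine Module.Basis.ext_alternating b fun v hv => ?_
  have hv' := Finite.injective_iff_bijective.1 hv
  have e : ∀ f : L [⋀^Fin p]→ₗ[A] V, f (fun i => b (v i)) =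
      Equiv.Perm.sign (Equiv.ofBijective v hv') • f b :=
    fun f => f.map_perm b (Equiv.ofBijective v hv')
  rw [e, e, h]

section OpLemmas

variable {A : Type*} [CommRing A] [Algebra ℂ A]

theorem ofDer_commute {δ ε : Derivation ℂ A A} (h : ⁅δ, ε⁆ = 0) :
    Commute (ofDer δ) (ofDer ε) := by
  refine toEnd_injective (LinearMap.ext fun g => ?_)
  rw [toEnd_mul_apply, toEnd_mul_apply]
  have := congrArg (fun δ : Derivation ℂ A A => δ g) h
  rw [Derivation.commutator_apply] at this
  exact sub_eq_zero.1 this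

/-- The form `w ⊗ P`. -/
def tensorForm {L : Submodule A (Derivation ℂ A A)} {p : ℕ} (w : L [⋀^Fin p]→ₗ[A] A) (P : D A) :
    Form L p :=
  (LinearMap.toSpanSingleton A (D A) P).compAlternatingMap w

theorem tensorForm_apply {L : Submodule A (Derivation ℂ A A)} {p : ℕ} (w : L [⋀^Fin p]→ₗ[A] A)
    (P : D A) (v : Fin p → L) : tensorForm w P v = w v • P := rfl

end OpLemmas

namespace TaylorCoords

section Frame

variable {A : Type*} [CommRing A] [Algebra ℂ A] {N : ℕ} (c : TaylorCoords A N) (E : Fin N → ℕ)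

/-- The Euler fields `z_i d_i`. -/
def euler (i : Fin N) : Derivation ℂ A A := c.z i • c.d i

theorem euler_apply (i : Fin N) (a : A) : c.euler i a = c.z i * c.d i a := rfl

theorem euler_zpow (i : Fin N) (u : Fin N → ℕ) :
    c.euler i (c.zpow u) = (u i : ℂ) • c.zpow u := by
  rw [euler_apply, d_zpow, mul_smul_comm]
  by_cases h : u i = 0
  · rw [h]; simp
  · rw [← c.zpow_single, ← c.zpow_add]
    congr 2
    ext j
    by_cases hj : j = i
    · subst hj; simp; omega
    · simp [hj]

/-- A frame of logarithmic fields for the divisor of `z^E`: the normalized Euler field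
`z_i d_i / E_i` if `E_i ≠ 0`, and `d_i` otherwise. -/
noncomputable def lam (i : Fin N) : Derivation ℂ A A :=
  if E i = 0 then c.d i else (E i : ℂ)⁻¹ • c.euler i

/-- The value of `lam i` on `z_i`. -/
noncomputable def lamZ (i : Fin N) : A := if E i = 0 then 1 else (E i : ℂ)⁻¹ • c.z i

theorem lam_z (i j : Fin N) : c.lam E i (c.z j) = if i = j then c.lamZ E j else 0 := by
  by_cases h : i = j
  · subst h
    rw [lam, lamZ, if_pos rfl]
    split_ifs with h0
    · rw [c.d_z_self]
    · rw [Derivation.smul_apply, euler_apply, c.d_z_self, mul_one]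
  · rw [lam, if_neg h]
    split_ifs with h0
    · rw [c.d_z_of_ne h]
    · rw [Derivation.smul_apply, euler_apply, c.d_z_of_ne h, mul_zero, smul_zero]

theorem lamZ_mul_eq_zero {i : Fin N} {a : A} (h : a * c.lamZ E i = 0) : a = 0 := by
  rw [lamZ] at h
  split_ifs at h with h0
  · rwa [mul_one] at h
  · rw [mul_smul_comm, smul_eq_zero] at h
    rcases h with h | h
    · simp [h0] at h
    · exact c.z_mul_eq_zero (by rwa [mul_comm])

theorem lam_zpow (i : Fin N) : c.lam E i (c.zpow E) = if E i = 0 then 0 else c.zpow E := by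
  rw [lam]
  split_ifs with h
  · rw [d_zpow, h]; simp
  · rw [Derivation.smul_apply, euler_zpow, smul_smul, inv_mul_cancel₀ (by exact_mod_cast h),
      one_smul]

theorem lam_lie (i j : Fin N) : ⁅c.lam E i, c.lam E j⁆ = 0 := by
  by_cases hij : i = j
  · rw [hij, lie_self]
  have h0 : ∀ i j : Fin N, i ≠ j → c.lam E i (c.lamZ E j) = 0 := by
    intro i j h
    rw [lamZ]
    split_ifs
    · exact Derivation.map_one_eq_zero _
    · rw [Derivation.map_smul, lam_z, if_neg h, smul_zero]
  refine c.derivation_eq_zero fun k => ?_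
  rw [Derivation.commutator_apply, lam_z, lam_z]
  split_ifs with h1 h2 h2
  · exact absurd (h2.trans h1.symm) hij
  · subst h1; rw [map_zero, h0 i _ h2, sub_zero]
  · subst h2; rw [map_zero, h0 j _ h1, sub_zero]
  · rw [map_zero, map_zero, sub_zero]

theorem sum_smul_apply {ι : Type*} [Fintype ι] (a : ι → A) (δ : ι → Derivation ℂ A A) (g : A) :
    (∑ i, a i • δ i : Derivation ℂ A A) g = ∑ i, a i * δ i g := by
  rw [← Derivation.coeFnAddMonoidHom_apply, map_sum, Finset.sum_apply]
  rfl

theorem lam_linearIndependent : LinearIndependent A (c.lam E) := by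
  rw [Fintype.linearIndependent_iff]
  intro a h i
  have := congrArg (fun δ : Derivation ℂ A A => δ (c.z i)) h
  simp only [sum_smul_apply, lam_z, mul_ite, mul_zero, Finset.sum_ite_eq', Finset.mem_univ,
    if_true, Derivation.zero_apply] at this
  exact c.lamZ_mul_eq_zero E this

/-- A function that does not depend on `z_i` and is divisible by `z_i` vanishes. -/
theorem eq_zero_of_d_of_dvd {i : Fin N} {a b : A} (h : c.d i a = 0) (hab : a = c.z i * b) :
    a = 0 := by
  refine c.coeff_inj _ fun v => ?_
  by_cases hv : v i = 0
  · rw [hab, c.coeff_z]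
    exact c.coeff_of_neg _ i _ (by simp [hv])
  · exact c.coeff_eq_zero_of_d h hv

/-- A logarithmic field maps `z_i` into the ideal `(z_i)` if `E_i ≠ 0`. -/
theorem z_dvd_of_mem_logT {δ : Derivation ℂ A A} (hδ : δ ∈ logT (c.zpow E)) {i : Fin N}
    (hi : E i ≠ 0) : c.z i ∣ δ (c.z i) := by
  obtain ⟨g, hg⟩ := hδ
  obtain ⟨r, b, e, hr⟩ := c.div i (δ (c.z i))
  set F : Fin N → ℕ := Function.update E i 0 with hF
  have hE : E = F + (E i - 1) • Pi.single i 1 + Pi.single i 1 := by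
    ext j
    by_cases hj : j = i
    · subst hj; simp [hF]; omega
    · simp [hF, hj]
  have hpow : ∀ k : ℕ, c.zpow (k • Pi.single i 1) = c.z i ^ k := by
    intro k
    induction k with
    | zero => rw [zero_smul, zpow_zero, pow_zero]
    | succ k ih => rw [succ_nsmul, zpow_add, ih, zpow_single, pow_succ]
  have ht : c.zpow E = c.z i ^ (E i - 1) * (c.z i * c.zpow F) := by
    conv_lhs => rw [hE]
    rw [zpow_add, zpow_add, hpow, zpow_single]; ring
  have ht2 : c.zpow E = c.zpow F * c.z i ^ (E i - 1 + 1) := by rw [ht]; ring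
  -- Write `z^E = z^F z_i^(E_i)` and cancel `z_i^(E_i - 1)` in the Leibniz rule.
  have h1 : δ (c.zpow E) = c.z i ^ (E i - 1) *
      ((E i : ℂ) • (c.zpow F * δ (c.z i)) + c.z i * δ (c.zpow F)) := by
    rw [ht2, Derivation.leibniz, Derivation.leibniz_pow, Nat.sub_add_cancel (by omega)]
    simp only [smul_eq_mul, nsmul_eq_mul]
    rw [Algebra.smul_def, map_natCast]
    have : c.z i ^ E i = c.z i ^ (E i - 1) * c.z i := by
      rw [← pow_succ, Nat.sub_add_cancel (by omega)]
    rw [this]; ring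
  have h2 : (E i : ℂ) • (c.zpow F * δ (c.z i)) + c.z i * δ (c.zpow F) =
      c.z i * c.zpow F * g := by
    rw [← sub_eq_zero]
    refine c.zpow_mul_eq_zero (u := (E i - 1) • Pi.single i 1) ?_
    rw [hpow, mul_sub, ← h1, hg, ht]; ring
  have hFi : c.d i (c.zpow F) = 0 := by rw [d_zpow]; simp [hF]
  -- The remainder `r` of `δ z_i` modulo `z_i` satisfies `z^F r ∈ (z_i)`, but neither factor
  -- depends on `z_i`.
  have h3 : c.zpow F * r = 0 := by
    refine c.eq_zero_of_d_of_dvd (i := i) (b := (E i : ℂ)⁻¹ • (c.zpow F * g - δ (c.zpow F)) -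
      c.zpow F * b) ?_ ?_
    · rw [Derivation.leibniz, hFi, hr, smul_zero, smul_zero, add_zero]
    · have h4 : c.zpow F * δ (c.z i) =
          (E i : ℂ)⁻¹ • (c.z i * c.zpow F * g - c.z i * δ (c.zpow F)) := by
        rw [← h2, add_sub_cancel_right, smul_smul, inv_mul_cancel₀ (by exact_mod_cast hi),
          one_smul]
      rw [e] at h4
      rw [mul_sub, mul_smul_comm, mul_sub, ← mul_assoc, ← h4]; ring
  rw [c.zpow_mul_eq_zero h3, zero_add] at e
  exact ⟨b, e⟩

theorem exists_eq_sum_lam {δ : Derivation ℂ A A} (hδ : δ ∈ logT (c.zpow E)) :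
    ∃ a : Fin N → A, δ = ∑ i, a i • c.lam E i := by
  have : ∀ i, ∃ a, δ (c.z i) = a * c.lamZ E i := by
    intro i
    rw [lamZ]
    split_ifs with h
    · exact ⟨_, (mul_one _).symm⟩
    · obtain ⟨b, hb⟩ := c.z_dvd_of_mem_logT E hδ h
      refine ⟨(E i : ℂ) • b, ?_⟩
      rw [smul_mul_smul_comm, mul_inv_cancel₀ (by exact_mod_cast h), one_smul, hb, mul_comm]
  choose a ha using this
  refine ⟨a, ?_⟩
  rw [← sub_eq_zero]
  refine c.derivation_eq_zero fun j => ?_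
  rw [Derivation.sub_apply, sum_smul_apply]
  simp [lam_z, ha]

end Frame

section Frames

variable {A : Type*} [CommRing A] [Algebra ℂ A] {n : ℕ} (c : TaylorCoords A (n + 1))
  (E : Fin (n + 1) → ℕ)

/-- The frame of the relative logarithmic fields, where `z_0` is a coordinate with `E_0 ≠ 0`: the
differences `lam k - lam 0` if `E_k ≠ 0`, and `d_k` otherwise. -/
noncomputable def xi (k : Fin n) : Derivation ℂ A A :=
  c.lam E k.succ - if E k.succ = 0 then 0 else c.lam E 0

theorem xi_mem_relT (hE : E 0 ≠ 0) (k : Fin n) : c.xi E k ∈ relT (c.zpow E) := by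
  change c.xi E k (c.zpow E) = 0
  rw [xi, Derivation.sub_apply, lam_zpow]
  split_ifs with h
  · simp
  · rw [lam_zpow, if_neg hE, sub_self]

theorem lam_zero_mem_logT (hE : E 0 ≠ 0) : c.lam E 0 ∈ logT (c.zpow E) := by
  change c.zpow E ∣ c.lam E 0 (c.zpow E)
  rw [lam_zpow, if_neg hE]

/-- The change of frame from `lam 0, xi k` to the `lam i`. -/
theorem cons_sum_eq (a : A) (b : Fin n → A) :
    a • c.lam E 0 + ∑ k, b k • c.xi E k =
      (a - ∑ k, if E k.succ = 0 then 0 else b k) • c.lam E 0 + ∑ k, b k • c.lam E k.succ := by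
  simp only [xi, smul_sub, Finset.sum_sub_distrib, sub_smul, Finset.sum_smul]
  have : ∑ k, b k • (if E (Fin.succ k) = 0 then 0 else c.lam E 0) =
      ∑ k, (if E (Fin.succ k) = 0 then 0 else b k) • c.lam E 0 :=
    Finset.sum_congr rfl fun k _ => by split_ifs <;> simp
  rw [this]
  abel

theorem cons_eq_zero {a : A} {b : Fin n → A}
    (h : a • c.lam E 0 + ∑ k, b k • c.xi E k = 0) : a = 0 ∧ b = 0 := by
  rw [cons_sum_eq] at h
  have := Fintype.linearIndependent_iff.1 (c.lam_linearIndependent E)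
    (Fin.cons (a - ∑ k, if E k.succ = 0 then 0 else b k) b) (by
      rw [Fin.sum_univ_succ]; simpa using h)
  have hb : b = 0 := funext fun k => by simpa using this k.succ
  refine ⟨?_, hb⟩
  have h0 := this 0
  simpa [hb] using h0

theorem exists_eq_cons {δ : Derivation ℂ A A} (hδ : δ ∈ logT (c.zpow E)) :
    ∃ a : A, ∃ b : Fin n → A, δ = a • c.lam E 0 + ∑ k, b k • c.xi E k := by
  obtain ⟨a, rfl⟩ := c.exists_eq_sum_lam E hδ
  refine ⟨a 0 + ∑ k : Fin n, if E k.succ = 0 then 0 else a k.succ, fun k => a k.succ, ?_⟩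
  rw [cons_sum_eq, add_sub_cancel_right, Fin.sum_univ_succ]

variable (hE : E 0 ≠ 0)

/-- The basis of the relative logarithmic fields. -/
noncomputable def relBasis : Module.Basis (Fin n) A (relT (c.zpow E)) :=
  Module.Basis.mk (v := fun k => ⟨c.xi E k, c.xi_mem_relT E hE k⟩)
    (by
      rw [Fintype.linearIndependent_iff]
      intro b hb k
      have := congrArg (Subtype.val) hb
      simp only [Submodule.coe_sum, Submodule.coe_smul, Submodule.coe_zero] at this
      exact congrFun (c.cons_eq_zero E (a := 0) (b := b) (by rw [zero_smul, zero_add, this])).2 k)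
    (by
      rintro ⟨δ, hδ⟩ -
      obtain ⟨a, b, e⟩ := c.exists_eq_cons E (relT_le_logT _ hδ)
      have h0 : δ (c.zpow E) = 0 := hδ
      have ha : a = 0 := by
        rw [e, Derivation.add_apply, sum_smul_apply, Derivation.smul_apply, lam_zpow, if_neg hE,
          Finset.sum_eq_zero, add_zero, smul_eq_mul, mul_comm] at h0
        · exact c.zpow_mul_eq_zero h0
        · intro k _
          rw [show c.xi E k (c.zpow E) = 0 from c.xi_mem_relT E hE k, mul_zero]
      rw [ha, zero_smul, zero_add] at e
      have : (⟨δ, hδ⟩ : relT (c.zpow E)) =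
          ∑ k, b k • (⟨c.xi E k, c.xi_mem_relT E hE k⟩ : relT (c.zpow E)) :=
        Subtype.ext (by simpa using e)
      rw [this]
      exact sum_mem fun k _ => Submodule.smul_mem _ _ (Submodule.subset_span ⟨k, rfl⟩))

theorem relBasis_apply (k : Fin n) : (c.relBasis E hE k : Derivation ℂ A A) = c.xi E k := by
  rw [relBasis, Module.Basis.mk_apply]

/-- The basis `lam 0, xi 0, xi 1, …` of the logarithmic fields. -/
noncomputable def logBasis : Module.Basis (Fin (n + 1)) A (logT (c.zpow E)) :=
  Module.Basis.mk (v := Fin.cons ⟨c.lam E 0, c.lam_zero_mem_logT E hE⟩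
      fun k => ⟨c.xi E k, relT_le_logT _ (c.xi_mem_relT E hE k)⟩)
    (by
      rw [Fintype.linearIndependent_iff]
      intro b hb
      rw [Fin.sum_univ_succ] at hb
      have := congrArg (Subtype.val) hb
      simp only [Submodule.coe_add, Submodule.coe_sum, Submodule.coe_smul, Submodule.coe_zero,
        Fin.cons_zero, Fin.cons_succ] at this
      obtain ⟨h1, h2⟩ := c.cons_eq_zero E this
      exact Fin.cases h1 (fun k => congrFun h2 k))
    (by
      rintro ⟨δ, hδ⟩ -
      obtain ⟨a, b, e⟩ := c.exists_eq_cons E hδ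
      set v : Fin (n + 1) → logT (c.zpow E) := Fin.cons ⟨c.lam E 0, c.lam_zero_mem_logT E hE⟩
        fun k => ⟨c.xi E k, relT_le_logT _ (c.xi_mem_relT E hE k)⟩ with hv
      have : (⟨δ, hδ⟩ : logT (c.zpow E)) = a • v 0 + ∑ k, b k • v (Fin.succ k) :=
        Subtype.ext (by simpa [hv] using e)
      rw [this]
      exact add_mem (Submodule.smul_mem _ _ (Submodule.subset_span ⟨0, rfl⟩))
        (sum_mem fun k _ => Submodule.smul_mem _ _ (Submodule.subset_span ⟨k.succ, rfl⟩)))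

theorem logBasis_zero : (c.logBasis E hE 0 : Derivation ℂ A A) = c.lam E 0 := by
  rw [logBasis, Module.Basis.mk_apply]; rfl

theorem logBasis_succ (k : Fin n) :
    (c.logBasis E hE k.succ : Derivation ℂ A A) = c.xi E k := by
  rw [logBasis, Module.Basis.mk_apply]; rfl

theorem xi_lie_xi (k l : Fin n) : ⁅c.xi E k, c.xi E l⁆ = 0 := by
  rw [xi, xi]
  split_ifs <;> simp [lam_lie]

theorem lam_lie_xi (i : Fin (n + 1)) (l : Fin n) : ⁅c.lam E i, c.xi E l⁆ = 0 := by
  rw [xi]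
  split_ifs <;> simp [lam_lie]

end Frames

end TaylorCoords

end LogDeRham

/-! ### The local description of the module and of the residue -/

namespace LogDeRham

section Forms

variable {A : Type*} [CommRing A] [Algebra ℂ A]

/-- On commuting fields the differential has only the terms with a derivative. -/
theorem deRhamD_of_lie_eq_zero {L : Submodule A (Derivation ℂ A A)}
    (hL : ∀ {δ η : Derivation ℂ A A}, δ ∈ L → η ∈ L → ⁅δ, η⁆ ∈ L) {p : ℕ} (η : Form L p)
    (ξ : Fin (p + 1) → L)
    (h : ∀ i j, ⁅(ξ i : Derivation ℂ A A), (ξ j : Derivation ℂ A A)⁆ = 0) :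
    deRhamD L hL η ξ = ∑ i : Fin (p + 1), (-1 : A) ^ (i : ℕ) •
      (ofDer (ξ i : Derivation ℂ A A) * η (i.removeNth ξ)) := by
  rw [deRhamD_eq]
  refine Finset.sum_congr rfl fun i _ => ?_
  rw [Finset.sum_eq_zero, sub_zero]
  intro j hj
  obtain ⟨k', -, hk⟩ := removeNth_update_of_ne (L := L) (Finset.mem_Ioi.1 hj).ne
  have h0 : bracket hL (ξ i) (ξ j) = 0 := Subtype.ext (h i j)
  rw [h0, hk, η.map_update_zero]

theorem neg_one_pow_smul_mul (k : ℕ) (P Q : D A) :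
    (-1 : A) ^ k • (P * Q) = P * ((-1 : A) ^ k • Q) := by
  rw [← neg_one_pow_mul, ← neg_one_pow_mul]
  exact ((Commute.neg_one_left P).pow_left k).left_comm Q

/-- The differential of a form `(ι_{b_k} det) ⊗ P`, where `b` is a commuting basis. -/
theorem deRhamD_curryLeft_det {L : Submodule A (Derivation ℂ A A)}
    (hL : ∀ {δ η : Derivation ℂ A A}, δ ∈ L → η ∈ L → ⁅δ, η⁆ ∈ L) {p : ℕ}
    (b : Module.Basis (Fin (p + 1)) A L)
    (h : ∀ i j, ⁅(b i : Derivation ℂ A A), (b j : Derivation ℂ A A)⁆ = 0)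
    (k : Fin (p + 1)) (P : D A) :
    deRhamD L hL (tensorForm (b.det.curryLeft (b k)) P) b = ofDer (b k : Derivation ℂ A A) * P := by
  rw [deRhamD_of_lie_eq_zero hL _ _ h, Finset.sum_eq_single k]
  · rw [tensorForm_apply, neg_one_pow_smul_mul, smul_smul, AlternatingMap.curryLeft_apply_apply]
    have := b.det.map_insertNth k (b k) (k.removeNth b)
    rw [Fin.insertNth_self_removeNth, b.det_self] at this
    have e : (-1 : A) ^ (k : ℕ) * b.det (Matrix.vecCons (b k) (k.removeNth b)) = 1 := by
      simpa using this.symm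
    rw [e, one_smul]
  · intro i _ hik
    rw [tensorForm_apply, AlternatingMap.curryLeft_apply_apply]
    have : b.det (Matrix.vecCons (b k) (i.removeNth b)) = 0 := by
      obtain ⟨k', hk'⟩ := Fin.exists_succAbove_eq (Ne.symm hik)
      refine b.det.map_eq_zero_of_eq _ (i := 0) (j := k'.succ) ?_ (Fin.succ_ne_zero _).symm
      simp [Fin.removeNth, hk']
    rw [this, zero_smul, mul_zero, smul_zero]
  · simp

end Forms

namespace TaylorCoords

variable {A : Type*} [CommRing A] [Algebra ℂ A] {n : ℕ} (c : TaylorCoords A (n + 1))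
  (E : Fin (n + 1) → ℕ)

/-- The right ideal of `D` generated by the function `z^E` and the relative logarithmic fields. -/
def relIdeal : Submodule (D A)ᵐᵒᵖ (D A) :=
  Submodule.span _ ({ofFun (c.zpow E)} ∪ Set.range fun k => ofDer (c.xi E k))

theorem xi_mul_mem_relIdeal (k : Fin n) (P : D A) : ofDer (c.xi E k) * P ∈ c.relIdeal E :=
  Submodule.smul_mem _ (MulOpposite.op P) (Submodule.subset_span (Or.inr ⟨k, rfl⟩))

theorem zpow_smul_mem_relIdeal (P : D A) : c.zpow E • P ∈ c.relIdeal E :=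
  Submodule.smul_mem _ (MulOpposite.op P) (Submodule.subset_span (Or.inl rfl))

variable (hE : E 0 ≠ 0)

theorem relBasis_lie (i j : Fin n) : ⁅(c.relBasis E hE i : Derivation ℂ A A),
    (c.relBasis E hE j : Derivation ℂ A A)⁆ = 0 := by
  rw [relBasis_apply, relBasis_apply, xi_lie_xi]

theorem logBasis_lie (i j : Fin (n + 1)) : ⁅(c.logBasis E hE i : Derivation ℂ A A),
    (c.logBasis E hE j : Derivation ℂ A A)⁆ = 0 := by
  induction i using Fin.cases <;> induction j using Fin.cases <;>
    simp only [logBasis_zero, logBasis_succ, lam_lie, lam_lie_xi, xi_lie_xi]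
  rw [← lie_skew, lam_lie_xi, neg_zero]

/-- Evaluation of the top forms on the frame, an isomorphism of `Ω^n_{rel} ⊗ D` with `D`. -/
noncomputable def formEquiv : Form (relT (c.zpow E)) n ≃ₗ[(D A)ᵐᵒᵖ] D A where
  toFun α := α (c.relBasis E hE)
  invFun P := tensorForm (c.relBasis E hE).det P
  map_add' _ _ := rfl
  map_smul' _ _ := rfl
  left_inv α := alternating_ext_basis (c.relBasis E hE) (by
    rw [tensorForm_apply, Module.Basis.det_self, one_smul])
  right_inv P := by
    change tensorForm _ P _ = P
    rw [tensorForm_apply, Module.Basis.det_self, one_smul]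

/-- The relations that define `M` correspond to the right ideal `relIdeal`. -/
theorem map_relations : (relations (c.zpow E) n).map (c.formEquiv E hE).toLinearMap =
    c.relIdeal E := by
  refine le_antisymm ?_ ?_
  · rw [relations, Submodule.map_span_le]
    rintro α (hα | ⟨γ, rfl⟩)
    · rcases n with _ | m
      · exact absurd hα (Set.notMem_empty α)
      · obtain ⟨η, hη⟩ := hα
        change α (c.relBasis E hE) ∈ _
        rw [hη, deRhamD_of_lie_eq_zero _ _ _ (c.relBasis_lie E hE)]
        refine sum_mem fun i _ => ?_
        rw [neg_one_pow_smul_mul, relBasis_apply]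
        exact c.xi_mul_mem_relIdeal E i _
    · exact c.zpow_smul_mem_relIdeal E (γ (c.relBasis E hE))
  · rw [relIdeal, Submodule.span_le]
    rintro P (rfl | ⟨k, rfl⟩)
    · refine ⟨c.zpow E • (c.formEquiv E hE).symm 1, Submodule.subset_span (Or.inr ⟨_, rfl⟩), ?_⟩
      change c.zpow E • c.formEquiv E hE ((c.formEquiv E hE).symm 1) = _
      rw [LinearEquiv.apply_symm_apply]
      exact mul_one _
    · rcases n with _ | m
      · exact k.elim0
      · set η : Form (relT (c.zpow E)) m :=
          tensorForm ((c.relBasis E hE).det.curryLeft (c.relBasis E hE k)) 1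
        refine ⟨deRham (lie_mem_relT _) η, Submodule.subset_span (Or.inl ⟨η, fun ξ => rfl⟩), ?_⟩
        change deRhamD _ (lie_mem_relT _) η (c.relBasis E hE) = _
        rw [deRhamD_curryLeft_det _ _ (c.relBasis_lie E hE), mul_one, relBasis_apply]

/-- The class in `M` of the form with value `P` on the frame. -/
noncomputable def pr : D A →ₗ[(D A)ᵐᵒᵖ] M (c.zpow E) n :=
  (relations (c.zpow E) n).mkQ ∘ₗ (c.formEquiv E hE).symm.toLinearMap

theorem mkQ_eq_pr (α : Form (relT (c.zpow E)) n) :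
    (relations (c.zpow E) n).mkQ α = c.pr E hE (α (c.relBasis E hE)) := by
  change _ = (relations (c.zpow E) n).mkQ ((c.formEquiv E hE).symm (c.formEquiv E hE α))
  rw [LinearEquiv.symm_apply_apply]

theorem pr_surjective : Function.Surjective (c.pr E hE) :=
  (Submodule.mkQ_surjective _).comp (c.formEquiv E hE).symm.surjective

theorem pr_eq_zero_iff {P : D A} : c.pr E hE P = 0 ↔ P ∈ c.relIdeal E := by
  rw [← c.map_relations E hE, Submodule.mem_map_equiv]
  exact Submodule.Quotient.mk_eq_zero _

/-- The filtration of `M` is the image of the order filtration, shifted by `n`. -/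
theorem mem_filM_iff (ℓ : ℤ) (x : M (c.zpow E) n) :
    x ∈ filM (c.zpow E) n ℓ ↔ ∃ P, toEnd A P ∈ orderLE A (ℓ + n) ∧ c.pr E hE P = x := by
  constructor
  · rintro ⟨α, hα, rfl⟩
    exact ⟨_, hα (c.relBasis E hE), (c.mkQ_eq_pr E hE α).symm⟩
  · rintro ⟨P, hP, rfl⟩
    refine ⟨(c.formEquiv E hE).symm P, fun ξ => ?_, rfl⟩
    change toEnd A ((c.relBasis E hE).det ξ • P) ∈ _
    rcases lt_or_ge (ℓ + n) 0 with h | h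
    · rw [orderLE_of_neg h] at hP ⊢
      rw [hP, smul_zero]
    · obtain ⟨m, hm⟩ := Int.eq_ofNat_of_zero_le h
      rw [hm, c.mem_orderLE] at hP ⊢
      exact Submodule.smul_mem _ _ hP

/-- Left multiplication by an operator, an endomorphism of the right module `D`. -/
def lmul (T : D A) : Module.End (D A)ᵐᵒᵖ (D A) where
  toFun P := T * P
  map_add' := mul_add T
  map_smul' Q P := (mul_assoc T P Q.unop).symm

/-- The left multiplication by `lam 0` preserves the relations: `lam 0` commutes with the `xi k`,
and its commutator with `z^E` is a multiple of `z^E`. -/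
theorem lam_zero_mul_mem {P : D A} (hP : P ∈ c.relIdeal E) :
    ofDer (c.lam E 0) * P ∈ c.relIdeal E := by
  have : (c.relIdeal E).map (lmul (ofDer (c.lam E 0))) ≤ c.relIdeal E := by
    conv_lhs => rw [relIdeal]
    rw [Submodule.map_span_le]
    rintro P (rfl | ⟨k, rfl⟩)
    · change ofDer (c.lam E 0) * ofFun (c.zpow E) ∈ _
      have h := ofDer_mul_smul (c.lam E 0) (c.zpow E) 1
      rw [smul_def, mul_one] at h
      rw [h]
      refine add_mem (c.zpow_smul_mem_relIdeal E _) ?_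
      rw [lam_zpow]
      split_ifs
      · rw [zero_smul]; exact zero_mem _
      · exact c.zpow_smul_mem_relIdeal E _
    · change ofDer (c.lam E 0) * ofDer (c.xi E k) ∈ _
      rw [(ofDer_commute (c.lam_lie_xi E 0 k)).eq]
      exact c.xi_mul_mem_relIdeal E k _
  exact this ⟨P, hP, rfl⟩

/-- The endomorphism of `M` induced by the left multiplication by the logarithmic field `lam 0`,
whose `dt/t` is one. -/
noncomputable def residue : Module.End (D A)ᵐᵒᵖ (M (c.zpow E) n) :=
  (relations (c.zpow E) n).liftQ
    (c.pr E hE ∘ₗ lmul (ofDer (c.lam E 0)) ∘ₗ (c.formEquiv E hE).toLinearMap) (by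
    intro α hα
    rw [LinearMap.mem_ker]
    change c.pr E hE (ofDer (c.lam E 0) * c.formEquiv E hE α) = 0
    rw [pr_eq_zero_iff]
    refine c.lam_zero_mul_mem E ?_
    rw [← c.map_relations E hE]
    exact ⟨α, hα, rfl⟩)

theorem residue_pr (P : D A) :
    c.residue E hE (c.pr E hE P) = c.pr E hE (ofDer (c.lam E 0) * P) := by
  change c.pr E hE (ofDer (c.lam E 0) * c.formEquiv E hE ((c.formEquiv E hE).symm P)) = _
  rw [LinearEquiv.apply_symm_apply]

theorem toRel_relBasis (α : Form (logT (c.zpow E)) n) :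
    toRel (c.zpow E) α (c.relBasis E hE) = α ((0 : Fin (n + 1)).removeNth (c.logBasis E hE)) := by
  refine congrArg α (funext fun k => Subtype.ext ?_)
  change (c.relBasis E hE k : Derivation ℂ A A) = c.logBasis E hE (Fin.succAbove 0 k)
  rw [Fin.zero_succAbove, logBasis_succ, relBasis_apply]

/-- The logarithmic form `dt/t` as a linear map. -/
noncomputable def dlogLin : logT (c.zpow E) →ₗ[A] A where
  toFun := dlog (c.zpow E)
  map_add' x y := by
    refine sub_eq_zero.1 (c.zpow_mul_eq_zero (u := E) ?_)
    rw [mul_sub, mul_add, ← dlog_spec, ← dlog_spec, ← dlog_spec]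
    simp
  map_smul' a x := by
    refine sub_eq_zero.1 (c.zpow_mul_eq_zero (u := E) ?_)
    rw [mul_sub, ← dlog_spec, RingHom.id_apply, smul_eq_mul, mul_left_comm, ← dlog_spec]
    simp

/-- The form `dt/t ∧ β`. -/
noncomputable def wedge (β : Form (logT (c.zpow E)) n) : Form (logT (c.zpow E)) (n + 1) :=
  AlternatingMap.alternatizeUncurryFin ((c.dlogLin E).smulRight β)

theorem wedge_apply (β : Form (logT (c.zpow E)) n) (ξ : Fin (n + 1) → logT (c.zpow E)) :
    c.wedge E β ξ = dlogWedge (c.zpow E) β ξ := by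
  rw [wedge, AlternatingMap.alternatizeUncurryFin_apply, dlogWedge]
  refine Finset.sum_congr rfl fun i _ => ?_
  rw [neg_one_pow_mul]
  rcases Nat.even_or_odd (i : ℕ) with h | h <;>
    simp only [h.neg_one_pow, one_smul, neg_smul] <;> rfl

theorem dlog_logBasis_zero : dlog (c.zpow E) (c.logBasis E hE 0) = 1 := by
  refine sub_eq_zero.1 (c.zpow_mul_eq_zero (u := E) ?_)
  rw [mul_sub, ← dlog_spec, logBasis_zero, lam_zpow, if_neg hE, mul_one, sub_self]

theorem dlog_logBasis_succ (k : Fin n) : dlog (c.zpow E) (c.logBasis E hE k.succ) = 0 := by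
  refine c.zpow_mul_eq_zero (u := E) ?_
  rw [← dlog_spec, logBasis_succ]
  exact c.xi_mem_relT E hE k

/-- Since `dt/t` is one on `lam 0` and zero on the `xi k`, the value of `dt/t ∧ β` on the frame is
the value of the relative form of `β`. -/
theorem dlogWedge_logBasis (β : Form (logT (c.zpow E)) n) :
    dlogWedge (c.zpow E) β (c.logBasis E hE) = toRel (c.zpow E) β (c.relBasis E hE) := by
  rw [dlogWedge, Fin.sum_univ_succ, Finset.sum_eq_zero, add_zero, dlog_logBasis_zero, one_smul,
    toRel_relBasis]
  · exact (congrArg (· * _) (pow_zero _)).trans (one_mul _)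
  · intro k _
    rw [dlog_logBasis_succ, zero_smul, mul_zero]

/-- Modulo the relations the value of `dα` on the frame is `lam 0` times the value of `α`. -/
theorem deRhamD_logBasis (α : Form (logT (c.zpow E)) n) :
    deRhamD (logT (c.zpow E)) (lie_mem_logT _) α (c.logBasis E hE) -
      ofDer (c.lam E 0) * toRel (c.zpow E) α (c.relBasis E hE) ∈ c.relIdeal E := by
  rw [deRhamD_of_lie_eq_zero _ _ _ (c.logBasis_lie E hE), Fin.sum_univ_succ, toRel_relBasis,
    logBasis_zero, Fin.val_zero, pow_zero, one_smul, add_sub_cancel_left]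
  refine sum_mem fun k _ => ?_
  rw [neg_one_pow_smul_mul, logBasis_succ]
  exact c.xi_mul_mem_relIdeal E k _

theorem isResidue_residue : IsResidue (c.zpow E) n (c.residue E hE) := by
  intro α β h
  rw [c.mkQ_eq_pr E hE, c.mkQ_eq_pr E hE, residue_pr, eq_comm, ← sub_eq_zero, ← map_sub,
    pr_eq_zero_iff, ← dlogWedge_logBasis, ← h]
  exact c.deRhamD_logBasis E hE α

/-- The residue is unique: every `P` is the value of a form `α` with `dα = dt/t ∧ β`, where `β` has
the value `lam 0 * P`. -/
theorem eq_residue {R : Module.End (D A)ᵐᵒᵖ (M (c.zpow E) n)} (hR : IsResidue (c.zpow E) n R) :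
    R = c.residue E hE := by
  refine LinearMap.ext fun x => ?_
  obtain ⟨P, rfl⟩ := c.pr_surjective E hE x
  rw [residue_pr]
  set w := (c.logBasis E hE).det.curryLeft (c.logBasis E hE 0) with hw
  have hval : ∀ Q : D A, toRel (c.zpow E) (tensorForm w Q) (c.relBasis E hE) = Q := by
    intro Q
    rw [toRel_relBasis, tensorForm_apply, hw, AlternatingMap.curryLeft_apply_apply]
    have : Matrix.vecCons (c.logBasis E hE 0) ((0 : Fin (n + 1)).removeNth (c.logBasis E hE)) =
        c.logBasis E hE := by
      funext k
      induction k using Fin.cases <;> rfl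
    rw [this, Module.Basis.det_self, one_smul]
  have key : deRham (lie_mem_logT _) (tensorForm w P) =
      c.wedge E (tensorForm w (ofDer (c.lam E 0) * P)) := by
    refine alternating_ext_basis (c.logBasis E hE) ?_
    rw [deRham_apply, wedge_apply, dlogWedge_logBasis _ _ hE, hval, hw,
      deRhamD_curryLeft_det _ _ (c.logBasis_lie E hE), logBasis_zero]
  have := hR (tensorForm w P) (tensorForm w (ofDer (c.lam E 0) * P)) (fun ξ => by
    rw [← deRham_apply, key, wedge_apply])
  rwa [c.mkQ_eq_pr E hE, c.mkQ_eq_pr E hE, hval, hval] at this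

end TaylorCoords

end LogDeRham

/-! ### Polynomial-valued functionals on differential operators -/

namespace LogDeRham

namespace TaylorCoords

section Functional

open Polynomial

variable {A : Type*} [CommRing A] [Algebra ℂ A] {N : ℕ} (c : TaylorCoords A N) (E : Fin N → ℕ)

/-- The polynomial by which the Euler field `z_i d_i` acts under `functional`: `E_i s`, or `-1` in
the directions in which `d_i` itself acts by zero. -/
noncomputable def weightPoly (i : Fin N) : ℂ[X] := if E i = 0 then -1 else C (E i : ℂ) * X

/-- The product of the falling factorials `(μ_i - w_i) (μ_i - w_i - 1) ⋯` with `β_i` factors, where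
`μ_i` is `weightPoly`. -/
noncomputable def fallingPoly (w : Fin N → ℤ) (β : Fin N → ℕ) : ℂ[X] :=
  ∏ i, ∏ m ∈ Finset.range (β i), (weightPoly E i - C ((w i : ℂ) + m))

theorem fallingPoly_add_single (w : Fin N → ℤ) (β : Fin N → ℕ) (i : Fin N) :
    fallingPoly E w (β + Pi.single i 1) =
      fallingPoly E w β * (weightPoly E i - C ((w i : ℂ) + β i)) := by
  rw [fallingPoly, fallingPoly, ← Finset.mul_prod_erase _ _ (Finset.mem_univ i),
    ← Finset.mul_prod_erase _ _ (Finset.mem_univ i)]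
  have : ∏ j ∈ Finset.univ.erase i, ∏ m ∈ Finset.range ((β + Pi.single i 1 : Fin N → ℕ) j),
      (weightPoly E j - C ((w j : ℂ) + m)) = ∏ j ∈ Finset.univ.erase i,
      ∏ m ∈ Finset.range (β j), (weightPoly E j - C ((w j : ℂ) + m)) :=
    Finset.prod_congr rfl fun j hj => by simp [Finset.ne_of_mem_erase hj]
  rw [this]
  simp only [Pi.add_apply, Pi.single_eq_same, Finset.prod_range_succ]
  ring

/-- The functional `a d^β ↦ [a]_{w + β} ∏_i (μ_i - w_i) (μ_i - w_i - 1) ⋯ (μ_i - w_i - β_i + 1)`.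
Formally it is the coefficient of `∏ z_i^{w_i-μ_i-1}` when the adjoint operator is applied to
`∏ z_i^{-μ_i-1}`. -/
noncomputable def functional (w : Fin N → ℤ) : D A →ₗ[ℂ] ℂ[X] :=
  (Finsupp.lsum ℂ fun β : Fin N → ℕ =>
    (LinearMap.toSpanSingleton ℂ ℂ[X] (fallingPoly E w β)) ∘ₗ
      c.coeff (w + fun i => (β i : ℤ))) ∘ₗ c.pdBasis.repr.toLinearMap.restrictScalars ℂ

theorem functional_smul_pd (w : Fin N → ℤ) (a : A) (β : Fin N → ℕ) :
    c.functional E w (a • c.pd β) = c.coeff (w + fun i => (β i : ℤ)) a • fallingPoly E w β := by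
  have : c.pdBasis.repr (a • c.pd β) = Finsupp.single β a := by
    rw [← c.pdBasis_apply, map_smul, Module.Basis.repr_self, Finsupp.smul_single, smul_eq_mul,
      mul_one]
  simp [functional, this]

theorem linearMap_ext_pd {V : Type*} [AddCommGroup V] [Module ℂ V] {f g : D A →ₗ[ℂ] V}
    (h : ∀ (a : A) (β : Fin N → ℕ), f (a • c.pd β) = g (a • c.pd β)) : f = g := by
  refine LinearMap.ext fun P => ?_
  have hP : P ∈ Submodule.span A (Set.range c.pd) := by
    obtain ⟨m, hm⟩ := c.exists_mem_ordLE P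
    exact Submodule.span_mono (Set.image_subset_range _ _) hm
  have key : ∀ a : A, f (a • P) = g (a • P) := by
    induction hP using Submodule.span_induction with
    | mem P hP => obtain ⟨β, rfl⟩ := hP; exact fun a => h a β
    | zero => simp
    | add P Q _ _ hP hQ => intro a; rw [smul_add, map_add, map_add, hP, hQ]
    | smul b P _ hP => intro a; rw [smul_smul]; exact hP _
  simpa using key 1

/-- The functional turns the left multiplication by `z_i d_i` into the multiplication by
`weightPoly i`. -/
theorem functional_euler_mul (w : Fin N → ℤ) (i : Fin N) (P : D A) :
    c.functional E w (ofDer (c.euler i) * P) = weightPoly E i * c.functional E w P := by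
  have : (c.functional E w) ∘ₗ LinearMap.mulLeft ℂ (ofDer (c.euler i)) =
      LinearMap.mulLeft ℂ (weightPoly E i) ∘ₗ c.functional E w := by
    refine c.linearMap_ext_pd fun a β => ?_
    have e : ofDer (c.euler i) * (a • c.pd β) =
        (c.z i * a) • c.pd (β + Pi.single i 1) + (c.z i * c.d i a) • c.pd β := by
      rw [euler, ofDer_smul, smul_mul, ← del, del_mul_smul, pd_add_single, smul_add, smul_smul,
        smul_smul]
    simp only [LinearMap.comp_apply, LinearMap.mulLeft_apply]
    rw [e, map_add, functional_smul_pd, functional_smul_pd, functional_smul_pd, c.coeff_z,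
      c.coeff_z, c.coeff_d, sub_add_cancel, fallingPoly_add_single]
    have e2 : (w + fun j => (((β + Pi.single i 1 : Fin N → ℕ) j : ℕ) : ℤ)) - Pi.single i 1 =
        w + fun j => (β j : ℤ) := by
      ext j
      by_cases hj : j = i
      · subst hj; simp; ring
      · simp [hj]
    rw [e2]
    simp only [Pi.add_apply, Pi.sub_apply, Pi.single_eq_same, smul_eq_C_mul, map_mul, map_add]
    push_cast
    simp only [map_add, map_sub, map_intCast, map_natCast, map_one]
    ring
  exact congrArg (fun f : D A →ₗ[ℂ] ℂ[X] => f P) this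

/-- Where `E_i = 0` the choice `μ_i = -1` makes the functional vanish on `d_i D`. -/
theorem functional_del_mul {i : Fin N} (hi : E i = 0) (w : Fin N → ℤ) (P : D A) :
    c.functional E w (c.del i * P) = 0 := by
  have : (c.functional E w) ∘ₗ LinearMap.mulLeft ℂ (c.del i) = 0 := by
    refine c.linearMap_ext_pd fun a β => ?_
    simp only [LinearMap.comp_apply, LinearMap.mulLeft_apply, LinearMap.zero_apply]
    rw [del_mul_smul, ← pd_add_single, map_add, functional_smul_pd, functional_smul_pd, c.coeff_d,
      fallingPoly_add_single]
    have e2 : (w + fun j => (((β + Pi.single i 1 : Fin N → ℕ) j : ℕ) : ℤ)) =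
        w + (fun j => (β j : ℤ)) + Pi.single i 1 := by
      ext j
      by_cases hj : j = i
      · subst hj; simp; ring
      · simp [hj]
    rw [e2, weightPoly, if_pos hi]
    simp only [Pi.add_apply, smul_eq_C_mul, map_mul, map_add]
    push_cast
    simp only [map_add, map_intCast, map_natCast, map_one]
    ring
  exact congrArg (fun f : D A →ₗ[ℂ] ℂ[X] => f P) this

/-- The multiset of the numbers `m / E_i` with `u_i ≤ m < E_i`. -/
noncomputable def rootSet (u : Fin N → ℕ) : Multiset ℝ :=
  ∑ i, (Finset.Ico (u i) (E i)).val.map fun m : ℕ => (m : ℝ) / E i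

/-- The monic polynomial with roots `rootSet`. -/
noncomputable def rootPoly (u : Fin N → ℕ) : ℂ[X] :=
  ((rootSet E u).map fun r : ℝ => X - C (r : ℂ)).prod

theorem rootPoly_eq (u : Fin N → ℕ) :
    rootPoly E u = ∏ i, ∏ m ∈ Finset.Ico (u i) (E i), (X - C ((m : ℂ) / E i)) := by
  rw [rootPoly, rootSet, ← Multiset.coe_mapAddMonoidHom, map_sum, Multiset.prod_sum]
  refine Finset.prod_congr rfl fun i _ => ?_
  simp [-Finset.prod_map_val, Finset.prod.eq_1]

/-- If `w + β ≥ E` then the integers `m` with `w_i⁺ ≤ m < E_i` are among `w_i, …, w_i + β_i - 1`,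
and the root `m / E_i` of `rootPoly` is the zero of the factor `E_i s - m`. -/
theorem rootPoly_dvd_fallingPoly {w : Fin N → ℤ} {β : Fin N → ℕ}
    (h : ∀ i, (E i : ℤ) ≤ w i + β i) :
    rootPoly E (fun i => (w i).toNat) ∣ fallingPoly E w β := by
  rw [rootPoly_eq, fallingPoly]
  refine Finset.prod_dvd_prod_of_dvd _ _ fun i _ => ?_
  rcases Nat.eq_zero_or_pos (E i) with h0 | h0
  · simp [h0]
  have h0' : (E i : ℂ) ≠ 0 := by exact_mod_cast h0.ne'
  set g : ℕ → ℕ := fun m => ((m : ℤ) - w i).toNat with hg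
  have hinj : Set.InjOn g (Finset.Ico (w i).toNat (E i)) := by
    intro m hm m' hm' e
    simp only [Finset.coe_Ico, Set.mem_Ico] at hm hm'
    simp only [hg] at e
    omega
  have hsub : (Finset.Ico (w i).toNat (E i)).image g ⊆ Finset.range (β i) := by
    intro k hk
    obtain ⟨m, hm, rfl⟩ := Finset.mem_image.1 hk
    have := h i
    simp only [Finset.mem_Ico] at hm
    simp only [Finset.mem_range, hg]
    omega
  refine dvd_trans ?_ (Finset.prod_dvd_prod_of_subset _ _ _ hsub)
  rw [Finset.prod_image hinj]
  refine Finset.prod_dvd_prod_of_dvd _ _ fun m hm => ⟨C (E i : ℂ), ?_⟩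
  have e : (w i : ℂ) + ((g m : ℕ) : ℂ) = m := by
    simp only [Finset.mem_Ico] at hm
    have : w i + ((g m : ℕ) : ℤ) = m := by simp only [hg]; omega
    exact_mod_cast this
  rw [e, weightPoly, if_neg h0.ne', sub_mul, ← C_mul, div_mul_cancel₀ _ h0', mul_comm]

/-- A coefficient of `z^E a` at `w + β` is nonzero only if `w + β ≥ E`. -/
theorem rootPoly_dvd_functional_zpow (w : Fin N → ℤ) (P : D A) :
    rootPoly E (fun i => (w i).toNat) ∣ c.functional E w (c.zpow E • P) := by
  have hP : P ∈ Submodule.span A (Set.range c.pd) := by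
    obtain ⟨m, hm⟩ := c.exists_mem_ordLE P
    exact Submodule.span_mono (Set.image_subset_range _ _) hm
  suffices key : ∀ a : A, rootPoly E (fun i => (w i).toNat) ∣
      c.functional E w (c.zpow E • a • P) by simpa using key 1
  induction hP using Submodule.span_induction with
  | mem P hP =>
    obtain ⟨β, rfl⟩ := hP
    intro a
    rw [smul_smul, functional_smul_pd, c.coeff_zpow_mul]
    by_cases h : ∀ i, (E i : ℤ) ≤ w i + β i
    · rw [smul_eq_C_mul]
      exact (rootPoly_dvd_fallingPoly E h).mul_left _
    · push Not at h
      obtain ⟨i, hi⟩ := h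
      rw [c.coeff_of_neg _ i _ (by simpa using hi), zero_smul]
      exact dvd_zero _
  | zero => simp
  | add P Q _ _ hP hQ => intro a; rw [smul_add, smul_add, map_add]; exact dvd_add (hP a) (hQ a)
  | smul b P _ hP => intro a; rw [smul_smul a]; exact hP _

end Functional

section Relations

open Polynomial

variable {A : Type*} [CommRing A] [Algebra ℂ A] {n : ℕ} (c : TaylorCoords A (n + 1))
  (E : Fin (n + 1) → ℕ)

theorem functional_lam_mul {i : Fin (n + 1)} (hi : E i ≠ 0) (w : Fin (n + 1) → ℤ) (P : D A) :
    c.functional E w (ofDer (c.lam E i) * P) = X * c.functional E w P := by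
  have e : ofDer ((E i : ℂ)⁻¹ • c.euler i) = (E i : ℂ)⁻¹ • ofDer (c.euler i) := rfl
  have h : (E i : ℂ) ≠ 0 := by exact_mod_cast hi
  rw [lam, if_neg hi, e, smul_mul_assoc, map_smul, functional_euler_mul, weightPoly, if_neg hi,
    smul_eq_C_mul, ← mul_assoc, ← mul_assoc, ← C_mul, inv_mul_cancel₀ h, C_1, one_mul]

theorem functional_xi_mul (hE : E 0 ≠ 0) (k : Fin n) (w : Fin (n + 1) → ℤ) (P : D A) :
    c.functional E w (ofDer (c.xi E k) * P) = 0 := by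
  rw [xi]
  split_ifs with h
  · rw [sub_zero, lam, if_pos h]
    exact c.functional_del_mul E h w P
  · have e : ofDer (c.lam E k.succ - c.lam E 0) = ofDer (c.lam E k.succ) - ofDer (c.lam E 0) := rfl
    rw [e, sub_mul, map_sub, functional_lam_mul _ _ h, functional_lam_mul _ _ hE, sub_self]

/-- The functional with index `w` induces a map from `M` to the quotient of `ℂ[s]` by
`rootPoly w⁺`. -/
theorem rootPoly_dvd_functional (hE : E 0 ≠ 0) (w : Fin (n + 1) → ℤ) {P : D A}
    (hP : P ∈ c.relIdeal E) : rootPoly E (fun i => (w i).toNat) ∣ c.functional E w P := by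
  suffices key : ∀ Q : D A, rootPoly E (fun i => (w i).toNat) ∣ c.functional E w (P * Q) by
    simpa using key 1
  induction hP using Submodule.span_induction with
  | zero => simp
  | add P P' _ _ hP hP' => intro Q; rw [add_mul, map_add]; exact dvd_add (hP Q) (hP' Q)
  | mem P hP =>
    intro Q
    rcases hP with rfl | ⟨k, rfl⟩
    · exact c.rootPoly_dvd_functional_zpow E w Q
    · dsimp only
      rw [c.functional_xi_mul E hE]
      exact dvd_zero _
  | smul T P _ hP =>
    intro Q
    have : (T • P) * Q = P * (T.unop * Q) := mul_assoc _ _ _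
    rw [this]
    exact hP _

end Relations

end TaylorCoords

end LogDeRham

/-! ### Generators of the module -/

namespace LogDeRham

namespace TaylorCoords

open Polynomial

section RootPoly

variable {N : ℕ} (E : Fin N → ℕ)

theorem rootSet_eq_cons {u : Fin N → ℕ} {i : Fin N} (hi : u i < E i) :
    rootSet E u = ((u i : ℝ) / E i) ::ₘ rootSet E (u + Pi.single i 1) := by
  rw [rootSet, rootSet, ← Finset.add_sum_erase _ _ (Finset.mem_univ i),
    ← Finset.add_sum_erase _ _ (Finset.mem_univ i), ← Multiset.cons_add]
  have : ∑ j ∈ Finset.univ.erase i, ((Finset.Ico ((u + Pi.single i 1 : Fin N → ℕ) j)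
      (E j)).val.map fun m : ℕ => (m : ℝ) / E j) =
      ∑ j ∈ Finset.univ.erase i, (Finset.Ico (u j) (E j)).val.map fun m : ℕ => (m : ℝ) / E j :=
    Finset.sum_congr rfl fun j hj => by simp [Finset.ne_of_mem_erase hj]
  rw [this]
  congr 1
  have h2 : Finset.Ico (u i) (E i) = Finset.cons (u i) (Finset.Ico (u i + 1) (E i)) (by simp) := by
    ext m; simp only [Finset.mem_Ico, Finset.mem_cons]; omega
  rw [h2, Finset.cons_val, Multiset.map_cons]
  simp

theorem rootPoly_eq_mul {u : Fin N → ℕ} {i : Fin N} (hi : u i < E i) :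
    rootPoly E u = rootPoly E (u + Pi.single i 1) * (X - C ((u i : ℂ) / E i)) := by
  rw [rootPoly, rootPoly, rootSet_eq_cons E hi, Multiset.map_cons, Multiset.prod_cons, mul_comm]
  simp

theorem rootPoly_self : rootPoly E E = 1 := by simp [rootPoly, rootSet]

end RootPoly

variable {A : Type*} [CommRing A] [Algebra ℂ A] {n : ℕ} (c : TaylorCoords A (n + 1))
  (E : Fin (n + 1) → ℕ)

/-- Left multiplication by this operator induces the residue. -/
noncomputable def theta : D A := ofDer (c.lam E 0)

theorem smul_mem_relIdeal (r : ℂ) {P : D A} (hP : P ∈ c.relIdeal E) : r • P ∈ c.relIdeal E := by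
  have : r • P = MulOpposite.op (algebraMap ℂ (D A) r) • P := by
    rw [op_smul_eq_mul, ← Algebra.commutes, Algebra.smul_def]
  rw [this]
  exact Submodule.smul_mem _ _ hP

theorem aeval_theta_mul_mem (p : ℂ[X]) {P : D A} (hP : P ∈ c.relIdeal E) :
    aeval (c.theta E) p * P ∈ c.relIdeal E := by
  induction p using Polynomial.induction_on' generalizing P with
  | add p q hp hq => rw [map_add, add_mul]; exact add_mem (hp hP) (hq hP)
  | monomial k r =>
    rw [aeval_monomial, mul_assoc, ← Algebra.smul_def]
    refine c.smul_mem_relIdeal E r ?_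
    induction k with
    | zero => simpa using hP
    | succ k ih => rw [pow_succ', mul_assoc]; exact c.lam_zero_mul_mem E ih

theorem functional_aeval_theta_mul (hE : E 0 ≠ 0) (w : Fin (n + 1) → ℤ) (p : ℂ[X]) (P : D A) :
    c.functional E w (aeval (c.theta E) p * P) = p * c.functional E w P := by
  induction p using Polynomial.induction_on' generalizing P with
  | add p q hp hq => rw [map_add, add_mul, map_add, hp, hq, add_mul]
  | monomial k r =>
    rw [aeval_monomial, mul_assoc, ← Algebra.smul_def, map_smul, ← C_mul_X_pow_eq_monomial,
      mul_assoc, smul_eq_C_mul]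
    congr 1
    induction k with
    | zero => simp
    | succ k ih =>
      rw [pow_succ', mul_assoc, theta, functional_lam_mul _ _ hE, ← theta, ih, pow_succ', mul_assoc]

/-- In `M` all normalized Euler fields act as `theta`. -/
theorem lam_mul_sub_mem {i : Fin (n + 1)} (hi : E i ≠ 0) (P : D A) :
    ofDer (c.lam E i) * P - c.theta E * P ∈ c.relIdeal E := by
  induction i using Fin.cases with
  | zero => rw [theta, sub_self]; exact zero_mem _
  | succ k =>
    have := c.xi_mul_mem_relIdeal E k P
    have e : ofDer (c.xi E k) = ofDer (c.lam E k.succ) - ofDer (c.lam E 0) := by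
      rw [xi, if_neg hi]; rfl
    rwa [e, sub_mul] at this

theorem euler_mul_sub_mem {i : Fin (n + 1)} (hi : E i ≠ 0) (P : D A) :
    ofDer (c.euler i) * P - (E i : ℂ) • (c.theta E * P) ∈ c.relIdeal E := by
  have h : (E i : ℂ) ≠ 0 := by exact_mod_cast hi
  have := c.smul_mem_relIdeal E (E i : ℂ) (c.lam_mul_sub_mem E hi P)
  have e : ofDer (c.lam E i) = (E i : ℂ)⁻¹ • ofDer (c.euler i) := by
    rw [lam, if_neg hi]; rfl
  rwa [smul_sub, e, smul_mul_assoc, smul_smul, mul_inv_cancel₀ h, one_smul] at this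

theorem del_mul_mem {i : Fin (n + 1)} (hE : E 0 ≠ 0) (hi : E i = 0) (P : D A) :
    c.del i * P ∈ c.relIdeal E := by
  induction i using Fin.cases with
  | zero => exact absurd hi hE
  | succ k =>
    have := c.xi_mul_mem_relIdeal E k P
    rwa [xi, if_pos hi, sub_zero, lam, if_pos hi] at this

theorem euler_mul_zpow_smul {i : Fin (n + 1)} {a : A} (ha : c.d i a = 0) (u γ : Fin (n + 1) → ℕ) :
    ofDer (c.euler i) * ((c.zpow u * a) • c.pd γ) =
      (c.zpow (u + Pi.single i 1) * a) • c.pd (γ + Pi.single i 1) +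
        (u i : ℂ) • ((c.zpow u * a) • c.pd γ) := by
  have h : c.euler i (c.zpow u * a) = (u i : ℂ) • (c.zpow u * a) := by
    rw [Derivation.leibniz, euler_zpow, euler_apply, ha, mul_zero, smul_zero, zero_add, smul_eq_mul,
      mul_smul_comm, mul_comm a]
  rw [ofDer_mul_smul, h, smul_assoc, pd_add_single, zpow_add, zpow_single, euler, ofDer_smul,
    smul_mul, smul_smul, ← del]
  congr 2
  ring

/-- Modulo the relations, `E_i θ - u_i` multiplies `z^u a d^γ` by `z_i` and `d_i`. -/
theorem theta_sub_mul_mem {i : Fin (n + 1)} (hi : E i ≠ 0) {a : A} (ha : c.d i a = 0)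
    (u γ : Fin (n + 1) → ℕ) :
    aeval (c.theta E) (X - C ((u i : ℂ) / E i)) * ((c.zpow u * a) • c.pd γ) -
      (E i : ℂ)⁻¹ • ((c.zpow (u + Pi.single i 1) * a) • c.pd (γ + Pi.single i 1)) ∈
      c.relIdeal E := by
  have h : (E i : ℂ) ≠ 0 := by exact_mod_cast hi
  have := c.smul_mem_relIdeal E (-(E i : ℂ)⁻¹)
    (c.euler_mul_sub_mem E hi ((c.zpow u * a) • c.pd γ))
  rw [c.euler_mul_zpow_smul ha, smul_sub, smul_smul, neg_mul, inv_mul_cancel₀ h, smul_add,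
    smul_smul] at this
  rw [map_sub, aeval_X, aeval_C, sub_mul, ← Algebra.smul_def, div_eq_inv_mul]
  convert this using 1
  simp only [neg_smul, one_smul, neg_mul]
  abel

/-- The operators `z^u a d^γ` are annihilated by the polynomial `rootPoly` in the residue: each
linear factor adds a `z_i`, until `z^E` appears. -/
theorem rootPoly_theta_mul_mem {u : Fin (n + 1) → ℕ} (hu : u ≤ E) {a : A}
    (ha : ∀ i, u i < E i → c.d i a = 0) (γ : Fin (n + 1) → ℕ) :
    aeval (c.theta E) (rootPoly E u) * ((c.zpow u * a) • c.pd γ) ∈ c.relIdeal E := by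
  induction h : ∑ i, (E i - u i) generalizing u γ with
  | zero =>
    have : u = E := funext fun i => le_antisymm (hu i)
      (Nat.sub_eq_zero_iff_le.1 (Finset.sum_eq_zero_iff.1 h i (Finset.mem_univ i)))
    rw [this, rootPoly_self, map_one, one_mul, ← smul_smul]
    exact c.zpow_smul_mem_relIdeal E _
  | succ k ih =>
    obtain ⟨i, hi⟩ : ∃ i, u i < E i := by
      by_contra! hall
      rw [Finset.sum_eq_zero fun i _ => Nat.sub_eq_zero_of_le (hall i)] at h
      exact absurd h (Nat.succ_ne_zero k).symm
    have hle : u + Pi.single i 1 ≤ E := by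
      intro j
      by_cases hj : j = i
      · subst hj; simpa using hi
      · simpa [hj] using hu j
    have hsum : ∑ j, (E j - (u + Pi.single i 1 : Fin (n + 1) → ℕ) j) = k := by
      rw [← Finset.add_sum_erase _ _ (Finset.mem_univ i)] at h ⊢
      have : ∑ j ∈ Finset.univ.erase i, (E j - (u + Pi.single i 1 : Fin (n + 1) → ℕ) j) =
          ∑ j ∈ Finset.univ.erase i, (E j - u j) :=
        Finset.sum_congr rfl fun j hj => by simp [Finset.ne_of_mem_erase hj]
      rw [this]
      simp only [Pi.add_apply, Pi.single_eq_same]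
      omega
    have h1 := ih hle (fun j hj => ha j (lt_of_le_of_lt (Nat.le_add_right _ _) hj))
      (γ + Pi.single i 1) hsum
    have h2 := c.aeval_theta_mul_mem E (rootPoly E (u + Pi.single i 1))
      (c.theta_sub_mul_mem E (i := i) (by omega) (ha i hi) u γ)
    rw [rootPoly_eq_mul E hi, map_mul, mul_assoc]
    have h3 := c.smul_mem_relIdeal E (E i : ℂ)⁻¹ h1
    rw [mul_sub, mul_smul_comm (E i : ℂ)⁻¹] at h2
    have h4 := add_mem h2 h3
    rwa [sub_add_cancel] at h4

/-- The exponents `κ` of the generators `z^{κ⁺} a d^{κ⁻}` of `M`: integer vectors with `κ ≤ E`, and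
`κ_i = 0` where `E_i = 0`. -/
def Shape : Type := {κ : Fin (n + 1) → ℤ // ∀ i, κ i ≤ E i ∧ (E i = 0 → κ i = 0)}

namespace Shape

variable {E}

/-- The positive part. -/
def pos (κ : Shape E) : Fin (n + 1) → ℕ := fun i => (κ.1 i).toNat

/-- The negative part. -/
def neg (κ : Shape E) : Fin (n + 1) → ℕ := fun i => (-κ.1 i).toNat

theorem pos_le (κ : Shape E) : κ.pos ≤ E := fun i => by
  have := (κ.2 i).1
  simp only [pos]; omega

/-- The roots of `rootPoly E κ.pos` in increasing order. -/
noncomputable def roots (κ : Shape E) : List ℝ := (rootSet E κ.pos).sort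

/-- The product of the linear factors of the first `q` roots. -/
noncomputable def poly (κ : Shape E) (q : ℕ) : ℂ[X] :=
  ((κ.roots.take q).map fun r : ℝ => X - C (r : ℂ)).prod

theorem poly_zero (κ : Shape E) : κ.poly 0 = 1 := rfl

theorem poly_succ (κ : Shape E) (q : Fin κ.roots.length) :
    κ.poly (q + 1) = κ.poly q * (X - C ((κ.roots.get q : ℝ) : ℂ)) := by
  rw [poly, poly, ← List.take_concat_get' _ _ q.2, List.map_append, List.prod_append]
  simp

theorem poly_length (κ : Shape E) : κ.poly κ.roots.length = rootPoly E κ.pos := by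
  rw [poly, List.take_length, rootPoly, ← Multiset.prod_coe, ← Multiset.map_coe, roots,
    Multiset.sort_eq]

end Shape

/-- The coefficients of the generators with exponent `κ`: the functions that do not depend on the
`z_i` with `κ_i < E_i`. -/
def coeffSpace (κ : Shape E) : Submodule ℂ A where
  carrier := {a | ∀ i, κ.1 i < E i → c.d i a = 0}
  add_mem' h h' i hi := by rw [map_add, h i hi, h' i hi, add_zero]
  zero_mem' i _ := map_zero _
  smul_mem' r a h i hi := by rw [Derivation.map_smul, h i hi, smul_zero]

/-- The generators of `M`, as operators: the product of `θ - r`, for the first `q` roots `r`,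
applied to `z^{κ⁺} a d^{κ⁻}`. -/
noncomputable def gen (κ : Shape E) (q : ℕ) : c.coeffSpace E κ →ₗ[ℂ] D A where
  toFun a := aeval (c.theta E) (κ.poly q) * ((c.zpow κ.pos * (a : A)) • c.pd κ.neg)
  map_add' a b := by rw [Submodule.coe_add, mul_add, add_smul, mul_add]
  map_smul' r a := by
    rw [Submodule.coe_smul, mul_smul_comm r, smul_assoc r, mul_smul_comm r, RingHom.id_apply]

theorem gen_apply (κ : Shape E) (q : ℕ) (a : c.coeffSpace E κ) :
    c.gen E κ q a = aeval (c.theta E) (κ.poly q) * ((c.zpow κ.pos * (a : A)) • c.pd κ.neg) := rfl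

/-- The next element of the chain is the image under `θ - r_q`. -/
theorem gen_succ (κ : Shape E) (q : Fin κ.roots.length) (a : c.coeffSpace E κ) :
    c.theta E * c.gen E κ q a =
      c.gen E κ (q + 1) a + ((κ.roots.get q : ℝ) : ℂ) • c.gen E κ q a := by
  rw [gen_apply, gen_apply, κ.poly_succ, mul_comm (κ.poly q), map_mul, mul_assoc, map_sub, aeval_X,
    aeval_C, sub_mul, ← Algebra.smul_def, sub_add_cancel]

/-- The chain ends after as many steps as there are roots. -/
theorem gen_length_mem (κ : Shape E) (a : c.coeffSpace E κ) :
    c.gen E κ κ.roots.length a ∈ c.relIdeal E := by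
  rw [gen_apply, κ.poly_length]
  refine c.rootPoly_theta_mul_mem E κ.pos_le (fun i hi => a.2 i ?_) _
  simp only [Shape.pos] at hi
  omega

end TaylorCoords

end LogDeRham

/-! ### The generators span -/

namespace LogDeRham

namespace TaylorCoords

section Expansion

variable {A : Type*} [CommRing A] [Algebra ℂ A] {N : ℕ} (c : TaylorCoords A N) (E : Fin N → ℕ)

/-- Iterated division: a function that does not depend on the `z_i` with `i ∈ T` is a sum of terms
`z^u b` with `u ≤ E`, where `u_i = 0` for `i ∈ T`, and `b` does not depend on `z_i` unless
`u_i = E_i`. -/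
theorem mem_of_zpow_mul_mem (V : Submodule ℂ A) (T : Finset (Fin N))
    (hV : ∀ u ≤ E, (∀ i ∈ T, u i = 0) → ∀ a, (∀ i, u i < E i → c.d i a = 0) → c.zpow u * a ∈ V)
    {a : A} (ha : ∀ i ∈ T, c.d i a = 0) : a ∈ V := by
  -- `S` is the set of the coordinates in which the division has not been carried out.
  have claim : ∀ S : Finset (Fin N), Disjoint S T → ∀ u ≤ E, (∀ i ∈ T, u i = 0) → ∀ a,
      (∀ i ∉ S, u i < E i → c.d i a = 0) → c.zpow u * a ∈ V := by
    intro S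
    induction S using Finset.induction_on with
    | empty => exact fun _ u hu hT a h => hV u hu hT a fun i => h i (Finset.notMem_empty i)
    | insert j S hj ih =>
      intro hd u hu hT a h
      rw [Finset.disjoint_insert_left] at hd
      induction hk : E j - u j generalizing u a with
      | zero =>
        refine ih hd.2 u hu hT a fun i hi hlt => h i ?_ hlt
        rw [Finset.mem_insert, not_or]
        exact ⟨fun e => by subst e; omega, hi⟩
      | succ k ihk =>
        obtain ⟨r, b, e, hr⟩ := c.div j a
        have hrb : ∀ i ∉ insert j S, u i < E i → c.d i r = 0 ∧ c.d i b = 0 := fun i hi hlt =>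
          c.d_eq_zero_of_div (fun e => hi (by rw [e]; exact Finset.mem_insert_self _ _)) hr
            (by rw [← e]; exact h i hi hlt)
        have e2 : c.zpow u * a = c.zpow u * r + c.zpow (u + Pi.single j 1) * b := by
          rw [e, zpow_add, zpow_single]; ring
        rw [e2]
        refine add_mem (ih hd.2 u hu hT r fun i hi hlt => ?_)
          (ihk _ ?_ ?_ b (fun i hi hlt => ?_) ?_)
        · by_cases hij : i = j
          · rw [hij]; exact hr
          · exact (hrb i (by simp [hij, hi]) hlt).1
        · intro i
          by_cases hij : i = j
          · subst hij; simp; omega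
          · simpa [hij] using hu i
        · intro i hi
          have : i ≠ j := fun e => hd.1 (e ▸ hi)
          simpa [this] using hT i hi
        · exact (hrb i hi (lt_of_le_of_lt (Nat.le_add_right _ _) hlt)).2
        · simp; omega
  have := claim Tᶜ disjoint_compl_left 0 (fun i => Nat.zero_le _) (fun _ _ => rfl) a
    (fun i hi _ => ha i (by simpa using hi))
  rwa [zpow_zero, one_mul] at this

end Expansion

open Polynomial

variable {A : Type*} [CommRing A] [Algebra ℂ A] {n : ℕ} (c : TaylorCoords A (n + 1))
  (E : Fin (n + 1) → ℕ)

/-- The span of the relations and of the generators of degree `|κ⁻| + q` at most `m`. -/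
noncomputable def genSpan (m : ℕ) : Submodule ℂ (D A) :=
  Submodule.span ℂ {P | ∃ (κ : Shape E) (q : Fin κ.roots.length) (a : c.coeffSpace E κ),
    ∑ i, κ.neg i + q ≤ m ∧ c.gen E κ q a = P} ⊔ (c.relIdeal E).restrictScalars ℂ

theorem genSpan_mono {m k : ℕ} (h : m ≤ k) : c.genSpan E m ≤ c.genSpan E k :=
  sup_le_sup_right (Submodule.span_mono (by
    rintro _ ⟨κ, q, a, hq, e⟩
    exact ⟨κ, q, a, hq.trans h, e⟩)) _

theorem mem_genSpan_of_mem_relIdeal {m : ℕ} {P : D A} (hP : P ∈ c.relIdeal E) :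
    P ∈ c.genSpan E m := Submodule.mem_sup_right hP

theorem gen_mem_genSpan (κ : Shape E) {q : ℕ} (hq : q ≤ κ.roots.length) (a : c.coeffSpace E κ) :
    c.gen E κ q a ∈ c.genSpan E (∑ i, κ.neg i + q) := by
  rcases hq.lt_or_eq with h | h
  · exact Submodule.mem_sup_left (Submodule.subset_span ⟨κ, ⟨q, h⟩, a, le_rfl, rfl⟩)
  · rw [h]
    exact c.mem_genSpan_of_mem_relIdeal E (c.gen_length_mem E κ a)

theorem theta_mul_mem_genSpan {m : ℕ} {P : D A} (hP : P ∈ c.genSpan E m) :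
    c.theta E * P ∈ c.genSpan E (m + 1) := by
  have : c.genSpan E m ≤ (c.genSpan E (m + 1)).comap (LinearMap.mulLeft ℂ (c.theta E)) := by
    refine sup_le (Submodule.span_le.2 ?_) fun P hP =>
      c.mem_genSpan_of_mem_relIdeal E (c.lam_zero_mul_mem E hP)
    rintro _ ⟨κ, q, a, hq, rfl⟩
    change c.theta E * _ ∈ c.genSpan E (m + 1)
    rw [gen_succ]
    refine add_mem (c.genSpan_mono E ?_ (c.gen_mem_genSpan E κ (q := q + 1) q.2 a))
      (Submodule.smul_mem _ _ (c.genSpan_mono E ?_ (c.gen_mem_genSpan E κ q.2.le a))) <;> omega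
  exact this hP

/-- Induction on the order. If `β_l ≠ 0` for a direction with `E_l = 0`, the relation `d_l` lowers
the order. Otherwise divide `a` by the `z_i` with `β_i ≠ 0`. The remainder gives generators with
`κ⁻ = β`, and in the terms that are divisible by `z_i` the operator `z_i d_i` is replaced by
`E_i θ`. -/
theorem smul_pd_mem_genSpan (hE : E 0 ≠ 0) (a : A) (β : Fin (n + 1) → ℕ) :
    a • c.pd β ∈ c.genSpan E (∑ i, β i) := by
  induction h : ∑ i, β i using Nat.strong_induction_on generalizing β a with
  | _ m ih =>
    subst h
    have hpred : ∀ i, β i ≠ 0 → ∃ β' : Fin (n + 1) → ℕ, β = β' + Pi.single i 1 := by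
      intro i hi
      refine ⟨β - Pi.single i 1, funext fun j => ?_⟩
      by_cases hj : j = i
      · subst hj; simp; omega
      · simp [hj]
    by_cases hA : ∃ l, E l = 0 ∧ β l ≠ 0
    · obtain ⟨l, hl, hβ⟩ := hA
      obtain ⟨β', rfl⟩ := hpred l hβ
      have h1 := c.del_mul_mem E hE hl (a • c.pd β')
      rw [sum_add_single] at ih ⊢
      have h2 := ih _ (Nat.lt_succ_self _) (c.d l a) β' rfl
      rw [del_mul_smul, ← pd_add_single] at h1
      have h3 := sub_mem (c.mem_genSpan_of_mem_relIdeal E h1) (c.genSpan_mono E (Nat.le_succ _) h2)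
      rwa [add_sub_cancel_right] at h3
    · push Not at hA
      obtain ⟨r, b, e, hr⟩ := c.exists_eq_add_sum a (Finset.univ.filter fun i => β i ≠ 0)
      rw [e, add_smul, Finset.sum_smul]
      refine add_mem ?_ (sum_mem fun i hi => ?_)
      · set V : Submodule ℂ A := (c.genSpan E (∑ i, β i)).comap
          ((LinearMap.toSpanSingleton A (D A) (c.pd β)).restrictScalars ℂ) with hV
        change r ∈ V
        refine c.mem_of_zpow_mul_mem E V (Finset.univ.filter fun i => β i ≠ 0) ?_ hr
        intro u hu hT a ha
        have hT' : ∀ i, β i ≠ 0 → u i = 0 := fun i hi => hT i (by simpa using hi)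
        set κ : Shape E := ⟨fun i => (u i : ℤ) - β i, fun i => by
          have h1 : u i ≤ E i := hu i
          dsimp only
          refine ⟨by omega, fun h0 => ?_⟩
          have := hA i h0
          omega⟩ with hκ
        have hp : κ.pos = u := funext fun i => by
          have := hT' i
          simp only [Shape.pos, hκ]; omega
        have hn : κ.neg = β := funext fun i => by
          have := hT' i
          simp only [Shape.neg, hκ]; omega
        have := c.gen_mem_genSpan E κ (Nat.zero_le _) ⟨a, fun i hi => by
          by_cases h0 : β i = 0
          · refine ha i ?_
            simp only [hκ] at hi
            omega
          · refine ha i ?_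
            rw [hT' i h0]
            exact Nat.pos_of_ne_zero fun h1 => h0 (hA i h1)⟩
        rw [gen_apply, κ.poly_zero, map_one, one_mul, hp, hn, add_zero] at this
        exact this
      · have hi' : β i ≠ 0 := by simpa using hi
        have hEi : E i ≠ 0 := fun h0 => hi' (hA i h0)
        obtain ⟨β', rfl⟩ := hpred i hi'
        rw [sum_add_single] at ih ⊢
        have h1 := ih _ (Nat.lt_succ_self _) (b i) β' rfl
        have h2 := ih _ (Nat.lt_succ_self _) (c.z i * c.d i (b i)) β' rfl
        have h3 := c.mem_genSpan_of_mem_relIdeal (m := ∑ j, β' j + 1) E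
          (c.euler_mul_sub_mem E hEi (b i • c.pd β'))
        have h4 := add_mem h3 (Submodule.smul_mem _ (E i : ℂ) (c.theta_mul_mem_genSpan E h1))
        rw [sub_add_cancel, euler, ofDer_smul, smul_mul, ← del, del_mul_smul, ← pd_add_single,
          smul_add, smul_smul, smul_smul] at h4
        have h5 := sub_mem h4 (c.genSpan_mono E (Nat.le_succ _) h2)
        rwa [add_sub_cancel_right] at h5

/-- The operators of order at most `m` are spanned by the relations and the generators of degree at
most `m`. -/
theorem mem_genSpan_of_mem_ordLE (hE : E 0 ≠ 0) {m : ℕ} {P : D A} (hP : P ∈ c.ordLE m) :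
    P ∈ c.genSpan E m := by
  suffices key : ∀ a : A, a • P ∈ c.genSpan E m by simpa using key 1
  induction hP using Submodule.span_induction with
  | mem P hP =>
    obtain ⟨β, hβ, rfl⟩ := hP
    exact fun a => c.genSpan_mono E hβ (c.smul_pd_mem_genSpan E hE a β)
  | zero => simp
  | add P Q _ _ hP hQ => intro a; rw [smul_add]; exact add_mem (hP a) (hQ a)
  | smul b P _ hP => intro a; rw [smul_smul]; exact hP _

/-- The generator with exponent `κ` and index `q` has order at most `|κ⁻| + q`. -/
theorem gen_mem_ordLE (κ : Shape E) (q : ℕ) (a : c.coeffSpace E κ) :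
    c.gen E κ q a ∈ c.ordLE (∑ i, κ.neg i + q) := by
  have key : ∀ (L : List ℝ) (P : D A) (m : ℕ), P ∈ c.ordLE m →
      aeval (c.theta E) (L.map fun r : ℝ => X - C (r : ℂ)).prod * P ∈ c.ordLE (m + L.length) := by
    intro L P m hP
    induction L with
    | nil => simpa using hP
    | cons r L ih =>
      rw [List.map_cons, List.prod_cons, map_mul, mul_assoc, map_sub, aeval_X, aeval_C, sub_mul,
        ← Algebra.smul_def, List.length_cons, ← add_assoc]
      refine sub_mem (c.ofDer_mul_mem_ordLE _ ih) ?_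
      rw [← algebraMap_smul A]
      exact Submodule.smul_mem _ _ (c.ordLE_mono (Nat.le_succ _) ih)
  refine c.ordLE_mono ?_ (key (κ.roots.take q) _ (∑ i, κ.neg i)
    (Submodule.smul_mem _ _ (c.pd_mem_ordLE le_rfl)))
  rw [List.length_take]
  exact Nat.add_le_add_left (min_le_left _ _) _

end TaylorCoords

end LogDeRham

/-! ### The generators form a basis -/

namespace LogDeRham

section Chains

open Polynomial

/-- A chain `∏_{k < q} (X - r_k)`, `q < l`, is linearly independent modulo `∏_{k < l} (X - r_k)`,
even after multiplication by a polynomial without zeros at the `r_k`. -/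
theorem eq_zero_of_prod_dvd (L : List ℝ) (f : Fin L.length → ℂ) (g : ℂ[X])
    (hg : ∀ r ∈ L, g.eval (r : ℂ) ≠ 0)
    (h : (L.map fun r : ℝ => X - C (r : ℂ)).prod ∣
      (∑ q, C (f q) * ((L.take q).map fun r : ℝ => X - C (r : ℂ)).prod) * g) (q : Fin L.length) :
    f q = 0 := by
  induction L with
  | nil => exact q.elim0
  | cons r L ih =>
    have e : ∑ q, C (f q) * (((r :: L).take q).map fun r : ℝ => X - C (r : ℂ)).prod =
        C (f 0) + (X - C (r : ℂ)) * ∑ q : Fin L.length, C (f q.succ) *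
          ((L.take q).map fun r : ℝ => X - C (r : ℂ)).prod := by
      rw [Finset.mul_sum]
      refine (Fin.sum_univ_succ _).trans ?_
      congr 1
      · simp
      · refine Finset.sum_congr rfl fun q _ => ?_
        rw [Fin.val_succ, List.take_succ_cons, List.map_cons, List.prod_cons]
        ring
    rw [e, List.map_cons, List.prod_cons] at h
    have h0 : f 0 = 0 := by
      have h1 := dvd_iff_isRoot.1 (dvd_of_mul_right_dvd h)
      simp only [IsRoot, eval_mul, eval_add, eval_C, eval_sub, eval_X, sub_self, zero_mul,
        add_zero] at h1
      exact (mul_eq_zero.1 h1).resolve_right (hg r List.mem_cons_self)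
    rw [h0, C_0, zero_add, mul_assoc] at h
    have h2 := (mul_dvd_mul_iff_left (X_sub_C_ne_zero (r : ℂ))).1 h
    have h3 := ih (fun q => f q.succ) (fun r hr => hg r (List.mem_cons_of_mem _ hr)) h2
    induction q using Fin.cases with
    | zero => exact h0
    | succ q => exact h3 q

end Chains

namespace TaylorCoords

open Polynomial

section RootPoly

variable {N : ℕ} (E : Fin N → ℕ)

theorem rootSet_nonneg {u : Fin N → ℕ} {r : ℝ} (hr : r ∈ rootSet E u) : 0 ≤ r := by
  rw [rootSet, Multiset.mem_sum] at hr
  obtain ⟨i, -, hi⟩ := hr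
  obtain ⟨m, -, rfl⟩ := Multiset.mem_map.1 hi
  positivity

theorem rootSet_eq_zero (hE : ∀ i, E i ≤ 1) {u : Fin N → ℕ} {r : ℝ} (hr : r ∈ rootSet E u) :
    r = 0 := by
  rw [rootSet, Multiset.mem_sum] at hr
  obtain ⟨i, -, hi⟩ := hr
  obtain ⟨m, hm, rfl⟩ := Multiset.mem_map.1 hi
  have h1 : m < E i := (Finset.mem_Ico.1 hm).2
  have h2 := hE i
  rw [show m = 0 by omega, Nat.cast_zero, zero_div]

theorem card_rootSet_le (u : Fin N → ℕ) : (rootSet E u).card ≤ ∑ i, E i := by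
  rw [rootSet, Multiset.card_sum]
  refine Finset.sum_le_sum fun i _ => ?_
  rw [Multiset.card_map, Finset.card_val, Nat.card_Ico]
  exact Nat.sub_le _ _

end RootPoly

variable {A : Type*} [CommRing A] [Algebra ℂ A] {n : ℕ} (c : TaylorCoords A (n + 1))
  (E : Fin (n + 1) → ℕ)

theorem functional_gen (hE : E 0 ≠ 0) (w : Fin (n + 1) → ℤ) (κ : Shape E) (q : ℕ)
    (a : c.coeffSpace E κ) : c.functional E w (c.gen E κ q a) =
      κ.poly q * (c.coeff (w - κ.1) (a : A) • fallingPoly E w κ.neg) := by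
  rw [gen_apply, functional_aeval_theta_mul _ _ hE, functional_smul_pd, c.coeff_zpow_mul]
  congr 4
  ext i
  simp only [Shape.pos, Shape.neg, Pi.add_apply, Pi.sub_apply]
  omega

/-- The functional with index `κ + v`, for `v` an exponent of the functions in `coeffSpace κ`,
vanishes on the generators of other shapes: a coefficient with index `κ + v - κ'` of a function in
`coeffSpace κ'` is zero. In a direction where `κ` and `κ'` differ this index is nonzero if
`κ'_i < E_i`, and negative if `κ'_i = E_i`. -/
theorem functional_gen_of_ne (hE : E 0 ≠ 0) {v : Fin (n + 1) → ℤ} {κ κ' : Shape E} (h : κ' ≠ κ)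
    (hv : ∀ i, 0 ≤ v i) (hv' : ∀ i, κ.1 i < E i → v i = 0) (q : ℕ) (a : c.coeffSpace E κ') :
    c.functional E (κ.1 + v) (c.gen E κ' q a) = 0 := by
  obtain ⟨i, hi⟩ := Function.ne_iff.1 (fun e => h (Subtype.ext e))
  have h1 := (κ.2 i).1
  have h2 := (κ'.2 i).1
  have h3 := hv i
  have h4 := hv' i
  suffices c.coeff (κ.1 + v - κ'.1) (a : A) = 0 by
    rw [functional_gen _ _ hE, this, zero_smul, mul_zero]
  by_cases h5 : κ'.1 i < E i
  · refine c.coeff_eq_zero_of_d (a.2 i h5) ?_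
    simp only [Pi.sub_apply, Pi.add_apply]
    omega
  · refine c.coeff_of_neg _ i _ ?_
    simp only [Pi.sub_apply, Pi.add_apply]
    omega

/-- The factors `E_i r - κ_i - m` with `m < -κ_i` are positive at `r ≥ 0`. -/
theorem eval_fallingPoly_ne_zero {v : Fin (n + 1) → ℤ} {κ : Shape E}
    (hv' : ∀ i, κ.1 i < E i → v i = 0) {r : ℝ} (hr : 0 ≤ r) :
    (fallingPoly E (κ.1 + v) κ.neg).eval (r : ℂ) ≠ 0 := by
  rw [fallingPoly, eval_prod]
  refine Finset.prod_ne_zero_iff.2 fun i _ => ?_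
  rw [eval_prod]
  refine Finset.prod_ne_zero_iff.2 fun m hm => ?_
  have hm' : (m : ℤ) < -κ.1 i := by
    simp only [Shape.neg, Finset.mem_range] at hm
    omega
  have h0 : E i ≠ 0 := fun h => by
    have := (κ.2 i).2 h
    omega
  rw [weightPoly, if_neg h0, Pi.add_apply, hv' i (by omega), add_zero]
  simp only [eval_sub, eval_mul, eval_C, eval_X]
  have h1 : (0 : ℝ) < E i * r - (κ.1 i + m) := by
    have h2 : ((κ.1 i + m : ℤ) : ℝ) < 0 := by
      have : κ.1 i + m < 0 := by omega
      exact_mod_cast this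
    push_cast at h2
    have : (0 : ℝ) ≤ E i * r := by positivity
    linarith
  have h3 := (Complex.ofReal_ne_zero (z := (E i * r - (κ.1 i + m) : ℝ))).2 h1.ne'
  push_cast at h3
  exact h3

theorem rootPoly_toNat {v : Fin (n + 1) → ℤ} {κ : Shape E} (hv : ∀ i, 0 ≤ v i)
    (hv' : ∀ i, κ.1 i < E i → v i = 0) :
    rootPoly E (fun i => ((κ.1 + v) i).toNat) = rootPoly E κ.pos := by
  refine congrArg (fun s : Multiset ℝ => (s.map fun r : ℝ => X - C (r : ℂ)).prod)
    (Finset.sum_congr rfl fun i _ => ?_)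
  by_cases h : κ.1 i < E i
  · simp [hv' i h, Shape.pos]
  · have := hv i
    rw [Finset.Ico_eq_empty_of_le, Finset.Ico_eq_empty_of_le] <;>
      simp only [Shape.pos, Pi.add_apply] <;> omega

open Classical in
/-- The sum of the generators with given coefficients. -/
noncomputable def genSum :
    (Π₀ s : Σ κ : Shape E, Fin κ.roots.length, c.coeffSpace E s.1) →ₗ[ℂ] D A :=
  DFinsupp.lsum ℂ fun s => c.gen E s.1 s.2

open Classical in
theorem genSum_single (s : Σ κ : Shape E, Fin κ.roots.length) (a : c.coeffSpace E s.1) :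
    c.genSum E (DFinsupp.single s a) = c.gen E s.1 s.2 a := DFinsupp.lsum_single _ _ _ _

/-- The functional with index `κ + v` reads off the coefficients with index `v` of the generators of
shape `κ`. -/
theorem functional_genSum (hE : E 0 ≠ 0) {v : Fin (n + 1) → ℤ} (κ : Shape E)
    (hv : ∀ i, 0 ≤ v i) (hv' : ∀ i, κ.1 i < E i → v i = 0)
    (x : Π₀ s : Σ κ : Shape E, Fin κ.roots.length, c.coeffSpace E s.1) :
    c.functional E (κ.1 + v) (c.genSum E x) =
      (∑ q : Fin κ.roots.length, C (c.coeff v (x ⟨κ, q⟩ : A)) * κ.poly q) *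
        fallingPoly E (κ.1 + v) κ.neg := by
  classical
  induction x using DFinsupp.induction with
  | h0 => simp
  | ha s a x _ _ ih =>
    rw [map_add, map_add, ih, genSum_single]
    simp only [DFinsupp.add_apply, Submodule.coe_add, map_add, add_mul, Finset.sum_add_distrib]
    congr 1
    obtain ⟨κ', q'⟩ := s
    by_cases hκ : κ' = κ
    · subst hκ
      rw [Finset.sum_eq_single q', DFinsupp.single_eq_same, functional_gen _ _ hE,
        add_sub_cancel_left, smul_eq_C_mul]
      · ring
      · intro q _ hq
        rw [DFinsupp.single_eq_of_ne (by simpa using hq)]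
        simp
      · simp
    · rw [c.functional_gen_of_ne E hE hκ hv hv', Finset.sum_eq_zero, zero_mul]
      intro q _
      rw [DFinsupp.single_eq_of_ne (by rintro ⟨⟩; exact hκ rfl)]
      simp

/-- The generators are independent modulo the relations: by the divisibility of the functionals on
the relations and the independence of the chain of polynomials, all Taylor coefficients vanish. -/
theorem eq_zero_of_genSum_mem (hE : E 0 ≠ 0)
    {x : Π₀ s : Σ κ : Shape E, Fin κ.roots.length, c.coeffSpace E s.1}
    (hx : c.genSum E x ∈ c.relIdeal E) : x = 0 := by
  refine DFinsupp.ext fun s => Subtype.ext (c.coeff_inj _ fun v => ?_)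
  obtain ⟨κ, q⟩ := s
  by_cases hv : ∀ i, 0 ≤ v i
  · by_cases hv' : ∀ i, κ.1 i < E i → v i = 0
    · have h := c.rootPoly_dvd_functional E hE (κ.1 + v) hx
      rw [functional_genSum _ _ hE κ hv hv', rootPoly_toNat E hv hv', ← κ.poly_length, Shape.poly,
        List.take_length] at h
      refine eq_zero_of_prod_dvd κ.roots (fun q => c.coeff v (x ⟨κ, q⟩ : A)) _ (fun r hr => ?_) h q
      exact eval_fallingPoly_ne_zero E hv' (rootSet_nonneg E (by simpa [Shape.roots] using hr))
    · push Not at hv'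
      obtain ⟨i, hi, hvi⟩ := hv'
      exact c.coeff_eq_zero_of_d ((x ⟨κ, q⟩).2 i hi) hvi
  · push Not at hv
    obtain ⟨i, hi⟩ := hv
    exact c.coeff_of_neg v i _ hi

theorem exists_genSum_sub_mem (hE : E 0 ≠ 0) (P : D A) :
    ∃ x, P - c.genSum E x ∈ c.relIdeal E := by
  classical
  obtain ⟨m, hm⟩ := c.exists_mem_ordLE P
  have hP := c.mem_genSpan_of_mem_ordLE E hE hm
  obtain ⟨Q, hQ, T, hT, rfl⟩ := Submodule.mem_sup.1 hP
  have : Q ∈ LinearMap.range (c.genSum E) := by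
    refine (Submodule.span_le.2 ?_) hQ
    rintro _ ⟨κ, q, a, -, rfl⟩
    exact ⟨DFinsupp.single ⟨κ, q⟩ a, c.genSum_single E _ _⟩
  obtain ⟨x, rfl⟩ := this
  exact ⟨x, by rw [add_sub_cancel_left]; exact hT⟩

variable (hE : E 0 ≠ 0)

/-- The coordinates of `M` with respect to its generators. -/
noncomputable def genEquiv :
    (Π₀ s : Σ κ : Shape E, Fin κ.roots.length, c.coeffSpace E s.1) ≃ₗ[ℂ] M (c.zpow E) n :=
  LinearEquiv.ofBijective ((c.pr E hE).restrictScalars ℂ ∘ₗ c.genSum E) (by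
    constructor
    · rw [injective_iff_map_eq_zero]
      exact fun x hx => c.eq_zero_of_genSum_mem E hE ((c.pr_eq_zero_iff E hE).1 hx)
    · intro y
      obtain ⟨P, rfl⟩ := c.pr_surjective E hE y
      obtain ⟨x, hx⟩ := c.exists_genSum_sub_mem E hE P
      refine ⟨x, ?_⟩
      rw [← c.pr_eq_zero_iff E hE, map_sub, sub_eq_zero] at hx
      exact hx.symm)

open Classical in
theorem genEquiv_single (s : Σ κ : Shape E, Fin κ.roots.length) (a : c.coeffSpace E s.1) :
    c.genEquiv E hE (DFinsupp.single s a) = c.pr E hE (c.gen E s.1 s.2 a) :=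
  congrArg (c.pr E hE) (c.genSum_single E s a)

open Classical in
/-- The basis of `M` obtained from bases of the spaces of coefficients. -/
noncomputable def genBasis : Module.Basis (Σ s : Σ κ : Shape E, Fin κ.roots.length,
    Module.Basis.ofVectorSpaceIndex ℂ (c.coeffSpace E s.1)) ℂ (M (c.zpow E) n) :=
  (DFinsupp.basis fun s : Σ κ : Shape E, Fin κ.roots.length =>
    Module.Basis.ofVectorSpace ℂ (c.coeffSpace E s.1)).map (c.genEquiv E hE)

theorem genBasis_apply (s : Σ κ : Shape E, Fin κ.roots.length)
    (j : Module.Basis.ofVectorSpaceIndex ℂ (c.coeffSpace E s.1)) :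
    c.genBasis E hE ⟨s, j⟩ =
      c.pr E hE (c.gen E s.1 s.2 (Module.Basis.ofVectorSpace ℂ (c.coeffSpace E s.1) j)) := by
  classical
  have : (DFinsupp.basis fun s : Σ κ : Shape E, Fin κ.roots.length =>
      Module.Basis.ofVectorSpace ℂ (c.coeffSpace E s.1)) ⟨s, j⟩ =
      DFinsupp.single s (Module.Basis.ofVectorSpace ℂ (c.coeffSpace E s.1) j) := by
    rw [Module.Basis.apply_eq_iff]
    refine (sigmaFinsuppLequivDFinsupp ℂ).symm_apply_eq.2 ?_
    refine Eq.trans ?_ (sigmaFinsuppEquivDFinsupp_single (N := ℂ)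
      (η := fun s : Σ κ : Shape E, Fin κ.roots.length =>
        Module.Basis.ofVectorSpaceIndex ℂ (c.coeffSpace E s.1)) ⟨s, j⟩ 1).symm
    refine (DFinsupp.mapRange_single (hf := fun _ => map_zero _)).trans ?_
    rw [Module.Basis.repr_self]
  rw [genBasis, Module.Basis.map_apply, ← genEquiv_single, ← this]

theorem pr_gen_mem_span {W : Submodule ℂ (M (c.zpow E) n)} {κ : Shape E}
    {q : Fin κ.roots.length} (h : ∀ j, c.genBasis E hE ⟨⟨κ, q⟩, j⟩ ∈ W) (a : c.coeffSpace E κ) :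
    c.pr E hE (c.gen E κ q a) ∈ W := by
  have ha := (Module.Basis.ofVectorSpace ℂ (c.coeffSpace E κ)).mem_span a
  have : Submodule.span ℂ (Set.range (Module.Basis.ofVectorSpace ℂ (c.coeffSpace E κ))) ≤
      W.comap ((c.pr E hE).restrictScalars ℂ ∘ₗ c.gen E κ q) := by
    rw [Submodule.span_le]
    rintro _ ⟨j, rfl⟩
    have := h j
    rwa [genBasis_apply] at this
  exact this ha

/-- The filtration of `M` is spanned by the basis vectors of degree `|κ⁻| + q - n` at most `ℓ`. -/
theorem filM_eq_span (ℓ : ℤ) : filM (c.zpow E) n ℓ = (Submodule.span ℂ (c.genBasis E hE ''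
    {k | ((∑ i, k.1.1.neg i + k.1.2 : ℕ) : ℤ) - n ≤ ℓ})).toAddSubgroup := by
  ext x
  rw [c.mem_filM_iff E hE, Submodule.mem_toAddSubgroup]
  rcases lt_or_ge (ℓ + n) 0 with h | h
  · have h1 : {k : Σ s : Σ κ : Shape E, Fin κ.roots.length,
        Module.Basis.ofVectorSpaceIndex ℂ (c.coeffSpace E s.1) |
        ((∑ i, k.1.1.neg i + k.1.2 : ℕ) : ℤ) - n ≤ ℓ} = ∅ := by
      refine Set.eq_empty_of_forall_notMem fun k hk => ?_
      have : (0 : ℤ) ≤ ((∑ i, k.1.1.neg i + k.1.2 : ℕ) : ℤ) := Int.natCast_nonneg _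
      rw [Set.mem_ofPred_eq] at hk
      omega
    rw [h1, Set.image_empty, Submodule.span_empty, Submodule.mem_bot]
    constructor
    · rintro ⟨P, hP, rfl⟩
      rw [orderLE_of_neg h] at hP
      rw [hP, map_zero]
    · rintro rfl
      exact ⟨0, by rw [map_zero]; exact zero_mem _, map_zero _⟩
  · obtain ⟨m, hm⟩ := Int.eq_ofNat_of_zero_le h
    simp only [hm, c.mem_orderLE]
    constructor
    · rintro ⟨P, hP, rfl⟩
      set W := Submodule.span ℂ (c.genBasis E hE ''
        {k | ((∑ i, k.1.1.neg i + k.1.2 : ℕ) : ℤ) - n ≤ ℓ}) with hW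
      have : c.genSpan E m ≤ W.comap ((c.pr E hE).restrictScalars ℂ) := by
        refine sup_le (Submodule.span_le.2 ?_) fun P hP => ?_
        · rintro _ ⟨κ, q, a, hq, rfl⟩
          refine c.pr_gen_mem_span E hE (fun j => Submodule.subset_span
            (Set.mem_image_of_mem _ ?_)) a
          change ((∑ i, κ.neg i + q : ℕ) : ℤ) - n ≤ ℓ
          omega
        · change c.pr E hE P ∈ W
          rw [(c.pr_eq_zero_iff E hE).2 hP]
          exact zero_mem W
      exact this (c.mem_genSpan_of_mem_ordLE E hE hP)
    · intro hx
      have : Submodule.span ℂ (c.genBasis E hE ''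
          {k | ((∑ i, k.1.1.neg i + k.1.2 : ℕ) : ℤ) - n ≤ ℓ}) ≤
          ((c.ordLE m).restrictScalars ℂ).map ((c.pr E hE).restrictScalars ℂ) := by
        rw [Submodule.span_le]
        rintro _ ⟨⟨⟨κ, q⟩, j⟩, hk, rfl⟩
        rw [genBasis_apply]
        refine Submodule.mem_map_of_mem (f := (c.pr E hE).restrictScalars ℂ)
          (c.ordLE_mono ?_ (c.gen_mem_ordLE E κ q _))
        rw [Set.mem_ofPred_eq] at hk
        dsimp only at hk
        omega
      exact this hx

/-- The basis of `M` by chains of generators: the step from a generator to the next one in its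
chain is a shifted residue, and raises the degree by one. -/
noncomputable def eigenBasis : FilteredEnd.EigenBasis (filM (c.zpow E) n) (c.residue E hE)
    (Σ s : Σ κ : Shape E, Fin κ.roots.length,
      Module.Basis.ofVectorSpaceIndex ℂ (c.coeffSpace E s.1)) where
  b := c.genBasis E hE
  r k := k.1.1.roots.get k.1.2
  deg k := ((∑ i, k.1.1.neg i + k.1.2 : ℕ) : ℤ) - n
  ht k := k.1.1.roots.length - k.1.2
  m := ∑ i, E i + 1
  ht_lt k := by
    have : k.1.1.roots.length ≤ ∑ i, E i := by
      rw [Shape.roots, Multiset.length_sort]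
      exact card_rootSet_le E _
    omega
  step := by
    rintro ⟨⟨κ, q⟩, j⟩
    have h : FilteredEnd.shift (c.residue E hE) ((κ.roots.get q : ℝ) : ℂ)
        (c.genBasis E hE ⟨⟨κ, q⟩, j⟩) = c.pr E hE (c.gen E κ (q + 1)
          (Module.Basis.ofVectorSpace ℂ (c.coeffSpace E κ) j)) := by
      have e := (c.pr E hE).map_smul_of_tower ((κ.roots.get q : ℝ) : ℂ)
        (c.gen E κ q (Module.Basis.ofVectorSpace ℂ (c.coeffSpace E κ) j))
      rw [FilteredEnd.shift_apply, genBasis_apply, residue_pr, ← theta, gen_succ, map_add, e,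
        add_sub_cancel_right]
    rw [h]
    by_cases hq : q + 1 < κ.roots.length
    · have h2 := c.genBasis_apply E hE ⟨κ, ⟨q + 1, hq⟩⟩ j
      rw [← h2]
      refine Submodule.subset_span (Set.mem_image_of_mem _ ⟨?_, ?_, ?_⟩)
      · have hs : κ.roots.SortedLE := (Multiset.pairwise_sort _ _).sortedLE
        exact hs.monotone_get (Fin.mk_le_mk.2 (Nat.le_succ _))
      · push_cast; ring
      · change κ.roots.length - (q + 1) < κ.roots.length - q
        omega
    · have h3 : (q : ℕ) + 1 = κ.roots.length := by omega
      rw [h3, (c.pr_eq_zero_iff E hE).2 (c.gen_length_mem E κ _)]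
      exact zero_mem _
  fil := c.filM_eq_span E hE

/-- In the reduced case the only root is zero. -/
theorem eigenBasis_r_eq_zero (h : ∀ i, E i ≤ 1) (k) : (c.eigenBasis E hE).r k = 0 := by
  refine rootSet_eq_zero E h (u := k.1.1.pos) ?_
  exact (Multiset.mem_sort _).1 (List.get_mem k.1.1.roots k.1.2)

end TaylorCoords

end LogDeRham

/-! ### Division of analytic functions -/

section Division

variable {E : Type*} [NormedAddCommGroup E] [NormedSpace ℂ E]

/-- The power series of the quotient of `f y - f (π y)` by `l y`, where `p` is the power series of
`f` and `y - π y = l y • v`: expand the difference of the values of `p (k + 1)` as a telescoping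
sum. -/
noncomputable def FormalMultilinearSeries.divSeries (p : FormalMultilinearSeries ℂ E ℂ)
    (π : E →L[ℂ] E) (v : E) : FormalMultilinearSeries ℂ E ℂ := fun k =>
  ∑ j : Fin (k + 1), ((p (k + 1)).compContinuousLinearMap
    (fun m => if m ≤ j then ContinuousLinearMap.id ℂ E else π)).curryMid j v

theorem FormalMultilinearSeries.mul_divSeries (p : FormalMultilinearSeries ℂ E ℂ) (π : E →L[ℂ] E)
    (v : E) (l : ℂ) (y : E) (h : y - π y = l • v) (k : ℕ) :
    l * p.divSeries π v k (fun _ => y) =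
      p (k + 1) (fun _ => y) - p (k + 1) (fun _ => π y) := by
  have h1 := (p (k + 1)).toMultilinearMap.map_sub_map_piecewise (fun _ => y) (fun _ => π y)
    Finset.univ
  rw [Finset.piecewise_univ] at h1
  refine Eq.trans ?_ h1.symm
  rw [divSeries, sum_apply, Finset.mul_sum]
  refine Finset.sum_congr rfl fun j _ => ?_
  rw [ContinuousMultilinearMap.curryMid_apply,
    ContinuousMultilinearMap.compContinuousLinearMap_apply]
  have h2 := (p (k + 1)).map_update_smul (fun m => if m < j then y else π y) j l v
  rw [smul_eq_mul, ← h] at h2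
  refine Eq.trans ?_ (h2.symm.trans ?_)
  · congr 2
    funext m
    induction m using j.succAboveCases with
    | x => simp
    | p m =>
      simp only [Fin.insertNth_apply_succAbove, Function.update_of_ne (Fin.succAbove_ne j m)]
      have : j.succAbove m ≤ j ↔ j.succAbove m < j :=
        ⟨fun h => lt_of_le_of_ne h (Fin.succAbove_ne j m), le_of_lt⟩
      simp only [this]
      split_ifs <;> rfl
  · refine congrArg (p (k + 1)) (funext fun m => ?_)
    by_cases hm : m = j
    · subst hm; simp
    · simp [hm, Ne.symm hm]

/-- The terms of the series grow at most like `(k + 1) (1 + ‖π‖)^(k + 1)` times those of `p`. -/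
theorem FormalMultilinearSeries.divSeries_radius_pos (p : FormalMultilinearSeries ℂ E ℂ)
    (hp : 0 < p.radius) (π : E →L[ℂ] E) (v : E) : 0 < (p.divSeries π v).radius := by
  obtain ⟨r, hr0, hr⟩ := ENNReal.lt_iff_exists_nnreal_btwn.1 hp
  have hr0' : (0 : ℝ) < r := by exact_mod_cast hr0
  obtain ⟨K, hK, hb⟩ := p.norm_mul_pow_le_of_lt_radius hr
  set C : ℝ := 1 + ‖π‖ with hC
  have hC1 : 1 ≤ C := by simp [hC]
  have hnorm : ∀ k, ‖p.divSeries π v k‖ ≤ (k + 1) * (‖p (k + 1)‖ * C ^ (k + 1) * ‖v‖) := by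
    intro k
    rw [divSeries]
    refine (norm_sum_le _ _).trans ?_
    have : ∀ j ∈ (Finset.univ : Finset (Fin (k + 1))), ‖((p (k + 1)).compContinuousLinearMap
        (fun m => if m ≤ j then ContinuousLinearMap.id ℂ E else π)).curryMid j v‖ ≤
        ‖p (k + 1)‖ * C ^ (k + 1) * ‖v‖ := by
      intro j _
      refine (ContinuousLinearMap.le_opNorm _ _).trans ?_
      rw [ContinuousMultilinearMap.norm_curryMid]
      refine mul_le_mul_of_nonneg_right ((ContinuousMultilinearMap.norm_compContinuousLinearMap_le
        _ _).trans (mul_le_mul_of_nonneg_left ?_ (norm_nonneg _))) (norm_nonneg _)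
      refine (Finset.prod_le_prod (g := fun _ => C) (fun m _ => norm_nonneg _)
        fun m _ => ?_).trans_eq (by simp)
      split_ifs
      · exact ContinuousLinearMap.norm_id_le.trans hC1
      · simp [hC]
    refine (Finset.sum_le_card_nsmul _ _ _ this).trans_eq ?_
    simp
  have hrC : 0 < (r : ℝ) / (2 * C) := by positivity
  refine lt_of_lt_of_le (ENNReal.coe_pos.2 (Real.toNNReal_pos.2 hrC))
    ((p.divSeries π v).le_radius_of_bound (K * C * ‖v‖ / r) fun k => ?_)
  rw [Real.coe_toNNReal _ hrC.le]
  have h2 : ((k : ℝ) + 1) / 2 ^ k ≤ 1 := by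
    rw [div_le_one (by positivity)]
    exact_mod_cast Nat.lt_two_pow_self
  calc ‖p.divSeries π v k‖ * (r / (2 * C)) ^ k
      ≤ (k + 1) * (‖p (k + 1)‖ * C ^ (k + 1) * ‖v‖) * (r / (2 * C)) ^ k :=
        mul_le_mul_of_nonneg_right (hnorm k) (by positivity)
    _ = ((k : ℝ) + 1) / 2 ^ k * ((‖p (k + 1)‖ * r ^ (k + 1)) * (C * ‖v‖ / r)) := by
        rw [div_pow, mul_pow]
        field_simp
        ring
    _ ≤ 1 * (K * (C * ‖v‖ / r)) := by
        refine mul_le_mul h2 ?_ (by positivity) zero_le_one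
        exact mul_le_mul_of_nonneg_right (hb _) (by positivity)
    _ = K * C * ‖v‖ / r := by ring

/-- Division with remainder of an analytic function by a linear form `l`. If `l v = 1` then the
remainder does not change along `v`. -/
theorem AnalyticAt.exists_eq_add_mul {f : E → ℂ} (hf : AnalyticAt ℂ f 0) (l : E →L[ℂ] ℂ) (v : E) :
    ∃ b : E → ℂ, AnalyticAt ℂ b 0 ∧ ∀ᶠ y in 𝓝 0, f y = f (y - l y • v) + l y * b y := by
  obtain ⟨p, R, hp⟩ := hf
  set π : E →L[ℂ] E := ContinuousLinearMap.id ℂ E - l.smulRight v with hπ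
  have hπ' : ∀ y, π y = y - l y • v := fun y => by simp [hπ]
  have hpos := p.divSeries_radius_pos (hp.r_pos.trans_le hp.r_le) π v
  have hq := (p.divSeries π v).hasFPowerSeriesOnBall hpos
  refine ⟨_, hq.analyticAt, ?_⟩
  have ht : Filter.Tendsto π (𝓝 0) (𝓝 0) := by simpa using π.continuous.tendsto 0
  have hB : Metric.eball (0 : E) R ∈ 𝓝 0 := Metric.eball_mem_nhds 0 hp.r_pos
  filter_upwards [hB, ht hB, Metric.eball_mem_nhds 0 hpos] with y h1 h2 h3
  have s1 := hp.hasSum h1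
  have s2 := hp.hasSum h2
  have s3 := (hq.hasSum h3).mul_left (l y)
  rw [zero_add] at s1 s2 s3
  have s4 := s1.sub s2
  rw [← hasSum_nat_add_iff' 1] at s4
  have e : ∀ k, l y * p.divSeries π v k (fun _ => y) =
      p (k + 1) (fun _ => y) - p (k + 1) (fun _ => π y) :=
    p.mul_divSeries π v (l y) y (by rw [hπ', sub_sub_cancel])
  simp only [e] at s3
  have h0 : p 0 (fun _ => y) = p 0 (fun _ => π y) := congrArg (p 0) (funext fun i => i.elim0)
  have := s3.unique s4
  rw [this, ← hπ']
  simp [h0]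

end Division

/-! ### Taylor coordinates from commuting derivations -/

namespace LogDeRham

section OfDerivations

variable {A : Type*} [CommRing A] [Algebra ℂ A] {N : ℕ} {z : Fin N → A}
  {d : Fin N → Derivation ℂ A A}

/-- The iterated derivatives of a function. -/
def iterDer (h : ∀ i j, Commute (d i : Module.End ℂ A) (d j : Module.End ℂ A))
    (β : Fin N → ℕ) : Module.End ℂ A :=
  multiPow (fun i => (d i : Module.End ℂ A)) h β

variable (h : ∀ i j, Commute (d i : Module.End ℂ A) (d j : Module.End ℂ A))

theorem iterDer_zero : iterDer h 0 = 1 := multiPow_zero _ _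

theorem iterDer_apply_d (β : Fin N → ℕ) (i : Fin N) (a : A) :
    iterDer h β (d i a) = iterDer h (β + Pi.single i 1) a := by
  rw [iterDer, iterDer, multiPow_add, multiPow_single]; rfl

theorem iterDer_add_single (β : Fin N → ℕ) (i : Fin N) (a : A) :
    iterDer h (β + Pi.single i 1) a = d i (iterDer h β a) := by
  rw [iterDer, iterDer, add_comm, multiPow_add, multiPow_single]; rfl

/-- The Leibniz rule for the product with a coordinate. -/
theorem iterDer_z_mul (hz : ∀ i j, d i (z j) = if i = j then 1 else 0) (β : Fin N → ℕ) (i : Fin N)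
    (a : A) : iterDer h β (z i * a) =
      z i * iterDer h β a + (β i : ℂ) • iterDer h (β - Pi.single i 1) a := by
  induction β using multiindex_induction with
  | h0 => simp [iterDer_zero]
  | h1 β j ih =>
    rw [iterDer_add_single, ih, map_add, Derivation.leibniz, hz, Derivation.map_smul,
      ← iterDer_add_single, ← iterDer_add_single]
    by_cases hij : j = i
    · subst hij
      rw [if_pos rfl, add_tsub_cancel_right]
      by_cases h0 : β j = 0
      · simp [h0]
      · have : β - Pi.single j 1 + Pi.single j 1 = β := by
          ext k
          by_cases hk : k = j
          · subst hk; simp; omega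
          · simp [hk]
        rw [this]
        simp only [Pi.add_apply, Pi.single_eq_same, smul_eq_mul, mul_one]
        push_cast
        rw [add_smul, one_smul]; ring
    · have : β - Pi.single i 1 + Pi.single j 1 = β + Pi.single j 1 - Pi.single i 1 := by
        ext k
        by_cases hk : k = i
        · subst hk; simp [Ne.symm hij]
        · simp [hk]
      rw [this, if_neg hij]
      simp [Ne.symm hij]

open Classical in
/-- The Taylor coefficients at the point `ev`: the values of the iterated derivatives, divided by
factorials. -/
noncomputable def taylorCoeff (ev : A →ₐ[ℂ] ℂ) (v : Fin N → ℤ) : A →ₗ[ℂ] ℂ :=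
  if ∀ i, 0 ≤ v i then
    (∏ i, ((v i).toNat.factorial : ℂ))⁻¹ • (ev.toLinearMap ∘ₗ iterDer h fun i => (v i).toNat) else 0

variable (ev : A →ₐ[ℂ] ℂ)

theorem taylorCoeff_natCast (β : Fin N → ℕ) (a : A) : taylorCoeff h ev (fun i => (β i : ℤ)) a =
    (∏ i, ((β i).factorial : ℂ))⁻¹ * ev (iterDer h β a) := by
  rw [taylorCoeff, if_pos fun i => Int.natCast_nonneg _]
  rfl

theorem taylorCoeff_of_neg {v : Fin N → ℤ} {i : Fin N} (hi : v i < 0) (a : A) :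
    taylorCoeff h ev v a = 0 := by
  rw [taylorCoeff, if_neg (fun h => absurd (h i) (not_le.2 hi)), LinearMap.zero_apply]

theorem prod_factorial_add_single (β : Fin N → ℕ) (i : Fin N) :
    ∏ j, (((β + Pi.single i 1 : Fin N → ℕ) j).factorial : ℂ) =
      ((β i : ℂ) + 1) * ∏ j, ((β j).factorial : ℂ) := by
  rw [← Finset.mul_prod_erase _ _ (Finset.mem_univ i),
    ← Finset.mul_prod_erase Finset.univ (fun j => ((β j).factorial : ℂ)) (Finset.mem_univ i)]
  have e : ∏ j ∈ Finset.univ.erase i, (((β + Pi.single i 1 : Fin N → ℕ) j).factorial : ℂ) =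
      ∏ j ∈ Finset.univ.erase i, ((β j).factorial : ℂ) :=
    Finset.prod_congr rfl fun j hj => by simp [Finset.ne_of_mem_erase hj]
  rw [e]
  simp only [Pi.add_apply, Pi.single_eq_same, Nat.factorial_succ]
  push_cast; ring

theorem exists_neg_or_eq_natCast (v : Fin N → ℤ) :
    (∃ i, v i < 0) ∨ ∃ β : Fin N → ℕ, v = fun i => (β i : ℤ) := by
  by_cases hv : ∀ i, 0 ≤ v i
  · exact Or.inr ⟨fun i => (v i).toNat, funext fun i => (Int.toNat_of_nonneg (hv i)).symm⟩
  · push Not at hv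
    exact Or.inl hv

theorem natCast_add_single (β : Fin N → ℕ) (i : Fin N) :
    (fun j => (((β + Pi.single i 1 : Fin N → ℕ) j : ℕ) : ℤ)) =
      (fun j => (β j : ℤ)) + Pi.single i 1 := by
  ext j
  by_cases hj : j = i
  · subst hj; simp
  · simp [hj]

theorem taylorCoeff_d (v : Fin N → ℤ) (i : Fin N) (a : A) :
    taylorCoeff h ev v (d i a) = (v i + 1) * taylorCoeff h ev (v + Pi.single i 1) a := by
  rcases exists_neg_or_eq_natCast v with ⟨j, hj⟩ | ⟨β, rfl⟩
  · rw [taylorCoeff_of_neg h ev hj]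
    by_cases hi : v i = -1
    · simp [hi]
    · rw [taylorCoeff_of_neg h ev (i := j), mul_zero]
      by_cases hji : j = i
      · subst hji; simp; omega
      · simpa [hji] using hj
  · have h0 : (β i : ℂ) + 1 ≠ 0 := Nat.cast_add_one_ne_zero (β i)
    rw [taylorCoeff_natCast, ← natCast_add_single, taylorCoeff_natCast, prod_factorial_add_single,
      iterDer_apply_d, Int.cast_natCast, mul_inv, ← mul_assoc, ← mul_assoc, mul_inv_cancel₀ h0,
      one_mul]

theorem taylorCoeff_z_mul (hz : ∀ i j, d i (z j) = if i = j then 1 else 0)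
    (hev : ∀ i, ev (z i) = 0) (v : Fin N → ℤ) (i : Fin N) (a : A) :
    taylorCoeff h ev v (z i * a) = taylorCoeff h ev (v - Pi.single i 1) a := by
  rcases exists_neg_or_eq_natCast v with ⟨j, hj⟩ | ⟨β, rfl⟩
  · rw [taylorCoeff_of_neg h ev hj, taylorCoeff_of_neg h ev (i := j)]
    by_cases hji : j = i
    · subst hji; simp; omega
    · simpa [hji] using hj
  · rw [taylorCoeff_natCast, iterDer_z_mul h hz, map_add, map_mul, hev, zero_mul, zero_add,
      map_smul,
      smul_eq_mul]
    by_cases h0 : β i = 0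
    · rw [taylorCoeff_of_neg h ev (i := i) (by simp [h0]), h0, Nat.cast_zero, zero_mul, mul_zero]
    · obtain ⟨γ, rfl⟩ : ∃ γ : Fin N → ℕ, β = γ + Pi.single i 1 := by
        refine ⟨β - Pi.single i 1, funext fun j => ?_⟩
        by_cases hj : j = i
        · subst hj; simp; omega
        · simp [hj]
      have h1 : (γ i : ℂ) + 1 ≠ 0 := Nat.cast_add_one_ne_zero (γ i)
      rw [natCast_add_single, add_sub_cancel_right, add_tsub_cancel_right, taylorCoeff_natCast,
        prod_factorial_add_single, mul_inv]
      simp only [Pi.add_apply, Pi.single_eq_same]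
      push_cast
      field_simp

/-- Coordinates from commuting derivations `d_i` dual to functions `z_i` that vanish at a point. -/
noncomputable def TaylorCoords.ofDerivations (hz : ∀ i j, d i (z j) = if i = j then 1 else 0)
    (hev : ∀ i, ev (z i) = 0) (hinj : ∀ a, (∀ β, ev (iterDer h β a) = 0) → a = 0)
    (hdiv : ∀ (i : Fin N) (a : A), ∃ r b, a = r + z i * b ∧ d i r = 0) : TaylorCoords A N where
  z := z
  d := d
  coeff := taylorCoeff h ev
  coeff_of_neg v i a hi := taylorCoeff_of_neg h ev hi a
  coeff_zero_one := by
    refine (taylorCoeff_natCast h ev 0 1).trans ?_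
    rw [iterDer_zero]
    simp
  coeff_d := taylorCoeff_d h ev
  coeff_z := taylorCoeff_z_mul h ev hz hev
  coeff_inj a ha := by
    refine hinj a fun β => ?_
    have := ha fun i => (β i : ℤ)
    rw [taylorCoeff_natCast] at this
    refine (mul_eq_zero.1 this).resolve_left (inv_ne_zero (Finset.prod_ne_zero_iff.2 fun i _ => ?_))
    exact_mod_cast Nat.factorial_ne_zero _
  div := hdiv

end OfDerivations

end LogDeRham

/-! ### Germs of analytic functions -/

namespace LogDeRham

section Analytic

variable {N : ℕ}

variable (N) in
/-- The functions on `ℂ^N` that are analytic at the origin. -/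
def analyticFns : Subalgebra ℂ ((Fin N → ℂ) → ℂ) where
  carrier := {f | AnalyticAt ℂ f 0}
  mul_mem' hf hg := AnalyticAt.mul hf hg
  add_mem' hf hg := AnalyticAt.add hf hg
  algebraMap_mem' _ := analyticAt_const

namespace analyticFns

/-- The partial derivative of a function. -/
noncomputable def partialDeriv (i : Fin N) (f : analyticFns N) : analyticFns N :=
  ⟨fun y => fderiv ℂ (f : (Fin N → ℂ) → ℂ) y (Pi.single i 1),
    ((ContinuousLinearMap.apply ℂ ℂ (Pi.single i 1 : Fin N → ℂ)).analyticAt _).comp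
      (AnalyticAt.fderiv f.2)⟩

theorem eventually_differentiableAt (f : analyticFns N) :
    ∀ᶠ y in 𝓝 0, DifferentiableAt ℂ (f : (Fin N → ℂ) → ℂ) y :=
  (AnalyticAt.eventually_analyticAt f.2).mono fun _ h => h.differentiableAt

theorem partialDeriv_congr (i : Fin N) {f g : analyticFns N}
    (h : (f : (Fin N → ℂ) → ℂ) =ᶠ[𝓝 0] g) :
    (partialDeriv i f : (Fin N → ℂ) → ℂ) =ᶠ[𝓝 0] partialDeriv i g :=
  h.fderiv.mono fun _ h => congrArg (fun L : (Fin N → ℂ) →L[ℂ] ℂ => L (Pi.single i 1)) h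

theorem partialDeriv_add (i : Fin N) (f g : analyticFns N) :
    (partialDeriv i (f + g) : (Fin N → ℂ) → ℂ) =ᶠ[𝓝 0]
      (partialDeriv i f + partialDeriv i g : analyticFns N) := by
  filter_upwards [eventually_differentiableAt f, eventually_differentiableAt g] with y hf hg
  exact congrArg (fun L : (Fin N → ℂ) →L[ℂ] ℂ => L (Pi.single i 1)) (fderiv_add hf hg)

theorem partialDeriv_smul (i : Fin N) (r : ℂ) (f : analyticFns N) :
    (partialDeriv i (r • f) : (Fin N → ℂ) → ℂ) =ᶠ[𝓝 0]
      (r • partialDeriv i f : analyticFns N) := by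
  filter_upwards [eventually_differentiableAt f] with y hf
  exact congrArg (fun L : (Fin N → ℂ) →L[ℂ] ℂ => L (Pi.single i 1)) (fderiv_const_smul hf r)

theorem partialDeriv_mul (i : Fin N) (f g : analyticFns N) :
    (partialDeriv i (f * g) : (Fin N → ℂ) → ℂ) =ᶠ[𝓝 0]
      (f * partialDeriv i g + g * partialDeriv i f : analyticFns N) := by
  filter_upwards [eventually_differentiableAt f, eventually_differentiableAt g] with y hf hg
  exact congrArg (fun L : (Fin N → ℂ) →L[ℂ] ℂ => L (Pi.single i 1)) (fderiv_mul hf hg)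

theorem partialDeriv_comm (i j : Fin N) (f : analyticFns N) :
    (partialDeriv i (partialDeriv j f) : (Fin N → ℂ) → ℂ) =ᶠ[𝓝 0]
      partialDeriv j (partialDeriv i f) := by
  filter_upwards [AnalyticAt.eventually_analyticAt f.2] with y hf
  have h := hf.contDiffAt.isSymmSndFDerivAt_of_omega (Pi.single i 1) (Pi.single j 1)
  have hd : DifferentiableAt ℂ (fderiv ℂ (f : (Fin N → ℂ) → ℂ)) y := hf.fderiv.differentiableAt
  have e : ∀ i j : Fin N, fderiv ℂ (fun y => fderiv ℂ (f : (Fin N → ℂ) → ℂ) y (Pi.single j 1)) y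
      (Pi.single i 1) = fderiv ℂ (fderiv ℂ (f : (Fin N → ℂ) → ℂ)) y (Pi.single i 1)
        (Pi.single j 1) := by
    intro i j
    rw [fderiv_clm_apply hd (differentiableAt_const _)]
    simp
  exact (e i j).trans (h.trans (e j i).symm)

/-- The coordinate functions. -/
def coord (i : Fin N) : analyticFns N :=
  ⟨fun y => y i, (ContinuousLinearMap.proj (R := ℂ) (φ := fun _ : Fin N => ℂ) i).analyticAt 0⟩

theorem partialDeriv_coord (i j : Fin N) :
    partialDeriv i (coord j) = if i = j then 1 else 0 := by
  refine Subtype.ext (funext fun y => ?_)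
  have : fderiv ℂ (fun y : Fin N → ℂ => y j) y = ContinuousLinearMap.proj j :=
    (ContinuousLinearMap.proj (R := ℂ) (φ := fun _ : Fin N => ℂ) j).fderiv
  change fderiv ℂ (fun y : Fin N → ℂ => y j) y (Pi.single i 1) = _
  rw [this]
  split_ifs with h
  · subst h; simp
  · simp [Ne.symm h]

theorem eventually_eq_zero_of_iteratedFDeriv {f : analyticFns N}
    (h : ∀ k, iteratedFDeriv ℂ k (f : (Fin N → ℂ) → ℂ) 0 = 0) :
    (f : (Fin N → ℂ) → ℂ) =ᶠ[𝓝 0] 0 := by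
  obtain ⟨p, r, hp⟩ := f.2
  filter_upwards [Metric.eball_mem_nhds 0 hp.r_pos] with y hy
  have := hp.hasSum_iteratedFDeriv hy
  simp only [h, zero_add] at this
  simpa using this.unique (by simp)

/-- An analytic function vanishes near the origin if it belongs to a class of functions that vanish
at the origin which is stable under partial derivatives. -/
theorem eventually_eq_zero_of_stable (S : Set (analyticFns N))
    (h0 : ∀ f ∈ S, (f : (Fin N → ℂ) → ℂ) 0 = 0) (hd : ∀ i, ∀ f ∈ S, partialDeriv i f ∈ S)
    {f : analyticFns N} (hf : f ∈ S) : (f : (Fin N → ℂ) → ℂ) =ᶠ[𝓝 0] 0 := by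
  refine eventually_eq_zero_of_iteratedFDeriv fun k => ?_
  induction k generalizing f with
  | zero =>
    ext m
    rw [iteratedFDeriv_zero_apply, h0 f hf]; rfl
  | succ k ih =>
    have key : ∀ (i : Fin N) (m : Fin k → Fin N → ℂ),
        iteratedFDeriv ℂ k (fun y => fderiv ℂ (f : (Fin N → ℂ) → ℂ) y) 0 m (Pi.single i 1) = 0 := by
      intro i m
      have h1 := ih (hd i f hf)
      have h2 := (ContinuousLinearMap.apply ℂ ℂ
        (Pi.single i 1 : Fin N → ℂ)).iteratedFDeriv_comp_left
        (AnalyticAt.contDiffAt (n := ω) (AnalyticAt.fderiv f.2)) (i := k) le_top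
      have h3 := congrArg (fun T : ContinuousMultilinearMap ℂ (fun _ : Fin k => Fin N → ℂ) ℂ => T m)
        (h2.symm.trans h1)
      exact h3
    ext m
    rw [iteratedFDeriv_succ_apply_right]
    have : m (Fin.last k) = ∑ i, m (Fin.last k) i • (Pi.single i 1 : Fin N → ℂ) := by
      ext j; simp [Finset.sum_apply, Pi.single_apply]
    rw [this, map_sum]
    exact Finset.sum_eq_zero fun i _ => by rw [map_smul, key, smul_zero]

/-- Division with remainder by a coordinate; the remainder does not depend on this coordinate. -/
theorem exists_div (i : Fin N) (f : analyticFns N) : ∃ r b : analyticFns N,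
    (f : (Fin N → ℂ) → ℂ) =ᶠ[𝓝 0] (r + coord i * b : analyticFns N) ∧
      (partialDeriv i r : (Fin N → ℂ) → ℂ) =ᶠ[𝓝 0] 0 := by
  set l : (Fin N → ℂ) →L[ℂ] ℂ := ContinuousLinearMap.proj i
  set v : Fin N → ℂ := Pi.single i 1
  set π : (Fin N → ℂ) →L[ℂ] (Fin N → ℂ) := ContinuousLinearMap.id ℂ _ - l.smulRight v with hπ
  have hπ' : ∀ y, π y = y - l y • v := fun y => by simp [hπ]
  obtain ⟨b, hb, h⟩ := AnalyticAt.exists_eq_add_mul f.2 l v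
  have h0 : π 0 = 0 := map_zero π
  have hr : AnalyticAt ℂ (fun y => (f : (Fin N → ℂ) → ℂ) (π y)) 0 :=
    AnalyticAt.fun_comp (by rw [h0]; exact f.2) (π.analyticAt 0)
  refine ⟨⟨_, hr⟩, ⟨b, hb⟩, ?_, ?_⟩
  · filter_upwards [h] with y hy
    rw [hy, ← hπ']; rfl
  · have ht : Filter.Tendsto π (𝓝 0) (𝓝 0) := by simpa using π.continuous.tendsto 0
    filter_upwards [ht (eventually_differentiableAt f)] with y hy
    change fderiv ℂ (fun y => (f : (Fin N → ℂ) → ℂ) (π y)) y (Pi.single i 1) = 0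
    have h1 := (HasFDerivAt.comp y (DifferentiableAt.hasFDerivAt (f := (f : (Fin N → ℂ) → ℂ)) hy)
        π.hasFDerivAt).fderiv
    have h2 : π (Pi.single i 1) = 0 := by simp [hπ', l, v]
    refine (congrArg (fun L : (Fin N → ℂ) →L[ℂ] ℂ => L (Pi.single i 1)) h1).trans ?_
    rw [ContinuousLinearMap.comp_apply, h2, map_zero]

end analyticFns

open analyticFns

variable {A : Type*} [CommRing A] [Algebra ℂ A] (π : analyticFns N →ₐ[ℂ] A)

/-- `A` is, through `π`, the algebra of germs at the origin of analytic functions. -/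
structure IsGermMap : Prop where
  surj : Function.Surjective π
  eq_zero_iff : ∀ f, π f = 0 ↔ (f : (Fin N → ℂ) → ℂ) =ᶠ[𝓝 0] 0

namespace IsGermMap

variable {π} (hπ : IsGermMap π)

theorem eq_iff {f g : analyticFns N} (hπ : IsGermMap π) :
    π f = π g ↔ (f : (Fin N → ℂ) → ℂ) =ᶠ[𝓝 0] g := by
  rw [← sub_eq_zero, ← map_sub, hπ.eq_zero_iff]
  exact Filter.eventuallyEq_iff_sub.symm

/-- The partial derivative of a germ. -/
noncomputable def dFun (hπ : IsGermMap π) (i : Fin N) (a : A) : A :=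
  π (partialDeriv i (Function.surjInv hπ.surj a))

theorem dFun_apply (i : Fin N) (f : analyticFns N) : hπ.dFun i (π f) = π (partialDeriv i f) :=
  hπ.eq_iff.2 (partialDeriv_congr i (hπ.eq_iff.1 (Function.surjInv_eq hπ.surj _)))

/-- The partial derivatives as derivations of the algebra of germs. -/
noncomputable def der (i : Fin N) : Derivation ℂ A A :=
  Derivation.mk' { toFun := hπ.dFun i
                   map_add' := fun a b => by
                    obtain ⟨f, rfl⟩ := hπ.surj a
                    obtain ⟨g, rfl⟩ := hπ.surj b
                    rw [← map_add, dFun_apply, dFun_apply, dFun_apply, ← map_add]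
                    exact hπ.eq_iff.2 (partialDeriv_add i f g)
                   map_smul' := fun r a => by
                    obtain ⟨f, rfl⟩ := hπ.surj a
                    rw [← map_smul, dFun_apply, dFun_apply, RingHom.id_apply, ← map_smul]
                    exact hπ.eq_iff.2 (partialDeriv_smul i r f) } (fun a b => by
    obtain ⟨f, rfl⟩ := hπ.surj a
    obtain ⟨g, rfl⟩ := hπ.surj b
    change hπ.dFun i (π f * π g) = π f * hπ.dFun i (π g) + π g * hπ.dFun i (π f)
    rw [← map_mul, dFun_apply, dFun_apply, dFun_apply, ← map_mul, ← map_mul, ← map_add]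
    exact hπ.eq_iff.2 (partialDeriv_mul i f g))

theorem der_apply (i : Fin N) (f : analyticFns N) : hπ.der i (π f) = π (partialDeriv i f) :=
  hπ.dFun_apply i f

/-- The value of a germ at the origin. -/
noncomputable def evalFun (hπ : IsGermMap π) (a : A) : ℂ := (Function.surjInv hπ.surj a).1 0

theorem evalFun_apply (f : analyticFns N) : hπ.evalFun (π f) = (f : (Fin N → ℂ) → ℂ) 0 :=
  (hπ.eq_iff.1 (Function.surjInv_eq hπ.surj (π f))).self_of_nhds

/-- The value at the origin as a homomorphism. -/
noncomputable def eval : A →ₐ[ℂ] ℂ :=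
  AlgHom.ofLinearMap
    { toFun := hπ.evalFun
      map_add' := fun a b => by
        obtain ⟨f, rfl⟩ := hπ.surj a
        obtain ⟨g, rfl⟩ := hπ.surj b
        rw [← map_add]
        simp only [evalFun_apply]
        rfl
      map_smul' := fun r a => by
        obtain ⟨f, rfl⟩ := hπ.surj a
        rw [← map_smul]
        simp only [evalFun_apply]
        rfl }
    (by
      rw [← map_one π]
      exact hπ.evalFun_apply 1)
    (fun a b => by
      obtain ⟨f, rfl⟩ := hπ.surj a
      obtain ⟨g, rfl⟩ := hπ.surj b
      rw [← map_mul]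
      simp only [LinearMap.coe_mk, AddHom.coe_mk, evalFun_apply]
      rfl)

theorem eval_apply (f : analyticFns N) : hπ.eval (π f) = (f : (Fin N → ℂ) → ℂ) 0 :=
  hπ.evalFun_apply f

theorem der_commute (i j : Fin N) :
    Commute (hπ.der i : Module.End ℂ A) (hπ.der j : Module.End ℂ A) := by
  refine LinearMap.ext fun a => ?_
  obtain ⟨f, rfl⟩ := hπ.surj a
  change hπ.der i (hπ.der j (π f)) = hπ.der j (hπ.der i (π f))
  simp only [der_apply]
  exact hπ.eq_iff.2 (partialDeriv_comm i j f)

/-- The Taylor coordinates on the algebra of germs. -/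
noncomputable def taylorCoords : TaylorCoords A N :=
  TaylorCoords.ofDerivations (z := fun i => π (coord i)) (d := hπ.der) hπ.der_commute hπ.eval
    (fun i j => by
      rw [der_apply, partialDeriv_coord]
      split_ifs
      · exact map_one π
      · exact map_zero π)
    (fun i => hπ.eval_apply _)
    (fun a ha => by
      obtain ⟨f, rfl⟩ := hπ.surj a
      rw [hπ.eq_zero_iff]
      refine eventually_eq_zero_of_stable
        {f | ∀ β, hπ.eval (iterDer hπ.der_commute β (π f)) = 0} ?_ ?_ ha
      · intro f hf
        have := hf 0
        rwa [iterDer_zero, Module.End.one_apply, eval_apply] at this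
      · intro i f hf β
        rw [← hπ.der_apply, iterDer_apply_d]
        exact hf _)
    (fun i a => by
      obtain ⟨f, rfl⟩ := hπ.surj a
      obtain ⟨r, b, h, hr⟩ := exists_div i f
      refine ⟨π r, π b, ?_, ?_⟩
      · rw [← map_mul, ← map_add]
        exact hπ.eq_iff.2 h
      · rw [der_apply]
        exact (hπ.eq_zero_iff _).2 hr)

end IsGermMap

end Analytic

end LogDeRham

/-! ### Degenerations -/

namespace FilteredEnd

theorem StrictLefschetz.of_subsingleton {S G : Type*} [Ring S] [AddCommGroup G] [Module S G]
    [Subsingleton G] (F : ℤ → AddSubgroup G) (N : Module.End S G) : StrictLefschetz F N :=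
  StrictLefschetz.of_strict ⟨1, Subsingleton.elim _ _⟩ fun a b =>
    AddSubgroup.ext fun x => by
      rw [Subsingleton.elim x 0]
      exact ⟨fun _ => zero_mem _, fun _ => zero_mem _⟩

end FilteredEnd

namespace LogDeRham

/-- `M` is annihilated by `t`, hence vanishes where `t` is a unit. -/
theorem subsingleton_M {A : Type*} [CommRing A] [Algebra ℂ A] {t : A} (ht : IsUnit t) (n : ℕ) :
    Subsingleton (M t n) := by
  rw [Submodule.Quotient.subsingleton_iff, eq_top_iff]
  intro α _
  obtain ⟨u, rfl⟩ := ht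
  refine Submodule.subset_span (Or.inr ⟨((u⁻¹ : Aˣ) : A) • α, ?_⟩)
  change (u : A) • ((u⁻¹ : Aˣ) : A) • α = α
  rw [smul_smul, Units.mul_inv, one_smul]

/-- The assertions at a point outside the central fibre. -/
theorem strictLefschetz_of_isUnit {A : Type*} [CommRing A] [Algebra ℂ A] {t : A} (ht : IsUnit t)
    (n : ℕ) (red : Prop) : (∃! R, IsResidue t n R) ∧ ∀ R, IsResidue t n R →
      (∀ α : ℝ, FilteredEnd.StrictLefschetz (FilteredEnd.eigF (filM t n) R α)
        (FilteredEnd.eigEnd R α)) ∧ (red → FilteredEnd.StrictLefschetz (filM t n) R) := by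
  have := subsingleton_M ht n
  refine ⟨⟨0, fun _ _ _ => Subsingleton.elim _ _, fun _ _ => LinearMap.ext fun _ =>
    Subsingleton.elim _ _⟩, fun R _ => ⟨fun α => ?_, fun _ =>
      FilteredEnd.StrictLefschetz.of_subsingleton _ _⟩⟩
  have : Subsingleton (FilteredEnd.EigMod R α) := (Submodule.mkQ_surjective _).subsingleton
  exact FilteredEnd.StrictLefschetz.of_subsingleton _ _

/-- The assertions at a point of the central fibre. Here `red` stands for the condition that the
central fibre is reduced. -/
theorem TaylorCoords.strictLefschetz {A : Type*} [CommRing A] [Algebra ℂ A] {n : ℕ}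
    (c : TaylorCoords A (n + 1)) {E : Fin (n + 1) → ℕ} (hE : E 0 ≠ 0) {t : A} (ht : t = c.zpow E)
    (red : Prop) (hred : red → ∀ k, E k ≤ 1) : (∃! R, IsResidue t n R) ∧ ∀ R, IsResidue t n R →
      (∀ α : ℝ, FilteredEnd.StrictLefschetz (FilteredEnd.eigF (filM t n) R α)
        (FilteredEnd.eigEnd R α)) ∧ (red → FilteredEnd.StrictLefschetz (filM t n) R) := by
  subst ht
  refine ⟨⟨c.residue E hE, c.isResidue_residue E hE, fun R hR => c.eq_residue E hE hR⟩,
    fun R hR => ?_⟩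
  obtain rfl := c.eq_residue E hE hR
  exact ⟨fun α => (c.eigenBasis E hE).strictLefschetz_eigEnd α, fun h =>
    (c.eigenBasis E hE).strictLefschetz_of_eigenvalues_eq_zero
      (c.eigenBasis_r_eq_zero E hE (hred h))⟩

end LogDeRham

namespace Degeneration

open LogDeRham LogDeRham.analyticFns

section Stalk

variable {m : ℕ} {X : Type*} [TopologicalSpace X] [ChartedSpace (Fin m → ℂ) X]

theorem isUnit_germ {f : X → ℂ} (hf : ContMDiff 𝓘(ℂ, Fin m → ℂ) 𝓘(ℂ, ℂ) ω f) {x : X}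
    (hx : f x ≠ 0) : IsUnit (germ hf x) := by
  have hinv : ContMDiffAt 𝓘(ℂ, Fin m → ℂ) 𝓘(ℂ, ℂ) ω (fun y => (f y)⁻¹) x :=
    ContMDiffAt.comp x ((contDiffAt_inv ℂ hx).contMDiffAt) (hf x)
  refine IsUnit.of_mul_eq_one (⟨_, _, hinv, rfl⟩ : stalk m x) (Subtype.ext ?_)
  refine Filter.Germ.coe_eq.2 ?_
  filter_upwards [hf.continuous.continuousAt.eventually_ne hx] with y hy
  exact mul_inv_cancel₀ hy

/-- The pullback of analytic functions along a holomorphic map `ψ` to `ℂ^m`. -/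
def pullback {x : X} {ψ : X → Fin m → ℂ} (hψ : ContMDiffAt 𝓘(ℂ, Fin m → ℂ) 𝓘(ℂ, Fin m → ℂ) ω ψ x)
    (h0 : ψ x = 0) : analyticFns m →ₐ[ℂ] stalk m x where
  toFun f := ⟨((fun y => (f : (Fin m → ℂ) → ℂ) (ψ y) : X → ℂ) : Filter.Germ (𝓝 x) ℂ), _,
    ContMDiffAt.comp x (by rw [h0]; exact (AnalyticAt.contDiffAt f.2).contMDiffAt) hψ, rfl⟩
  map_one' := rfl
  map_mul' _ _ := rfl
  map_zero' := rfl
  map_add' _ _ := rfl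
  commutes' r := by
    refine Subtype.ext ?_
    change _ = algebraMap ℂ (Filter.Germ (𝓝 x) ℂ) r
    rw [Algebra.algebraMap_eq_smul_one]
    exact congrArg _ (funext fun a => by simp)

/-- A chart `ψ` centred at `x`, with inverse `χ`, identifies the stalk with the germs of analytic
functions. -/
theorem isGermMap_pullback {x : X} {ψ : X → Fin m → ℂ}
    (hψ : ContMDiffAt 𝓘(ℂ, Fin m → ℂ) 𝓘(ℂ, Fin m → ℂ) ω ψ x) (h0 : ψ x = 0)
    {χ : (Fin m → ℂ) → X} (hχ : ContMDiffAt 𝓘(ℂ, Fin m → ℂ) 𝓘(ℂ, Fin m → ℂ) ω χ 0) (h1 : χ 0 = x)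
    (h2 : ∀ᶠ y in 𝓝 x, χ (ψ y) = y) (h3 : ∀ᶠ v in 𝓝 0, ψ (χ v) = v) :
    IsGermMap (pullback hψ h0) where
  surj := by
    rintro ⟨_, g, hg, rfl⟩
    have : ContMDiffAt 𝓘(ℂ, Fin m → ℂ) 𝓘(ℂ, ℂ) ω (g ∘ χ) 0 :=
      ContMDiffAt.comp 0 (by rw [h1]; exact hg) hχ
    refine ⟨⟨g ∘ χ, (contMDiffAt_iff_contDiffAt.1 this).analyticAt⟩, Subtype.ext ?_⟩
    exact Filter.Germ.coe_eq.2 (h2.mono fun y hy => congrArg g hy)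
  eq_zero_iff f := by
    rw [Subtype.ext_iff]
    refine Filter.Germ.coe_eq.trans ⟨fun h => ?_, fun h => ?_⟩
    · have ht : Filter.Tendsto χ (𝓝 0) (𝓝 x) := by
        have := hχ.continuousAt.tendsto
        rwa [h1] at this
      filter_upwards [ht.eventually h, h3] with v hv hv'
      rw [hv'] at hv
      exact hv
    · have ht : Filter.Tendsto ψ (𝓝 x) (𝓝 0) := by
        have := hψ.continuousAt.tendsto
        rwa [h0] at this
      exact ht.eventually h

end Stalk

/-- At a point of the central fibre the germ of `f` is a monomial in suitable Taylor coordinates. -/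
theorem exists_taylorCoords {n : ℕ} {X : Type*} [TopologicalSpace X]
    [ChartedSpace (Fin (n + 1) → ℂ) X]
    [IsManifold 𝓘(ℂ, Fin (n + 1) → ℂ) ω X] {f : X → ℂ}
    (hf : ContMDiff 𝓘(ℂ, Fin (n + 1) → ℂ) 𝓘(ℂ, ℂ) ω f) {I : Type*} [Fintype I] {Y : I → Set X}
    {e : I → ℕ} (hY : IsSNC (n + 1) f Y e) {x : X} (hx : f x = 0) :
    ∃ (c : TaylorCoords (stalk (n + 1) x) (n + 1)) (E : Fin (n + 1) → ℕ),
      germ hf x = c.zpow E ∧ E 0 ≠ 0 ∧ ((∀ i, e i = 1) → ∀ k, E k ≤ 1) := by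
  classical
  obtain ⟨φ, hφ, hxs, σ, hσ, hYσ, -, hprod⟩ := hY.chart x hx
  obtain ⟨i₀, hi₀⟩ : ∃ i, x ∈ Y i := by
    have : x ∈ f ⁻¹' {0} := hx
    rw [hY.zeros] at this
    exact Set.mem_iUnion.1 this
  -- The coordinate that vanishes on one of the components through `x` is moved to index `0`.
  set τ : Equiv.Perm (Fin (n + 1)) := Equiv.swap 0 (σ i₀) with hτ
  set L : (Fin (n + 1) → ℂ) → Fin (n + 1) → ℂ := fun v k => v (τ k) - φ x (τ k) with hL
  set L' : (Fin (n + 1) → ℂ) → Fin (n + 1) → ℂ := fun v k => v (τ.symm k) + φ x k with hL'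
  have hLs : ContDiff ℂ ω L := contDiff_pi.2 fun k => (contDiff_apply ℂ ℂ (τ k)).sub contDiff_const
  have hLs' : ContDiff ℂ ω L' :=
    contDiff_pi.2 fun k => (contDiff_apply ℂ ℂ (τ.symm k)).add contDiff_const
  have hLL' : ∀ v, L (L' v) = v := fun v => funext fun k => by simp [hL, hL']
  have hL'L : ∀ v, L' (L v) = v := fun v => funext fun k => by simp [hL, hL']
  have hψ0 : L (φ x) = 0 := funext fun k => sub_self _
  have hL'0 : L' 0 = φ x := by rw [← hψ0, hL'L]
  have hψ : ContMDiffAt 𝓘(ℂ, Fin (n + 1) → ℂ) 𝓘(ℂ, Fin (n + 1) → ℂ) ω (fun y => L (φ y)) x :=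
    hLs.contMDiff.contMDiffAt.comp x
      ((contMDiffOn_of_mem_maximalAtlas hφ).contMDiffAt (φ.open_source.mem_nhds hxs))
  have hφs : ContMDiffAt 𝓘(ℂ, Fin (n + 1) → ℂ) 𝓘(ℂ, Fin (n + 1) → ℂ) ω φ.symm (φ x) :=
    (contMDiffOn_symm_of_mem_maximalAtlas hφ).contMDiffAt
      (φ.open_target.mem_nhds (φ.map_source hxs))
  have hχ : ContMDiffAt 𝓘(ℂ, Fin (n + 1) → ℂ) 𝓘(ℂ, Fin (n + 1) → ℂ) ω
      (fun v => φ.symm (L' v)) 0 :=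
    ContMDiffAt.comp 0 (by rw [hL'0]; exact hφs) hLs'.contMDiff.contMDiffAt
  have hg := isGermMap_pullback hψ hψ0 hχ (by rw [hL'0, φ.left_inv hxs])
    (by
      filter_upwards [φ.open_source.mem_nhds hxs] with y hy
      rw [hL'L, φ.left_inv hy])
    (by
      have : Filter.Tendsto L' (𝓝 0) (𝓝 (φ x)) := by
        rw [← hL'0]; exact hLs'.continuous.tendsto 0
      filter_upwards [this (φ.open_target.mem_nhds (φ.map_source hxs))] with v hv
      rw [φ.right_inv hv, hLL'])
  -- Distinct components through `x` have distinct coordinates, so the sum has at most one term.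
  set E : Fin (n + 1) → ℕ := fun k => ∑ i with x ∈ Y i ∧ σ i = τ k, e i with hE
  refine ⟨hg.taylorCoords, E, ?_, ?_, ?_⟩
  · have hz : hg.taylorCoords.zpow E = pullback hψ hψ0 (∏ k, coord k ^ E k) := by
      rw [map_prod]
      exact Finset.prod_congr rfl fun k _ => (map_pow _ _ _).symm
    rw [hz]
    refine Subtype.ext (Filter.Germ.coe_eq.2 ?_)
    filter_upwards [φ.open_source.mem_nhds hxs] with y hy
    have hval : ((∏ k, coord k ^ E k : analyticFns (n + 1)) : (Fin (n + 1) → ℂ) → ℂ) (L (φ y)) =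
        ∏ k, L (φ y) k ^ E k := by
      rw [SubmonoidClass.coe_finsetProd, Finset.prod_apply]
      rfl
    rw [hval, hprod y hy, ← Finset.prod_fiberwise _ (fun i => τ.symm (σ i))]
    refine Finset.prod_congr rfl fun k _ => ?_
    rw [hE, ← Finset.prod_pow_eq_pow_sum, Finset.filter_filter]
    simp only [Equiv.symm_apply_eq]
    refine Finset.prod_congr rfl fun i hi => ?_
    obtain ⟨h1, h2⟩ := (Finset.mem_filter.1 hi).2
    have h3 : φ x (σ i) = 0 := (hYσ i h1 x hxs).1 h1
    rw [hL]
    dsimp only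
    rw [← h2, h3, sub_zero]
  · have h1 : e i₀ ≤ E 0 :=
      Finset.single_le_sum (f := e) (fun _ _ => Nat.zero_le _) (by simp [hi₀, hτ])
    have := hY.pos i₀
    omega
  · intro he k
    rw [hE]
    simp only [he, Finset.sum_const, smul_eq_mul, mul_one]
    refine Finset.card_le_one.2 fun i hi j hj => ?_
    obtain ⟨h1, h2⟩ := (Finset.mem_filter.1 hi).2
    obtain ⟨h3, h4⟩ := (Finset.mem_filter.1 hj).2
    exact hσ h1 h3 (h2.trans h4.symm)

end Degeneration

theorem mainTheorem8 {n : ℕ} {X : Type*} [TopologicalSpace X] [T2Space X]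
    [SecondCountableTopology X] [ChartedSpace (Fin (n + 1) → ℂ) X]
    [IsManifold (modelWithCornersSelf ℂ (Fin (n + 1) → ℂ)) ω X]
    (f : X → Metric.ball (0 : ℂ) 1) (hproper : IsProperMap f)
    (hf : ContMDiff 𝓘(ℂ, Fin (n + 1) → ℂ) 𝓘(ℂ, ℂ) ω fun x => (f x : ℂ))
    (hsmooth : ∀ x, (f x : ℂ) ≠ 0 →
      mfderiv 𝓘(ℂ, Fin (n + 1) → ℂ) 𝓘(ℂ, ℂ) (fun x => (f x : ℂ)) x ≠ 0)
    {I : Type*} [Fintype I] (Y : I → Set X) (e : I → ℕ)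
    (hY : Degeneration.IsSNC (n + 1) (fun x => (f x : ℂ)) Y e) (x : X) :
    (∃! R, LogDeRham.IsResidue (Degeneration.germ hf x) n R) ∧
    ∀ R, LogDeRham.IsResidue (Degeneration.germ hf x) n R →
      (∀ α : ℝ, FilteredEnd.StrictLefschetz
        (FilteredEnd.eigF (LogDeRham.filM (Degeneration.germ hf x) n) R α)
        (FilteredEnd.eigEnd R α)) ∧
      ((∀ i, e i = 1) →
        FilteredEnd.StrictLefschetz (LogDeRham.filM (Degeneration.germ hf x) n) R) := by
  by_cases hx : (f x : ℂ) = 0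
  · obtain ⟨c, E, ht, hE, hred⟩ := Degeneration.exists_taylorCoords hf hY hx
    exact c.strictLefschetz hE ht _ hred
  · exact LogDeRham.strictLefschetz_of_isUnit (Degeneration.isUnit_germ hf hx) n _
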